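/- **Reflections.** All Hilbert spaces below are complex and finite dimensional; a reflection is a self-adjoint operator $R$ with $R^2=\mathbb 1$. For an operator $T$ on one player's space, $T_D$ ($D\in\{A,B\}$) denotes $T$ acting on player $D$'s tensor factor. **Strategies.** Let $n\ge 2$. A strategy for two players $A$ (Alice) and $B$ (Bob) consists of finite-dimensional Hilbert spaces $\mathcal H_A,\mathcal H_B$, a unit vector $|\psi\rangle\in\mathcal H_A\otimes\mathcal H_B$, and, for each $D\in\{A,B\}$, reflections $(Z_i)_D,(X_i)_D$ on $\mathcal H_D$ ($1\le i\le n$) and, for all $i<j$ and $b,c\in\{0,1\}$, a complete set of mutually orthogonal projections $\{(\Pi^{(i,b),(j,c)}_{x,y})_D : x,y=\pm1\}$ on $\mathcal H_D$. On question $(i,0)$ player $D$ measures $(Z_i)_D$, on question $(i,1)$ she measures $(X_i)_D$, and answers the eigenvalue; on question $((i,b),(j,c))$ with $i<j$ she measures the projections and answers $(x,y)$. **Protocol.** The verifier runs one of three sub-protocols, each with probability $1/3$. (1) Choose uniform $i\in[n]$, $a\in\{0,1\}$, send $(i,a)$ to both players, accept iff their answers $x,y$ are equal. (2) Choose uniform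 $i\ne j$ in $[n]$ and bits $a,b,c$; send $(i,a)$ to Alice and $(i,b),(j,c)$, sorted by index, to Bob; if Alice answers $x$ and Bob answers $y$ to $(i,b)$ and $y'$ to $(j,c)$, accept iff $xy=(-1)^{ab}$. (3) The same as (2) with the roles of Alice and Bob exchanged. Let $\omega_{\mathrm{opt}}=\frac13\left(1+2\cos^2\frac\pi8\right)$. **Theorem.** There is a universal constant $C>0$ such that the following holds for all $n\ge2$, all $\delta>0$ and every strategy that is accepted with probability at least $\omega_{\mathrm{opt}}-\delta$. There exist finite-dimensional Hilbert spaces $\mathcal H'_A\supseteq\mathcal H_A$, $\mathcal H'_B\supseteq\mathcal H_B$ and, for each $D$ and $i$, an extension of $(Z_i)_D$ to $\mathcal H'_D$ by a direct sum with another reflection (still denoted $(Z_i)_D$) and a reflection $(\bar X_i)_D$ on $\mathcal H'_D$, such that for $D\in\{A,B\}$ 1. $Z_i\bar X_i+\bar X_iZ_i=0$ on $\mathcal H'_D$ and $\|(X_i-\bar X_i)_D|\psi\rangle\|\le C\,n\sqrt\delta$ for all $i$; 2. $\|[P_i,Q_j]_D|\psi\rangle\|\le C\,n\sqrt\delta$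 for all $i\ne j$ and $P,Q\in\{\bar X,Z\}$; 3. $\|(P_i)_A\otimes(P_i)_B|\psi\rangle-|\psi\rangle\|\le C\,n\sqrt\delta$ for all $i$ and $P\in\{\bar X,Z\}$; 4. (robustness) let $|\mathrm{EPR}\rangle=\frac1{\sqrt2}(|00\rangle+|11\rangle)$ and $|\psi'\rangle=|\psi\rangle\otimes|\mathrm{EPR}\rangle^{\otimes n}_{A'}\otimes|\mathrm{EPR}\rangle^{\otimes n}_{B'}$, where the first $n$ EPR states are local to Alice (register $A'$) and the others local to Bob (register $B'$). There are finite-dimensional Hilbert spaces $\hat{\mathcal H}_A,\hat{\mathcal H}_B$, unitaries $U_D:\mathcal H'_D\otimes(\mathbb C^2)^{\otimes 2n}_{D'}\to(\mathbb C^2)^{\otimes n}\otimes\hat{\mathcal H}_D$ and a unit vector $|\mathrm{extra}\rangle\in\hat{\mathcal H}_A\otimes\hat{\mathcal H}_B$ such that, writing $|\Phi\rangle=|\mathrm{EPR}\rangle^{\otimes n}_{AB}\otimes|\mathrm{extra}\rangle$, where the $n$ EPR states are shared between Alice's and Bob's $n$ qubits, $$\|U_A\otimes U_B|\psi'\rangle-|\Phi\rangle\|\le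 C\,n^{5/2}\sqrt\delta,$$ $$\big\|\big(U(\bar X_j\otimes\mathbb 1)U^\dagger-\sigma^x_j\otimes\mathbb 1\big)_D|\Phi\rangle\big\|\le C\,n^{5/2}\sqrt\delta,\qquad \big\|\big(U(Z_j\otimes\mathbb 1)U^\dagger-\sigma^z_j\otimes\mathbb 1\big)_D|\Phi\rangle\big\|\le C\,n^{5/2}\sqrt\delta$$ for all $j\in[n]$ and $D\in\{A,B\}$. -/

import Mathlib

open scoped TensorProduct

universe u v

namespace EPRTest

noncomputable section

/-! ## Strategies -/

/-- A reflection: a self-adjoint operator squaring to the identity. -/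
structure IsReflection {H : Type*} [NormedAddCommGroup H] [InnerProductSpace ℂ H]
    (R : Module.End ℂ H) : Prop where
  isSymmetric : LinearMap.IsSymmetric R
  mul_self : R * R = 1

/-- A question about a single qubit: an index `i` and a bit `a`. -/
abbrev Question (n : ℕ) : Type := Fin n × Fin 2

/-- The measurements of one player on the local space `H`.  On a single question `(i, 0)` the player
measures the reflection `Z i`, on `(i, 1)` the reflection `X i`.  On a pair of questions `q = (i, b)`
and `r = (j, c)` with `i < j` the player measures the complete family of orthogonal projections
`proj q r x y`, `x, y = ±1`, and answers `x` to `q` and `y` to `r`. (The values of `proj q r`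
for `i ≥ j` are never used.) -/
structure PlayerStrategy (n : ℕ) (H : Type*) [NormedAddCommGroup H] [InnerProductSpace ℂ H] where
  Z : Fin n → Module.End ℂ H
  X : Fin n → Module.End ℂ H
  Z_refl : ∀ i, IsReflection (Z i)
  X_refl : ∀ i, IsReflection (X i)
  proj : Question n → Question n → ℤˣ → ℤˣ → Module.End ℂ H
  proj_isSymmetricProjection : ∀ q r : Question n, q.1 < r.1 → ∀ x y,
    LinearMap.IsSymmetricProjection (proj q r x y)
  proj_orthogonal : ∀ q r : Question n, q.1 < r.1 → ∀ x y x' y', (x, y) ≠ (x', y') →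
    proj q r x y * proj q r x' y' = 0
  proj_complete : ∀ q r : Question n, q.1 < r.1 → ∑ x, ∑ y, proj q r x y = 1

namespace PlayerStrategy

variable {n : ℕ} {H : Type*} [NormedAddCommGroup H] [InnerProductSpace ℂ H]

/-- The reflection measured on a single question. -/
def obs (s : PlayerStrategy n H) (q : Question n) : Module.End ℂ H :=
  if q.2 = 0 then s.Z q.1 else s.X q.1

/-- The projection onto the `x`-eigenspace of `s.obs q`: the event of answering `x` to the single
question `q`. -/
def single (s : PlayerStrategy n H) (q : Question n) (x : ℤˣ) : Module.End ℂ H :=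
  (1 / 2 : ℂ) • (1 + ((x : ℤ) : ℂ) • s.obs q)

/-- The event of answering `y` to `q` and `y'` to `r`, when asked about two distinct indices;
the player receives the two questions sorted by index. -/
def double (s : PlayerStrategy n H) (q r : Question n) (y y' : ℤˣ) : Module.End ℂ H :=
  if q.1 < r.1 then s.proj q r y y' else s.proj r q y' y

end PlayerStrategy

/-- A strategy for the two players: a shared unit vector and the measurements of each player. -/
structure Strategy (n : ℕ) (HA HB : Type*) [NormedAddCommGroup HA] [InnerProductSpace ℂ HA]
    [NormedAddCommGroup HB] [InnerProductSpace ℂ HB] where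
  ψ : HA ⊗[ℂ] HB
  norm_ψ : ‖ψ‖ = 1
  alice : PlayerStrategy n HA
  bob : PlayerStrategy n HB

/-! ## The protocol -/

/-- The expectation `⟨ψ, T ψ⟩` of the operator `T` in the state `ψ`. -/
def expval {V : Type*} [NormedAddCommGroup V] [InnerProductSpace ℂ V] (ψ : V)
    (T : Module.End ℂ V) : ℝ :=
  (inner ℂ ψ (T ψ)).re

namespace Strategy

variable {n : ℕ} {HA HB : Type*} [NormedAddCommGroup HA] [InnerProductSpace ℂ HA]
  [NormedAddCommGroup HB] [InnerProductSpace ℂ HB]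

/-- Born rule: the joint probability `⟨ψ, (E ⊗ F) ψ⟩` of the local events `E` and `F`. -/
def prob (S : Strategy n HA HB) (E : Module.End ℂ HA) (F : Module.End ℂ HB) : ℝ :=
  expval S.ψ (TensorProduct.map E F)

/-- Sub-protocol 1: uniform `i`, `a`; both players get `(i, a)`; accept iff `x = y`. -/
def accept₁ (S : Strategy n HA HB) : ℝ :=
  (∑ i : Fin n, ∑ a : Fin 2, ∑ x : ℤˣ, ∑ y : ℤˣ,
    if x = y then S.prob (S.alice.single (i, a) x) (S.bob.single (i, a) y) else 0) / (n * 2)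

/-- Sub-protocol 2: uniform `i ≠ j`, `a`, `b`, `c`; Alice gets `(i, a)` and answers `x`, Bob gets
`(i, b)` and `(j, c)` and answers `y` and `y'`; accept iff `x y = (-1) ^ (a b)`. -/
def accept₂ (S : Strategy n HA HB) : ℝ :=
  (∑ i : Fin n, ∑ j : Fin n, if i = j then 0 else
    ∑ a : Fin 2, ∑ b : Fin 2, ∑ c : Fin 2, ∑ x : ℤˣ, ∑ y : ℤˣ, ∑ y' : ℤˣ,
      if x * y = (-1) ^ ((a : ℕ) * (b : ℕ)) then
        S.prob (S.alice.single (i, a) x) (S.bob.double (i, b) (j, c) y y') else 0)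
    / (n * (n - 1) * 8)

/-- Sub-protocol 3: as sub-protocol 2, with the roles of Alice and Bob exchanged. -/
def accept₃ (S : Strategy n HA HB) : ℝ :=
  (∑ i : Fin n, ∑ j : Fin n, if i = j then 0 else
    ∑ a : Fin 2, ∑ b : Fin 2, ∑ c : Fin 2, ∑ x : ℤˣ, ∑ y : ℤˣ, ∑ y' : ℤˣ,
      if x * y = (-1) ^ ((a : ℕ) * (b : ℕ)) then
        S.prob (S.alice.double (i, b) (j, c) y y') (S.bob.single (i, a) x) else 0)
    / (n * (n - 1) * 8)

/-- The probability that the verifier accepts: each sub-protocol is run with probability `1/3`. -/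
def acceptProb (S : Strategy n HA HB) : ℝ :=
  (S.accept₁ + S.accept₂ + S.accept₃) / 3

end Strategy

/-- The acceptance probability of the honest strategy. -/
def omegaOpt : ℝ := (1 + 2 * Real.cos (Real.pi / 8) ^ 2) / 3

/-! ## Extended spaces and operators -/

/-- A space `H'` extending the player's space `H` (through an isometric embedding `ι`), with
reflections `Z i` on `H'` that extend the player's `Z i` by a direct sum with a reflection
of the orthogonal complement (for a self-adjoint operator this is the equation
`Z i ∘ ι = ι ∘ s.Z i`), and reflections `X i` on `H'` that anticommute exactly with `Z i`. -/
structure Extension {n : ℕ} {H : Type*} [NormedAddCommGroup H] [InnerProductSpace ℂ H]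
    (s : PlayerStrategy n H) (H' : Type*) [NormedAddCommGroup H'] [InnerProductSpace ℂ H'] where
  ι : H →ₗᵢ[ℂ] H'
  Z : Fin n → Module.End ℂ H'
  X : Fin n → Module.End ℂ H'
  Z_refl : ∀ i, IsReflection (Z i)
  X_refl : ∀ i, IsReflection (X i)
  Z_extends : ∀ i v, Z i (ι v) = ι (s.Z i v)
  anticomm : ∀ i, Z i * X i + X i * Z i = 0

/-- `e.obs 0 i` is the operator `Z i` and `e.obs 1 i` the operator `X i` of the extension. -/
def Extension.obs {n : ℕ} {H : Type*} [NormedAddCommGroup H] [InnerProductSpace ℂ H]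
    {s : PlayerStrategy n H} {H' : Type*} [NormedAddCommGroup H'] [InnerProductSpace ℂ H']
    (e : Extension s H') (P : Fin 2) (i : Fin n) : Module.End ℂ H' :=
  if P = 0 then e.Z i else e.X i

section Local

variable {H K : Type*} [NormedAddCommGroup H] [InnerProductSpace ℂ H]
  [NormedAddCommGroup K] [InnerProductSpace ℂ K]

/-- `T ⊗ 1`. -/
def left (K : Type*) [NormedAddCommGroup K] [InnerProductSpace ℂ K] (T : Module.End ℂ H) :
    Module.End ℂ (H ⊗[ℂ] K) :=
  TensorProduct.map T 1

/-- `1 ⊗ T`. -/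
def right (H : Type*) [NormedAddCommGroup H] [InnerProductSpace ℂ H] (T : Module.End ℂ K) :
    Module.End ℂ (H ⊗[ℂ] K) :=
  TensorProduct.map 1 T

end Local

/-! ## Qubits -/

/-- `n` qubits, `(ℂ²)^{⊗ n}`, with the computational basis indexed by bit strings. -/
abbrev Qubits (n : ℕ) : Type := EuclideanSpace ℂ (Fin n → Fin 2)

/-- The state `|EPR⟩^{⊗ n} = 2^{-n/2} ∑ₓ |x⟩ ⊗ |x⟩`, the `j`-th qubit of the left factor being
paired with the `j`-th qubit of the right factor. -/
def eprState (n : ℕ) : Qubits n ⊗[ℂ] Qubits n :=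
  ((1 / Real.sqrt (2 ^ n) : ℝ) : ℂ) •
    ∑ x : Fin n → Fin 2, EuclideanSpace.single x (1 : ℂ) ⊗ₜ[ℂ] EuclideanSpace.single x (1 : ℂ)

/-- The matrix `M` acting on the `j`-th of `n` qubits. -/
def onQubit {n : ℕ} (M : Matrix (Fin 2) (Fin 2) ℂ) (j : Fin n) : Module.End ℂ (Qubits n) :=
  Matrix.toEuclideanLin (Matrix.of fun x y : Fin n → Fin 2 =>
    if ∀ k, k ≠ j → x k = y k then M (x j) (y j) else 0)

/-- The Pauli matrices: `σ^z` for `P = 0`, `σ^x` for `P = 1`. -/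
def pauli (P : Fin 2) : Matrix (Fin 2) (Fin 2) ℂ :=
  if P = 0 then !![1, 0; 0, -1] else !![0, 1; 1, 0]

/-- Two bipartite vectors side by side: from `φ ∈ A ⊗ B` and `χ ∈ A' ⊗ B'` the vector
`φ ⊗ χ`, regarded as an element of `(A ⊗ A') ⊗ (B ⊗ B')`. -/
def juxt {A B A' B' : Type*} [NormedAddCommGroup A] [InnerProductSpace ℂ A]
    [NormedAddCommGroup B] [InnerProductSpace ℂ B] [NormedAddCommGroup A']
    [InnerProductSpace ℂ A'] [NormedAddCommGroup B'] [InnerProductSpace ℂ B']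
    (φ : A ⊗[ℂ] B) (χ : A' ⊗[ℂ] B') : (A ⊗[ℂ] A') ⊗[ℂ] (B ⊗[ℂ] B') :=
  TensorProduct.tensorTensorTensorComm ℂ A B A' B' (φ ⊗ₜ[ℂ] χ)

/-- The `2n` ancilla qubits of one player, grouped into the first and the second halves of `n`
local EPR pairs. -/
abbrev Ancilla (n : ℕ) : Type := Qubits n ⊗[ℂ] Qubits n

/-- `φ ⊗ |EPR⟩^{⊗ n} ⊗ |EPR⟩^{⊗ n}`, the first `n` EPR pairs being local to the first player
and the other `n` local to the second player. -/
def withAncillas {A B : Type*} [NormedAddCommGroup A] [InnerProductSpace ℂ A]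
    [NormedAddCommGroup B] [InnerProductSpace ℂ B] (n : ℕ) (φ : A ⊗[ℂ] B) :
    (A ⊗[ℂ] Ancilla n) ⊗[ℂ] (B ⊗[ℂ] Ancilla n) :=
  juxt φ (eprState n ⊗ₜ[ℂ] eprState n)

end

end EPRTest

/-! No sub-protocol can be won with more than its optimal probability, because `2√2` minus the CHSH
value is a sum of squares. A strategy within `δ` of `omegaOpt` therefore loses at most `3δ` in each
sub-protocol. All question tuples contribute a nonnegative deficit to the average, so each single
one loses at most the number of tuples times this. There are of order `n²` of them, and taking
square roots of the squared norms produces `n√δ`. By `Strategy.norm_chsh_le`, on the state, `√2 Z_i`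
and `√2 X_i` of Alice are close to the sum and the difference of Bob's answers. Squaring those
relations shows that `Z_i` and `X_i` nearly anticommute. For `i ≠ j`, Bob's two answers come from a
single measurement, so they commute exactly and force Alice's observables for `i` and `j` to nearly
commute. Exchanging the players gives the same for Bob.

To make anticommutation exact, `X_i` is split into the parts anticommuting and commuting with `Z_i`.
The second part is small on the state. One extra qubit, on which it is multiplied by `σ^x` while
`Z_i` is multiplied by `σ^z`, turns it into an anticommuting part too (`PlayerStrategy.extension`).

Every pair `Z_i`, `X_i` now defines an exact qubit, which is swapped with one half of a local EPR
pair. The local unitary is the product of these `n` swap gates. Estimates hold only on the state,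
and an operator standing to the left of others cannot use them. The remedy, used throughout, is to
replace the rightmost operator by a mirror image that commutes with everything else: the other
player's reflection together with the Pauli operator on the partner half of the local EPR pair. Each
gate then costs `O(n√δ)`, and the circuit intertwines `Z_j`, `X_j` with the Pauli operators up to
`O(n²√δ)` (`SwapData.norm_circuit_le`).

After the circuit, the Pauli operators of the two sides nearly agree, so the state is nearly fixed
by the `2n` commuting stabilizers `σ^P_j ⊗ σ^P_j`. Projecting onto their fixed spaces one after
another adds squared errors, which costs only a factor `√n` and yields `n^{5/2}`. The joint fixed
vectors are exactly the EPR state tensored with an arbitrary vector (`eq_eprState_tmul_of_fixed`).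
-/

namespace EPRTest

noncomputable section

/-! ### Reflections -/

namespace IsReflection

variable {H K : Type*} [NormedAddCommGroup H] [InnerProductSpace ℂ H]
  [NormedAddCommGroup K] [InnerProductSpace ℂ K] {R Q : Module.End ℂ H}

theorem apply_apply (hR : IsReflection R) (v : H) : R (R v) = v := by
  rw [← Module.End.mul_apply, hR.mul_self, Module.End.one_apply]

theorem inner_apply_apply (hR : IsReflection R) (v w : H) :
    inner ℂ (R v) (R w) = inner ℂ v w := by
  rw [hR.isSymmetric, hR.apply_apply]

theorem norm_apply (hR : IsReflection R) (v : H) : ‖R v‖ = ‖v‖ := by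
  rw [@norm_eq_sqrt_re_inner ℂ, @norm_eq_sqrt_re_inner ℂ _ _ _ _ v, hR.inner_apply_apply]

theorem one : IsReflection (1 : Module.End ℂ H) :=
  ⟨fun _ _ => rfl, one_mul 1⟩

theorem mul (hR : IsReflection R) (hQ : IsReflection Q) (h : Commute R Q) :
    IsReflection (R * Q) := by
  refine ⟨fun v w => ?_, ?_⟩
  · rw [Module.End.mul_apply, hR.isSymmetric, hQ.isSymmetric, h.eq, Module.End.mul_apply]
  · rw [mul_assoc, ← mul_assoc Q, ← h.eq, mul_assoc, hQ.mul_self, mul_one, hR.mul_self]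

end IsReflection

theorem isSymmetric_map {H K : Type*} [NormedAddCommGroup H] [InnerProductSpace ℂ H]
    [NormedAddCommGroup K] [InnerProductSpace ℂ K] {R : Module.End ℂ H} {Q : Module.End ℂ K}
    (hR : LinearMap.IsSymmetric R) (hQ : LinearMap.IsSymmetric Q) :
    LinearMap.IsSymmetric (TensorProduct.map R Q) := by
  intro v w
  induction v using TensorProduct.induction_on with
  | zero => simp
  | add x y hx hy => simp only [map_add, inner_add_left, hx, hy]
  | tmul a b =>
    induction w using TensorProduct.induction_on with
    | zero => simp
    | add x y hx hy => simp only [map_add, inner_add_right, hx, hy]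
    | tmul c d => simp [hR a c, hQ b d]

theorem IsReflection.map {H K : Type*} [NormedAddCommGroup H] [InnerProductSpace ℂ H]
    [NormedAddCommGroup K] [InnerProductSpace ℂ K] {R : Module.End ℂ H} {Q : Module.End ℂ K}
    (hR : IsReflection R) (hQ : IsReflection Q) : IsReflection (TensorProduct.map R Q) :=
  ⟨isSymmetric_map hR.isSymmetric hQ.isSymmetric, by
    rw [← TensorProduct.map_mul, hR.mul_self, hQ.mul_self, TensorProduct.map_one]⟩

/-! ### Local operators -/

section Local

variable {H K : Type*} [NormedAddCommGroup H] [InnerProductSpace ℂ H]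
  [NormedAddCommGroup K] [InnerProductSpace ℂ K]

theorem left_mul (S T : Module.End ℂ H) : left K (S * T) = left K S * left K T := by
  rw [left, left, left, ← TensorProduct.map_mul, one_mul]

theorem right_mul (S T : Module.End ℂ K) : right H (S * T) = right H S * right H T := by
  rw [right, right, right, ← TensorProduct.map_mul, one_mul]

theorem left_add (S T : Module.End ℂ H) : left K (S + T) = left K S + left K T :=
  TensorProduct.map_add_left _ _ _

theorem right_add (S T : Module.End ℂ K) : right H (S + T) = right H S + right H T :=
  TensorProduct.map_add_right _ _ _

theorem left_smul (c : ℂ) (T : Module.End ℂ H) : left K (c • T) = c • left K T :=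
  TensorProduct.map_smul_left _ _ _

theorem right_smul (c : ℂ) (T : Module.End ℂ K) : right H (c • T) = c • right H T :=
  TensorProduct.map_smul_right _ _ _

theorem left_neg (T : Module.End ℂ H) : left K (-T) = -left K T := by
  rw [← neg_one_smul ℂ T, left_smul]
  exact neg_one_smul ℂ (left K T)

theorem right_neg (T : Module.End ℂ K) : right H (-T) = -right H T := by
  rw [← neg_one_smul ℂ T, right_smul]
  exact neg_one_smul ℂ (right H T)

theorem left_sub (S T : Module.End ℂ H) : left K (S - T) = left K S - left K T := by
  rw [sub_eq_add_neg, left_add, left_neg, sub_eq_add_neg]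

theorem right_sub (S T : Module.End ℂ K) : right H (S - T) = right H S - right H T := by
  rw [sub_eq_add_neg, right_add, right_neg, sub_eq_add_neg]

@[simp] theorem left_one : left K (1 : Module.End ℂ H) = 1 := TensorProduct.map_one

@[simp] theorem right_one : right H (1 : Module.End ℂ K) = 1 := TensorProduct.map_one

@[simp] theorem left_tmul (T : Module.End ℂ H) (v : H) (w : K) :
    left K T (v ⊗ₜ w) = T v ⊗ₜ w := rfl

@[simp] theorem right_tmul (T : Module.End ℂ K) (v : H) (w : K) :
    right H T (v ⊗ₜ w) = v ⊗ₜ T w := rfl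

theorem left_mul_right (S : Module.End ℂ H) (T : Module.End ℂ K) :
    left K S * right H T = TensorProduct.map S T := by
  rw [left, right, ← TensorProduct.map_mul, one_mul, mul_one]

theorem right_mul_left (S : Module.End ℂ H) (T : Module.End ℂ K) :
    right H T * left K S = TensorProduct.map S T := by
  rw [left, right, ← TensorProduct.map_mul, one_mul, mul_one]

theorem commute_left_right (S : Module.End ℂ H) (T : Module.End ℂ K) :
    Commute (left K S) (right H T) := by
  rw [commute_iff_eq, left_mul_right, right_mul_left]

theorem commute_left {S T : Module.End ℂ H} (h : Commute S T) :
    Commute (left K S) (left K T) := by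
  rw [commute_iff_eq, ← left_mul, h.eq, left_mul]

theorem commute_right {S T : Module.End ℂ K} (h : Commute S T) :
    Commute (right H S) (right H T) := by
  rw [commute_iff_eq, ← right_mul, h.eq, right_mul]

theorem IsReflection.left {T : Module.End ℂ H} (h : IsReflection T) : IsReflection (left K T) :=
  h.map .one

theorem IsReflection.right {T : Module.End ℂ K} (h : IsReflection T) :
    IsReflection (right H T) :=
  IsReflection.one.map h

theorem comm_right (T : Module.End ℂ K) (v : H ⊗[ℂ] K) :
    TensorProduct.comm ℂ H K (right H T v) = left H T (TensorProduct.comm ℂ H K v) := by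
  induction v using TensorProduct.induction_on with
  | zero => simp
  | add x y hx hy => simp only [map_add, hx, hy]
  | tmul a b => rfl

end Local

/-! ### The CHSH inequality and its rigidity -/

section CHSH

variable {V : Type*} [NormedAddCommGroup V] [InnerProductSpace ℂ V]

/-- The sum-of-squares certificate of the CHSH inequality. -/
theorem chsh_sum_of_squares {z x b₀ b₁ : V} (hz : ‖z‖ = 1) (hx : ‖x‖ = 1) (h₀ : ‖b₀‖ = 1)
    (h₁ : ‖b₁‖ = 1) :
    ‖((√2 : ℝ) : ℂ) • z - (b₀ + b₁)‖ ^ 2 + ‖((√2 : ℝ) : ℂ) • x - (b₀ - b₁)‖ ^ 2 =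
      2 * √2 * (2 * √2 - ((inner ℂ z b₀).re + (inner ℂ z b₁).re + (inner ℂ x b₀).re
        - (inner ℂ x b₁).re)) := by
  -- The squares contribute `2 + 2` from the first vectors and `4` from the parallelogram law, in
  -- total `8 = (2√2)²`; the cross terms give `-2√2` times the CHSH value.
  have hp := parallelogram_law_with_norm ℂ b₀ b₁
  rw [h₀, h₁] at hp
  have hs : √2 * √2 = 2 := Real.mul_self_sqrt (by norm_num)
  rw [@norm_sub_sq ℂ, @norm_sub_sq ℂ, norm_smul, norm_smul, hz, hx, inner_smul_left,
    inner_smul_left, inner_add_right, inner_sub_right]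
  simp only [Complex.norm_real, Real.norm_eq_abs, mul_one, sq_abs, Complex.conj_ofReal,
    RCLike.re_to_complex, Complex.re_ofReal_mul, Complex.add_re, Complex.sub_re]
  have hs2 : √2 ^ 2 = 2 := by rw [sq, hs]
  rw [hs2]
  linear_combination hp - 4 * hs

theorem norm_sqrt_two : ‖((√2 : ℝ) : ℂ)‖ = √2 := by
  rw [Complex.norm_real, Real.norm_eq_abs, abs_of_nonneg (Real.sqrt_nonneg _)]

theorem sqrt_two_lt : √2 < 3 / 2 := by
  rw [Real.sqrt_lt' (by norm_num)]; norm_num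

theorem sqrt_two_mul_self : ((√2 : ℝ) : ℂ) * ((√2 : ℝ) : ℂ) = 2 := by
  rw [← Complex.ofReal_mul, Real.mul_self_sqrt (by norm_num)]; norm_num

/-- Near-optimal CHSH observables nearly anticommute on the state: one of the two orderings. -/
theorem norm_mul_sub_of_chsh {Z X B₀ B₁ : Module.End ℂ V} (hX : IsReflection X)
    (h₀ : IsReflection B₀) (h₁ : IsReflection B₁) (hX₀ : Commute X B₀) (hX₁ : Commute X B₁)
    {ψ : V} {η : ℝ} {e : ℂ} (he : ‖e‖ = 1) (hzψ : ‖((√2 : ℝ) : ℂ) • Z ψ - (B₀ ψ + e • B₁ ψ)‖ ≤ η)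
    (hxψ : ‖((√2 : ℝ) : ℂ) • X ψ - (B₀ ψ - e • B₁ ψ)‖ ≤ η) :
    ‖(2 : ℂ) • X (Z ψ) - (B₀ + e • B₁) (B₀ ψ - e • B₁ ψ)‖ ≤ 4 * η := by
  set r : ℂ := ((√2 : ℝ) : ℂ) with hr
  have hη : 0 ≤ η := (norm_nonneg _).trans hzψ
  -- `2XZψ = √2 X(√2 Zψ) ≈ √2 X(B₀ + eB₁)ψ = (B₀ + eB₁)(√2 Xψ) ≈ (B₀ + eB₁)(B₀ - eB₁)ψ`; the two
  -- replacements cost `√2 η ≤ 2η` and `2η`.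
  have key : (2 : ℂ) • X (Z ψ) - (B₀ + e • B₁) (B₀ ψ - e • B₁ ψ) =
      r • X (r • Z ψ - (B₀ ψ + e • B₁ ψ)) +
        (B₀ (r • X ψ - (B₀ ψ - e • B₁ ψ)) + e • B₁ (r • X ψ - (B₀ ψ - e • B₁ ψ))) := by
    have e₀ : X (B₀ ψ) = B₀ (X ψ) := LinearMap.congr_fun hX₀.eq ψ
    have e₁ : X (B₁ ψ) = B₁ (X ψ) := LinearMap.congr_fun hX₁.eq ψ
    simp only [map_sub, map_add, map_smul, e₀, e₁, LinearMap.add_apply, LinearMap.smul_apply,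
      smul_sub, smul_add, smul_smul, hr, sqrt_two_mul_self, mul_comm e]
    module
  rw [key]
  refine (norm_add_le _ _).trans ?_
  have a₁ : ‖r • X (r • Z ψ - (B₀ ψ + e • B₁ ψ))‖ ≤ 2 * η := by
    rw [norm_smul, hX.norm_apply, hr, norm_sqrt_two]
    exact mul_le_mul (by linarith [sqrt_two_lt]) hzψ (norm_nonneg _) (by norm_num)
  have a₂ : ‖B₀ (r • X ψ - (B₀ ψ - e • B₁ ψ)) + e • B₁ (r • X ψ - (B₀ ψ - e • B₁ ψ))‖
      ≤ 2 * η := by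
    refine (norm_add_le _ _).trans ?_
    rw [norm_smul, he, h₀.norm_apply, h₁.norm_apply]
    linarith
  linarith

/-- Near-optimal CHSH observables nearly anticommute on the state. -/
theorem norm_anticomm_of_chsh {Z X B₀ B₁ : Module.End ℂ V} (hZ : IsReflection Z)
    (hX : IsReflection X) (h₀ : IsReflection B₀) (h₁ : IsReflection B₁) (hZ₀ : Commute Z B₀)
    (hZ₁ : Commute Z B₁) (hX₀ : Commute X B₀) (hX₁ : Commute X B₁) {ψ : V} {η : ℝ}
    (hzψ : ‖((√2 : ℝ) : ℂ) • Z ψ - (B₀ ψ + B₁ ψ)‖ ≤ η)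
    (hxψ : ‖((√2 : ℝ) : ℂ) • X ψ - (B₀ ψ - B₁ ψ)‖ ≤ η) :
    ‖(Z * X + X * Z) ψ‖ ≤ 4 * η := by
  have t₁ := norm_mul_sub_of_chsh (Z := Z) hX h₀ h₁ hX₀ hX₁ (ψ := ψ) (η := η) (e := 1) (by simp)
    (by simpa using hzψ) (by simpa using hxψ)
  have t₂ := norm_mul_sub_of_chsh (Z := X) hZ h₀ h₁ hZ₀ hZ₁ (ψ := ψ) (η := η) (e := -1) (by simp)
    (by simpa [← sub_eq_add_neg] using hxψ) (by simpa using hzψ)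
  -- The two approximants add up to `2(B₀² - B₁²) = 0`.
  have key : (2 : ℂ) • (Z * X + X * Z) ψ =
      ((2 : ℂ) • X (Z ψ) - (B₀ + (1 : ℂ) • B₁) (B₀ ψ - (1 : ℂ) • B₁ ψ)) +
      ((2 : ℂ) • Z (X ψ) - (B₀ + (-1 : ℂ) • B₁) (B₀ ψ - (-1 : ℂ) • B₁ ψ)) := by
    simp only [LinearMap.add_apply, Module.End.mul_apply, map_sub, map_smul, LinearMap.smul_apply,
      h₀.apply_apply, h₁.apply_apply, smul_add, smul_smul]
    module
  have : 2 * ‖(Z * X + X * Z) ψ‖ ≤ 4 * η + 4 * η := by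
    calc 2 * ‖(Z * X + X * Z) ψ‖ = ‖(2 : ℂ) • (Z * X + X * Z) ψ‖ := by rw [norm_smul]; simp
      _ ≤ _ := by rw [key]; exact (norm_add_le _ _).trans (add_le_add t₁ t₂)
  linarith

/-- Operators that are simulated on the state by commuting operators commuting with them nearly
commute on the state. -/
theorem norm_comm_of_simulated {G H B C : Module.End ℂ V} (hG : ∀ v, ‖G v‖ ≤ 2 * ‖v‖)
    (hH : ∀ v, ‖H v‖ ≤ 2 * ‖v‖) (hB : IsReflection B) (hC : IsReflection C)
    (hBC : Commute B C) (hGC : Commute G C) (hHB : Commute H B) {ψ : V} {η : ℝ}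
    (hGψ : ‖((√2 : ℝ) : ℂ) • G ψ - (2 : ℂ) • B ψ‖ ≤ 2 * η)
    (hHψ : ‖((√2 : ℝ) : ℂ) • H ψ - (2 : ℂ) • C ψ‖ ≤ 2 * η) :
    ‖(G * H - H * G) ψ‖ ≤ 10 * η := by
  have half : ∀ {G H B C : Module.End ℂ V}, (∀ v, ‖G v‖ ≤ 2 * ‖v‖) → IsReflection C →
      Commute G C →
      ‖((√2 : ℝ) : ℂ) • G ψ - (2 : ℂ) • B ψ‖ ≤ 2 * η →
      ‖((√2 : ℝ) : ℂ) • H ψ - (2 : ℂ) • C ψ‖ ≤ 2 * η →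
      ‖(2 : ℂ) • G (H ψ) - (4 : ℂ) • C (B ψ)‖ ≤ 10 * η := by
    intro G H B C hG hC hGC hGψ hHψ
    set r : ℂ := ((√2 : ℝ) : ℂ) with hr
    have hη : 0 ≤ η := by linarith [(norm_nonneg _).trans hGψ]
    have e : G (C ψ) = C (G ψ) := LinearMap.congr_fun hGC.eq ψ
    -- `2GHψ ≈ 2√2 GCψ = 2√2 CGψ ≈ 4CBψ`. The first replacement costs `√2 · 2 · 2η ≤ 6η`, the second
    -- `2 · 2η`.
    have key : (2 : ℂ) • G (H ψ) - (4 : ℂ) • C (B ψ) =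
        r • G (r • H ψ - (2 : ℂ) • C ψ) + (2 : ℂ) • C (r • G ψ - (2 : ℂ) • B ψ) := by
      simp only [map_sub, map_smul, smul_sub, smul_smul, hr, sqrt_two_mul_self, e]
      module
    rw [key]
    refine (norm_add_le _ _).trans ?_
    rw [norm_smul, norm_smul, hC.norm_apply, hr, norm_sqrt_two, ← hr]
    have b₁ := (hG (r • H ψ - (2 : ℂ) • C ψ)).trans (mul_le_mul_of_nonneg_left hHψ zero_le_two)
    have b₂ := mul_le_mul sqrt_two_lt.le b₁ (norm_nonneg _) (by norm_num)
    have : ‖(2 : ℂ)‖ = 2 := by simp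
    rw [this]
    linarith
  have t₁ := half hG hC hGC hGψ hHψ
  have t₂ := half hH hB hHB hHψ hGψ
  have e : B (C ψ) = C (B ψ) := LinearMap.congr_fun hBC.eq ψ
  have key : (2 : ℂ) • (G * H - H * G) ψ = ((2 : ℂ) • G (H ψ) - (4 : ℂ) • C (B ψ)) -
      ((2 : ℂ) • H (G ψ) - (4 : ℂ) • B (C ψ)) := by
    rw [e]
    simp only [LinearMap.sub_apply, Module.End.mul_apply, smul_sub]
    abel
  have : 2 * ‖(G * H - H * G) ψ‖ ≤ 10 * η + 10 * η := by
    calc 2 * ‖(G * H - H * G) ψ‖ = ‖(2 : ℂ) • (G * H - H * G) ψ‖ := by rw [norm_smul]; simp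
      _ ≤ _ := by rw [key]; exact (norm_sub_le _ _).trans (add_le_add t₁ t₂)
  linarith

end CHSH

/-! ### The observables of a pair of questions -/

theorem sum_units {M : Type*} [AddCommMonoid M] (f : ℤˣ → M) : ∑ x, f x = f 1 + f (-1) := by
  rw [show (Finset.univ : Finset ℤˣ) = {1, -1} from rfl, Finset.sum_pair (by decide)]

/-- The difference of two complementary projections is a reflection. -/
theorem isReflection_of_projections {H : Type*} [NormedAddCommGroup H] [InnerProductSpace ℂ H]
    {P Q : Module.End ℂ H} (hP : LinearMap.IsSymmetric P) (hPP : P * P = P) (hPQ : P + Q = 1) :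
    IsReflection (P - Q) := by
  obtain rfl : Q = 1 - P := eq_sub_of_add_eq' hPQ
  refine ⟨hP.sub (LinearMap.IsSymmetric.sub IsReflection.one.isSymmetric hP), ?_⟩
  have : (P - (1 - P)) * (P - (1 - P)) = 4 • (P * P) - 4 • P + 1 := by noncomm_ring
  rw [this, hPP, sub_self, zero_add]

namespace PlayerStrategy

variable {n : ℕ} {H : Type*} [NormedAddCommGroup H] [InnerProductSpace ℂ H]
  (s : PlayerStrategy n H)

theorem obs_refl (q : Question n) : IsReflection (s.obs q) := by
  unfold obs
  split_ifs
  exacts [s.Z_refl _, s.X_refl _]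

/-- The observable whose value is the answer to `q` when the player is asked about `q` and `r`. -/
def answer (q r : Question n) : Module.End ℂ H :=
  (s.double q r 1 1 + s.double q r 1 (-1)) - (s.double q r (-1) 1 + s.double q r (-1) (-1))

theorem double_swap {q r : Question n} (h : q.1 ≠ r.1) (y y' : ℤˣ) :
    s.double r q y' y = s.double q r y y' := by
  rcases lt_or_gt_of_ne h with h' | h'
  · rw [double, double, if_pos h', if_neg h'.le.not_gt]
  · rw [double, double, if_pos h', if_neg h'.le.not_gt]

theorem double_isSymmetricProjection {q r : Question n} (h : q.1 ≠ r.1) (y y' : ℤˣ) :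
    LinearMap.IsSymmetricProjection (s.double q r y y') := by
  rcases lt_or_gt_of_ne h with h' | h'
  · rw [double, if_pos h']; exact s.proj_isSymmetricProjection q r h' _ _
  · rw [double, if_neg h'.le.not_gt]; exact s.proj_isSymmetricProjection r q h' _ _

theorem double_mul_self {q r : Question n} (h : q.1 ≠ r.1) (y y' : ℤˣ) :
    s.double q r y y' * s.double q r y y' = s.double q r y y' :=
  (s.double_isSymmetricProjection h y y').isIdempotentElem

theorem double_orthogonal {q r : Question n} (h : q.1 ≠ r.1) {y y' z z' : ℤˣ}
    (hne : (y, y') ≠ (z, z')) : s.double q r y y' * s.double q r z z' = 0 := by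
  rcases lt_or_gt_of_ne h with h' | h'
  · rw [double, if_pos h', double, if_pos h']; exact s.proj_orthogonal q r h' _ _ _ _ hne
  · rw [double, if_neg h'.le.not_gt, double, if_neg h'.le.not_gt]
    refine s.proj_orthogonal r q h' _ _ _ _ fun e => hne ?_
    rw [Prod.mk.injEq] at e ⊢
    exact e.symm

theorem double_complete {q r : Question n} (h : q.1 ≠ r.1) :
    s.double q r 1 1 + s.double q r 1 (-1) +
      (s.double q r (-1) 1 + s.double q r (-1) (-1)) = 1 := by
  rcases lt_or_gt_of_ne h with h' | h'
  · simp only [double, if_pos h']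
    rw [← s.proj_complete q r h', sum_units, sum_units, sum_units]
  · simp only [double, if_neg h'.le.not_gt]
    rw [← s.proj_complete r q h', sum_units, sum_units, sum_units]
    abel

theorem answer_refl {q r : Question n} (h : q.1 ≠ r.1) : IsReflection (s.answer q r) := by
  refine isReflection_of_projections ?_ ?_ (s.double_complete h)
  · exact (s.double_isSymmetricProjection h _ _).isSymmetric.add
      (s.double_isSymmetricProjection h _ _).isSymmetric
  · rw [add_mul, mul_add, mul_add, s.double_mul_self h, s.double_mul_self h,
      s.double_orthogonal h (by decide), s.double_orthogonal h (by decide), add_zero, zero_add]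

/-- Both answers are coarse-grainings of one projective measurement. This exact commutation is what
forces the other player's observables for distinct indices to nearly commute. -/
theorem answer_commute {q r : Question n} (h : q.1 ≠ r.1) :
    Commute (s.answer q r) (s.answer r q) := by
  have hd : ∀ y y' z z', Commute (s.double q r y y') (s.double q r z z') := by
    intro y y' z z'
    by_cases e : (y, y') = (z, z')
    · rw [Prod.mk.injEq] at e; rw [e.1, e.2]
    · rw [commute_iff_eq, s.double_orthogonal h e, s.double_orthogonal h (Ne.symm e)]
  rw [answer, answer, s.double_swap h, s.double_swap h, s.double_swap h, s.double_swap h]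
  have : ∀ z z', Commute ((s.double q r 1 1 + s.double q r 1 (-1)) -
      (s.double q r (-1) 1 + s.double q r (-1) (-1))) (s.double q r z z') := fun z z' =>
    ((hd _ _ _ _).add_left (hd _ _ _ _)).sub_left ((hd _ _ _ _).add_left (hd _ _ _ _))
  exact ((this _ _).add_right (this _ _)).sub_right ((this _ _).add_right (this _ _))

end PlayerStrategy

/-! ### The acceptance probability -/

section Expval

variable {V : Type*} [NormedAddCommGroup V] [InnerProductSpace ℂ V] (ψ : V)

/-- The real part of the inner product. -/
def reInner (v w : V) : ℝ := (inner ℂ v w).re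

theorem expval_add (S T : Module.End ℂ V) : expval ψ (S + T) = expval ψ S + expval ψ T := by
  simp [expval]

theorem expval_smul (c : ℝ) (T : Module.End ℂ V) :
    expval ψ ((c : ℂ) • T) = c * expval ψ T := by
  simp [expval]

theorem expval_one (h : ‖ψ‖ = 1) : expval ψ 1 = 1 := by
  rw [expval, Module.End.one_apply, inner_self_eq_norm_sq_to_K, h]
  simp

theorem expval_mul {S T : Module.End ℂ V} (hS : LinearMap.IsSymmetric S) :
    expval ψ (S * T) = reInner (S ψ) (T ψ) := by
  rw [expval, reInner, hS, Module.End.mul_apply]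

theorem reInner_le_one {v w : V} (hv : ‖v‖ = 1) (hw : ‖w‖ = 1) : reInner v w ≤ 1 := by
  refine (Complex.re_le_norm _).trans ((norm_inner_le_norm _ _).trans ?_)
  rw [hv, hw, one_mul]

theorem norm_sub_sq_of_norm_one {v w : V} (hv : ‖v‖ = 1) (hw : ‖w‖ = 1) :
    ‖v - w‖ ^ 2 = 2 - 2 * reInner v w := by
  rw [@norm_sub_sq ℂ, hv, hw, RCLike.re_to_complex, reInner]
  ring

theorem expval_conj {W : Type*} [NormedAddCommGroup W] [InnerProductSpace ℂ W] (e : V ≃ₗᵢ[ℂ] W)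
    {S : Module.End ℂ V} {T : Module.End ℂ W} (h : ∀ v, e (S v) = T (e v)) :
    expval (e ψ) T = expval ψ S := by
  rw [expval, expval, ← h, e.inner_map_map]

end Expval

namespace Strategy

variable {n : ℕ} {HA HB : Type*} [NormedAddCommGroup HA] [InnerProductSpace ℂ HA]
  [NormedAddCommGroup HB] [InnerProductSpace ℂ HB] (S : Strategy n HA HB)

/-- The strategy with the two players exchanged. -/
def swap : Strategy n HB HA where
  ψ := TensorProduct.comm ℂ HA HB S.ψ
  norm_ψ := by rw [TensorProduct.norm_comm, S.norm_ψ]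
  alice := S.bob
  bob := S.alice

theorem prob_swap (E : Module.End ℂ HA) (F : Module.End ℂ HB) :
    S.swap.prob F E = S.prob E F := by
  refine expval_conj S.ψ (TensorProduct.commIsometry ℂ HA HB) fun v => ?_
  induction v using TensorProduct.induction_on with
  | zero => simp
  | add x y hx hy => simp only [map_add, hx, hy]
  | tmul a b => simp

theorem prob_swap' : S.prob = fun E F => S.swap.prob F E := by
  funext E F
  rw [prob_swap]

theorem accept₃_eq : S.accept₃ = S.swap.accept₂ := by
  simp only [accept₃, accept₂, prob_swap' S]
  rfl

theorem accept₂_eq : S.accept₂ = S.swap.accept₃ := by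
  simp only [accept₃, accept₂, prob_swap' S]
  rfl

/-- Correlations of reflections become inner products of unit vectors, to which the sum of squares
applies. -/
theorem prob_eq_reInner {E : Module.End ℂ HA} (hE : LinearMap.IsSymmetric E)
    (F : Module.End ℂ HB) :
    S.prob E F = reInner (left HB E S.ψ) (right HA F S.ψ) := by
  rw [prob, ← left_mul_right]
  exact expval_mul S.ψ (isSymmetric_map hE IsReflection.one.isSymmetric)

theorem prob_add_left (E E' : Module.End ℂ HA) (F : Module.End ℂ HB) :
    S.prob (E + E') F = S.prob E F + S.prob E' F := by
  rw [prob, TensorProduct.map_add_left]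
  exact expval_add _ _ _

theorem prob_add_right (E : Module.End ℂ HA) (F F' : Module.End ℂ HB) :
    S.prob E (F + F') = S.prob E F + S.prob E F' := by
  rw [prob, TensorProduct.map_add_right]
  exact expval_add _ _ _

theorem prob_smul_left (c : ℝ) (E : Module.End ℂ HA) (F : Module.End ℂ HB) :
    S.prob ((c : ℂ) • E) F = c * S.prob E F := by
  rw [prob, TensorProduct.map_smul_left]
  exact expval_smul _ _ _

theorem prob_smul_right (c : ℝ) (E : Module.End ℂ HA) (F : Module.End ℂ HB) :
    S.prob E ((c : ℂ) • F) = c * S.prob E F := by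
  rw [prob, TensorProduct.map_smul_right]
  exact expval_smul _ _ _

theorem prob_sub_right (E : Module.End ℂ HA) (F F' : Module.End ℂ HB) :
    S.prob E (F - F') = S.prob E F - S.prob E F' := by
  have := S.prob_add_right E (F - F') F'
  rw [sub_add_cancel] at this
  linarith

theorem prob_one_one : S.prob 1 1 = 1 := by
  rw [prob, TensorProduct.map_one]
  exact expval_one _ S.norm_ψ

theorem prob_single_left (q : Question n) (x : ℤˣ) (F : Module.End ℂ HB) :
    S.prob (S.alice.single q x) F =
      (S.prob 1 F + ((x : ℤ) : ℝ) * S.prob (S.alice.obs q) F) / 2 := by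
  have h₁ : (1 / 2 : ℂ) = ((1 / 2 : ℝ) : ℂ) := by norm_num
  have h₂ : ((x : ℤ) : ℂ) = (((x : ℤ) : ℝ) : ℂ) := by norm_num
  rw [PlayerStrategy.single, h₁, h₂, prob_smul_left, prob_add_left, prob_smul_left]
  ring

theorem prob_single_right (q : Question n) (x : ℤˣ) (E : Module.End ℂ HA) :
    S.prob E (S.bob.single q x) =
      (S.prob E 1 + ((x : ℤ) : ℝ) * S.prob E (S.bob.obs q)) / 2 := by
  have h₁ : (1 / 2 : ℂ) = ((1 / 2 : ℝ) : ℂ) := by norm_num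
  have h₂ : ((x : ℤ) : ℂ) = (((x : ℤ) : ℝ) : ℂ) := by norm_num
  rw [PlayerStrategy.single, h₁, h₂, prob_smul_right, prob_add_right, prob_smul_right]
  ring

/-- Winning probability of sub-protocol 1 in terms of the correlation. -/
theorem sum_prob_single_single (q : Question n) :
    (∑ x : ℤˣ, ∑ y : ℤˣ,
      if x = y then S.prob (S.alice.single q x) (S.bob.single q y) else 0) =
      (1 + S.prob (S.alice.obs q) (S.bob.obs q)) / 2 := by
  simp only [Finset.sum_ite_eq, Finset.mem_univ, if_true, sum_units, prob_single_left,
    prob_single_right, prob_one_one]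
  push_cast
  ring

/-- Winning probability of sub-protocol 2 in terms of the correlation. -/
theorem sum_prob_single_double {q q' r : Question n} (h : q'.1 ≠ r.1) (s : ℤˣ) :
    (∑ x : ℤˣ, ∑ y : ℤˣ, ∑ y' : ℤˣ, if x * y = s then
      S.prob (S.alice.single q x) (S.bob.double q' r y y') else 0) =
      (1 + ((s : ℤ) : ℝ) * S.prob (S.alice.obs q) (S.bob.answer q' r)) / 2 := by
  have h₁ := S.prob_one_one
  rw [← S.bob.double_complete h] at h₁
  simp only [prob_add_right] at h₁
  rw [PlayerStrategy.answer]
  simp only [prob_sub_right, prob_add_right, sum_units, prob_single_left]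
  rcases Int.units_eq_one_or s with rfl | rfl
  · simp
    linear_combination h₁ / 2
  · simp
    linear_combination h₁ / 2

/-- The CHSH value of the players' observables for the index `i`, when Bob is also asked `r`. -/
def chsh (i : Fin n) (r : Question n) : ℝ :=
  S.prob (S.alice.obs (i, 0)) (S.bob.answer (i, 0) r) +
    S.prob (S.alice.obs (i, 0)) (S.bob.answer (i, 1) r) +
    S.prob (S.alice.obs (i, 1)) (S.bob.answer (i, 0) r) -
    S.prob (S.alice.obs (i, 1)) (S.bob.answer (i, 1) r)

theorem accept₁_eq_sum : S.accept₁ =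
    (∑ q : Question n, (1 + S.prob (S.alice.obs q) (S.bob.obs q)) / 2) / (n * 2) := by
  unfold accept₁
  simp only [sum_prob_single_single]
  rw [Fintype.sum_prod_type]

theorem accept₁_swap : S.swap.accept₁ = S.accept₁ := by
  rw [accept₁_eq_sum, accept₁_eq_sum]
  congr 1
  refine Finset.sum_congr rfl fun q _ => ?_
  rw [show S.swap.prob (S.swap.alice.obs q) (S.swap.bob.obs q) =
    S.prob (S.alice.obs q) (S.bob.obs q) from S.prob_swap _ _]

/-- The protocol is symmetric in the players, so every estimate for Alice yields one for Bob through
`S.swap`. -/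
theorem acceptProb_swap : S.swap.acceptProb = S.acceptProb := by
  unfold acceptProb
  rw [accept₁_swap, ← accept₂_eq, ← accept₃_eq]
  ring

/-- For fixed `i ≠ j` the eight triples `(a, b, c)` form one CHSH game for each value of the
spectator bit `c`; each triple contributes `1/2` besides its correlation. -/
theorem accept₂_eq_sum : S.accept₂ =
    (∑ i : Fin n, ∑ j : Fin n, if i = j then 0 else
      (4 + (S.chsh i (j, 0) + S.chsh i (j, 1)) / 2)) / (n * (n - 1) * 8) := by
  unfold accept₂
  congr 1
  refine Finset.sum_congr rfl fun i _ => Finset.sum_congr rfl fun j _ => ?_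
  split_ifs with h
  · rfl
  · have : ∀ (a b c : Fin 2) (s : ℤˣ), (∑ x : ℤˣ, ∑ y : ℤˣ, ∑ y' : ℤˣ, if x * y = s then
        S.prob (S.alice.single (i, a) x) (S.bob.double (i, b) (j, c) y y') else 0) =
        (1 + ((s : ℤ) : ℝ) * S.prob (S.alice.obs (i, a)) (S.bob.answer (i, b) (j, c))) / 2 :=
      fun a b c s => S.sum_prob_single_double h s
    simp only [this, Fin.sum_univ_two, chsh]
    simp
    ring

theorem norm_left_apply {R : Module.End ℂ HA} (hR : IsReflection R) : ‖left HB R S.ψ‖ = 1 := by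
  rw [hR.left.norm_apply, S.norm_ψ]

theorem norm_right_apply {R : Module.End ℂ HB} (hR : IsReflection R) :
    ‖right HA R S.ψ‖ = 1 := by
  rw [hR.right.norm_apply, S.norm_ψ]

theorem prob_obs_le_one (q : Question n) : S.prob (S.alice.obs q) (S.bob.obs q) ≤ 1 := by
  rw [S.prob_eq_reInner (S.alice.obs_refl q).isSymmetric]
  exact reInner_le_one (S.norm_left_apply (S.alice.obs_refl q))
    (S.norm_right_apply (S.bob.obs_refl q))

theorem chsh_sum_of_squares {i : Fin n} {r : Question n} (h : i ≠ r.1) :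
    ‖((√2 : ℝ) : ℂ) • left HB (S.alice.obs (i, 0)) S.ψ -
        (right HA (S.bob.answer (i, 0) r) S.ψ + right HA (S.bob.answer (i, 1) r) S.ψ)‖ ^ 2 +
      ‖((√2 : ℝ) : ℂ) • left HB (S.alice.obs (i, 1)) S.ψ -
        (right HA (S.bob.answer (i, 0) r) S.ψ - right HA (S.bob.answer (i, 1) r) S.ψ)‖ ^ 2 =
      2 * √2 * (2 * √2 - S.chsh i r) := by
  have h₀ : (i, (0 : Fin 2)).1 ≠ r.1 := h
  have h₁ : (i, (1 : Fin 2)).1 ≠ r.1 := h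
  simp only [chsh, S.prob_eq_reInner (S.alice.obs_refl _).isSymmetric]
  exact EPRTest.chsh_sum_of_squares (S.norm_left_apply (S.alice.obs_refl _))
    (S.norm_left_apply (S.alice.obs_refl _)) (S.norm_right_apply (S.bob.answer_refl h₀))
    (S.norm_right_apply (S.bob.answer_refl h₁))

theorem chsh_le {i : Fin n} {r : Question n} (h : i ≠ r.1) : S.chsh i r ≤ 2 * √2 := by
  have h₁ := S.chsh_sum_of_squares h
  have h₂ : 0 ≤ 2 * √2 * (2 * √2 - S.chsh i r) := by rw [← h₁]; positivity
  have h₃ : 0 < 2 * √2 := by positivity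
  linarith [nonneg_of_mul_nonneg_right h₂ h₃]

/-! ### Deficits of single question tuples -/

theorem sum_ite_diag (n : ℕ) (c : ℝ) :
    ∑ i : Fin n, ∑ j : Fin n, (if i = j then 0 else c) = n * (n - 1) * c := by
  have : ∀ i : Fin n, ∑ j : Fin n, (if i = j then 0 else c) = (n - 1) * c := by
    intro i
    have h : ∀ j : Fin n, (if i = j then 0 else c) = c - if i = j then c else 0 := by
      intro j; split_ifs <;> simp
    simp only [h, Finset.sum_sub_distrib, Finset.sum_ite_eq, Finset.mem_univ, if_true]
    simp
    ring
  simp [this]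
  ring

/-- All questions have nonnegative deficit, so one of them is at most the sum, which is the number
of questions times the average. -/
theorem accept₁_le (hn : 2 ≤ n) (q : Question n) :
    (1 - S.prob (S.alice.obs q) (S.bob.obs q)) / 2 ≤ (n * 2) * (1 - S.accept₁) := by
  have hn' : (0 : ℝ) < n * 2 := by positivity
  have h : (n * 2) * (1 - S.accept₁) =
      ∑ q : Question n, (1 - S.prob (S.alice.obs q) (S.bob.obs q)) / 2 := by
    have : ∀ q : Question n, (1 - S.prob (S.alice.obs q) (S.bob.obs q)) / 2 =
      1 - (1 + S.prob (S.alice.obs q) (S.bob.obs q)) / 2 := fun q => by ring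
    simp only [this]
    rw [Finset.sum_sub_distrib, accept₁_eq_sum, mul_sub, mul_div_cancel₀ _ hn'.ne']
    simp
  rw [h]
  exact Finset.single_le_sum (f := fun q => (1 - S.prob (S.alice.obs q) (S.bob.obs q)) / 2)
    (fun q _ => by linarith [S.prob_obs_le_one q]) (Finset.mem_univ q)

/-- One nonnegative term against the whole sum again. The factor of order `n²` lost here becomes the
`n` of `n√δ` after a square root. -/
theorem accept₂_le (hn : 2 ≤ n) {i j : Fin n} (hij : i ≠ j) (c : Fin 2) :
    (2 * √2 - S.chsh i (j, c)) / 2 ≤ (n * (n - 1) * 8) * (1 / 2 + √2 / 4 - S.accept₂) := by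
  have hn' : (2 : ℝ) ≤ n := by exact_mod_cast hn
  have hn₂ : (n * (n - 1) * 8 : ℝ) ≠ 0 := by
    have : (0 : ℝ) < n - 1 := by linarith
    positivity
  set f : Fin n → Fin n → ℝ := fun i j => if i = j then 0 else
    ((2 * √2 - S.chsh i (j, 0)) / 2 + (2 * √2 - S.chsh i (j, 1)) / 2) with hf
  have hf₀ : ∀ i j, 0 ≤ f i j := by
    intro i j
    simp only [hf]
    split_ifs with h
    · rfl
    · have h₀ := S.chsh_le (r := (j, 0)) h
      have h₁ := S.chsh_le (r := (j, 1)) h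
      linarith
  have h : (n * (n - 1) * 8) * (1 / 2 + √2 / 4 - S.accept₂) = ∑ i, ∑ j, f i j := by
    have : ∀ i j, f i j = (if i = j then 0 else (4 + 2 * √2)) -
        (if i = j then 0 else (4 + (S.chsh i (j, 0) + S.chsh i (j, 1)) / 2)) := by
      intro i j
      simp only [hf]
      split_ifs
      · simp
      · ring
    simp only [this, Finset.sum_sub_distrib]
    rw [sum_ite_diag, accept₂_eq_sum, mul_sub, mul_div_cancel₀ _ hn₂]
    ring
  rw [h]
  have h₀ := S.chsh_le (r := (j, 0)) hij
  have h₁ := S.chsh_le (r := (j, 1)) hij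
  calc (2 * √2 - S.chsh i (j, c)) / 2 ≤ f i j := by
        simp only [hf, if_neg hij]
        fin_cases c
        · simp; linarith
        · simp; linarith
    _ ≤ ∑ j, f i j := Finset.single_le_sum (f := f i) (fun j _ => hf₀ i j) (Finset.mem_univ j)
    _ ≤ ∑ i, ∑ j, f i j := Finset.single_le_sum (f := fun i => ∑ j, f i j)
        (fun i _ => Finset.sum_nonneg fun j _ => hf₀ i j) (Finset.mem_univ i)

theorem omegaOpt_eq : omegaOpt = (1 + 2 * (1 / 2 + √2 / 4)) / 3 := by
  rw [omegaOpt, Real.cos_sq, show 2 * (Real.pi / 8) = Real.pi / 4 by ring, Real.cos_pi_div_four]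
  ring

/-- Upper bounds on all three sub-protocols are needed so that a total deficit `δ` leaves a deficit
of at most `3δ` to each of them. -/
theorem accept₁_le_one (hn : 2 ≤ n) : S.accept₁ ≤ 1 := by
  have h := S.accept₁_le hn (⟨0, by omega⟩, 0)
  have h' := S.prob_obs_le_one (⟨0, by omega⟩, 0)
  have hn' : (0 : ℝ) < n * 2 := by positivity
  linarith [nonneg_of_mul_nonneg_right ((by linarith : (0 : ℝ) ≤ _).trans h) hn']

theorem accept₂_le_opt (hn : 2 ≤ n) : S.accept₂ ≤ 1 / 2 + √2 / 4 := by
  have hij : (⟨0, by omega⟩ : Fin n) ≠ ⟨1, by omega⟩ := by simp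
  have h := S.accept₂_le hn hij 0
  have h' := S.chsh_le (r := (⟨1, by omega⟩, 0)) hij
  have hn' : (2 : ℝ) ≤ n := by exact_mod_cast hn
  have hn₂ : (0 : ℝ) < (n * (n - 1) * 8 : ℝ) := by
    have : (0 : ℝ) < n - 1 := by linarith
    positivity
  linarith [nonneg_of_mul_nonneg_right ((by linarith : (0 : ℝ) ≤ _).trans h) hn₂]

/-! ### Rigidity of the measurements -/

variable {S} {δ : ℝ}

theorem le_mul_sqrt_of_sq_le (hδ : 0 < δ) {x : ℝ} (h : x ^ 2 ≤ 144 * (n ^ 2 * δ)) :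
    x ≤ 12 * (n * √δ) := by
  refine le_of_sq_le_sq ?_ (by positivity)
  rw [mul_pow, mul_pow, Real.sq_sqrt hδ.le]
  linarith

theorem norm_left_obs_sub_right_obs_le (hn : 2 ≤ n) (hδ : 0 < δ)
    (hS : omegaOpt - δ ≤ S.acceptProb) (q : Question n) :
    ‖left HB (S.alice.obs q) S.ψ - right HA (S.bob.obs q) S.ψ‖ ≤ 12 * (n * √δ) := by
  have h₂ := S.accept₂_le_opt hn
  have h₃ := S.swap.accept₂_le_opt hn
  have h₁ := S.accept₁_le hn q
  have hn' : (2 : ℝ) ≤ n := by exact_mod_cast hn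
  rw [omegaOpt_eq, acceptProb, accept₃_eq] at hS
  have h₄ : 1 - S.accept₁ ≤ 3 * δ := by linarith
  have h₅ : (n * 2) * (1 - S.accept₁) ≤ (n * 2) * (3 * δ) :=
    mul_le_mul_of_nonneg_left h₄ (by positivity)
  refine le_mul_sqrt_of_sq_le hδ ?_
  rw [norm_sub_sq_of_norm_one (S.norm_left_apply (S.alice.obs_refl q))
    (S.norm_right_apply (S.bob.obs_refl q)), ← S.prob_eq_reInner (S.alice.obs_refl q).isSymmetric]
  -- This test alone gives the squared bound `24 n δ`; it is weakened to the scale of the CHSH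
  -- tests.
  have h₆ : (n : ℝ) * δ ≤ n ^ 2 * δ := by
    refine mul_le_mul_of_nonneg_right ?_ hδ.le
    nlinarith
  have h₇ : 0 ≤ (n : ℝ) * δ := by positivity
  linarith

/-- The sum-of-squares identity bounds each square by `2√2` times the deficit of the CHSH value. -/
theorem norm_chsh_le (hn : 2 ≤ n) (hδ : 0 < δ) (hS : omegaOpt - δ ≤ S.acceptProb)
    {i : Fin n} {r : Question n} (h : i ≠ r.1) :
    ‖((√2 : ℝ) : ℂ) • left HB (S.alice.obs (i, 0)) S.ψ -
        (right HA (S.bob.answer (i, 0) r) S.ψ + right HA (S.bob.answer (i, 1) r) S.ψ)‖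
        ≤ 12 * (n * √δ) ∧
      ‖((√2 : ℝ) : ℂ) • left HB (S.alice.obs (i, 1)) S.ψ -
        (right HA (S.bob.answer (i, 0) r) S.ψ - right HA (S.bob.answer (i, 1) r) S.ψ)‖
        ≤ 12 * (n * √δ) := by
  have h₁ := S.accept₁_le_one hn
  have h₃ := S.swap.accept₂_le_opt hn
  have h₂ := S.accept₂_le hn h r.2
  have hn' : (2 : ℝ) ≤ n := by exact_mod_cast hn
  rw [omegaOpt_eq, acceptProb, accept₃_eq] at hS
  have h₄ : 1 / 2 + √2 / 4 - S.accept₂ ≤ 3 * δ := by linarith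
  have h₅ : (n * (n - 1) * 8) * (1 / 2 + √2 / 4 - S.accept₂) ≤ (n * (n - 1) * 8) * (3 * δ) := by
    refine mul_le_mul_of_nonneg_left h₄ ?_
    have : (0 : ℝ) < n - 1 := by linarith
    positivity
  -- `48 = 2 · 8 · 3`; with `2√2 ≤ 3` this leads to `144 = 12²`, hence to the unit `12 n√δ` in which
  -- later errors are counted.
  have h₆ : 2 * √2 - S.chsh i r ≤ 48 * (n ^ 2 * δ) := by
    have : 0 ≤ (n : ℝ) * δ := by positivity
    change (2 * √2 - S.chsh i r) / 2 ≤ _ at h₂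
    nlinarith
  have h₇ : 2 * √2 * (2 * √2 - S.chsh i r) ≤ 144 * (n ^ 2 * δ) := by
    have h₈ := mul_le_mul (by linarith [sqrt_two_lt] : 2 * √2 ≤ 3) h₆
      (by linarith [S.chsh_le h]) (by norm_num)
    linarith
  rw [← S.chsh_sum_of_squares h] at h₇
  constructor
  · refine le_mul_sqrt_of_sq_le hδ (le_trans ?_ h₇)
    exact le_add_of_nonneg_right (sq_nonneg _)
  · refine le_mul_sqrt_of_sq_le hδ (le_trans ?_ h₇)
    exact le_add_of_nonneg_left (sq_nonneg _)

theorem norm_left_anticomm_le (hn : 2 ≤ n) (hδ : 0 < δ) (hS : omegaOpt - δ ≤ S.acceptProb)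
    (i : Fin n) :
    ‖left HB (S.alice.Z i * S.alice.X i + S.alice.X i * S.alice.Z i) S.ψ‖
      ≤ 4 * (12 * (n * √δ)) := by
  -- Any second index serves as spectator, and one exists because `n ≥ 2`.
  obtain ⟨j, hj⟩ : ∃ j : Fin n, i ≠ j := by
    have : Nontrivial (Fin n) := Fin.nontrivial_iff_two_le.2 hn
    obtain ⟨j, hj⟩ := exists_ne i
    exact ⟨j, hj.symm⟩
  obtain ⟨h₁, h₂⟩ := norm_chsh_le hn hδ hS (r := (j, 0)) hj
  rw [left_add, left_mul, left_mul]
  exact norm_anticomm_of_chsh (S.alice.Z_refl i).left (S.alice.X_refl i).left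
    (S.bob.answer_refl (q := (i, 0)) hj).right (S.bob.answer_refl (q := (i, 1)) hj).right
    (commute_left_right _ _) (commute_left_right _ _) (commute_left_right _ _)
    (commute_left_right _ _) h₁ h₂

end Strategy

/-! ### Pauli operators on qubits -/

section Qubits

variable {n : ℕ}

/-- The computational basis vector. -/
abbrev ket (x : Fin n → Fin 2) : Qubits n := EuclideanSpace.single x (1 : ℂ)

/-- Flip the `j`-th bit. -/
def flipBit (j : Fin n) (x : Fin n → Fin 2) : Fin n → Fin 2 := Function.update x j (x j + 1)

/-- The sign `(-1)^a`. -/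
def bitSign (a : Fin 2) : ℂ := if a = 0 then 1 else -1

theorem bitSign_mul_self (a : Fin 2) : bitSign a * bitSign a = 1 := by
  fin_cases a <;> simp [bitSign]

theorem bitSign_add_one (a : Fin 2) : bitSign (a + 1) = -bitSign a := by
  fin_cases a <;> simp [bitSign]

theorem flipBit_flipBit (j : Fin n) (x : Fin n → Fin 2) : flipBit j (flipBit j x) = x := by
  have : ∀ a : Fin 2, a + 1 + 1 = a := by decide
  simp [flipBit, this]

theorem flipBit_same (j : Fin n) (x : Fin n → Fin 2) : flipBit j x j = x j + 1 := by
  simp [flipBit]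

theorem flipBit_of_ne {j k : Fin n} (h : k ≠ j) (x : Fin n → Fin 2) : flipBit j x k = x k := by
  simp [flipBit, h]

theorem flipBit_comm {j k : Fin n} (h : j ≠ k) (x : Fin n → Fin 2) :
    flipBit j (flipBit k x) = flipBit k (flipBit j x) := by
  simp only [flipBit, Function.update_of_ne h, Function.update_of_ne h.symm]
  exact Function.update_comm h.symm _ _ _

theorem qubits_ext {W : Type*} [AddCommMonoid W] [Module ℂ W] {S T : Qubits n →ₗ[ℂ] W}
    (h : ∀ x, S (ket x) = T (ket x)) : S = T := by
  refine (EuclideanSpace.basisFun (Fin n → Fin 2) ℂ).toBasis.ext fun x => ?_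
  simpa using h x

theorem onQubit_ket_apply (M : Matrix (Fin 2) (Fin 2) ℂ) (j : Fin n) (x y : Fin n → Fin 2) :
    onQubit M j (ket x) y = if ∀ k, k ≠ j → y k = x k then M (y j) (x j) else 0 := by
  simp [onQubit, Matrix.toLpLin_apply, ket]

theorem onQubit_pauli_zero_ket (j : Fin n) (x : Fin n → Fin 2) :
    onQubit (pauli 0) j (ket x) = bitSign (x j) • ket x := by
  ext y
  rw [onQubit_ket_apply]
  by_cases h : y = x
  · subst h
    simp [pauli, bitSign]
    generalize y j = a
    fin_cases a <;> simp
  · simp [h, pauli]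
    intro h'
    have : y j ≠ x j := fun e => h (funext fun k => by
      by_cases hk : k = j
      · rw [hk, e]
      · exact h' k hk)
    generalize y j = a at *
    generalize x j = b at *
    fin_cases a <;> fin_cases b <;> simp at *

theorem onQubit_pauli_one_ket (j : Fin n) (x : Fin n → Fin 2) :
    onQubit (pauli 1) j (ket x) = ket (flipBit j x) := by
  ext y
  rw [onQubit_ket_apply]
  by_cases h : y = flipBit j x
  · subst h
    have : ∀ k, k ≠ j → flipBit j x k = x k := fun k hk => flipBit_of_ne hk x
    rw [if_pos this, flipBit_same]
    generalize x j = a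
    fin_cases a <;> simp [pauli]
  · simp [h, pauli]
    intro h'
    have : y j ≠ x j + 1 := fun e => h (funext fun k => by
      by_cases hk : k = j
      · rw [hk, e, flipBit_same]
      · rw [h' k hk, flipBit_of_ne hk])
    generalize y j = a at *
    generalize x j = b at *
    fin_cases a <;> fin_cases b <;> simp at *

theorem onQubit_isSymmetric {M : Matrix (Fin 2) (Fin 2) ℂ} (hM : M.IsHermitian) (j : Fin n) :
    LinearMap.IsSymmetric (onQubit M j) := by
  refine Matrix.isSymmetric_toEuclideanLin_iff.2 ?_
  ext x y
  simp only [Matrix.conjTranspose_apply, Matrix.of_apply, eq_comm (a := y _)]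
  split_ifs with h
  · exact hM.apply _ _
  · simp

theorem pauli_isHermitian (P : Fin 2) : (pauli P).IsHermitian := by
  ext a b
  fin_cases P <;> fin_cases a <;> fin_cases b <;> simp [pauli]

theorem fin_two_cases {p : Fin 2 → Prop} (h₀ : p 0) (h₁ : p 1) (P : Fin 2) : p P := by
  fin_cases P
  exacts [h₀, h₁]

theorem onQubit_pauli_refl (P : Fin 2) (j : Fin n) : IsReflection (onQubit (pauli P) j) := by
  refine ⟨onQubit_isSymmetric (pauli_isHermitian P) j, qubits_ext fun x => ?_⟩
  revert P
  refine fin_two_cases ?_ ?_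
  · rw [Module.End.mul_apply, onQubit_pauli_zero_ket, map_smul, onQubit_pauli_zero_ket, smul_smul,
      bitSign_mul_self, one_smul, Module.End.one_apply]
  · rw [Module.End.mul_apply, onQubit_pauli_one_ket, onQubit_pauli_one_ket, flipBit_flipBit,
      Module.End.one_apply]

theorem onQubit_pauli_anticomm (j : Fin n) :
    onQubit (pauli 0) j * onQubit (pauli 1) j = -(onQubit (pauli 1) j * onQubit (pauli 0) j) := by
  refine qubits_ext fun x => ?_
  simp only [LinearMap.neg_apply, Module.End.mul_apply, onQubit_pauli_zero_ket,
    onQubit_pauli_one_ket, map_smul, flipBit_same, bitSign_add_one, neg_smul]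

theorem onQubit_pauli_commute (P Q : Fin 2) {j k : Fin n} (h : j ≠ k) :
    Commute (onQubit (pauli P) j) (onQubit (pauli Q) k) := by
  refine qubits_ext fun x => ?_
  revert P Q
  refine fin_two_cases (fin_two_cases ?_ ?_) (fin_two_cases ?_ ?_)
  all_goals simp only [Module.End.mul_apply, onQubit_pauli_zero_ket, onQubit_pauli_one_ket,
    map_smul, flipBit_of_ne h, flipBit_of_ne h.symm, flipBit_comm h, smul_smul,
    mul_comm (bitSign (x j))]

end Qubits

/-! ### Approximate commutation of the players' observables -/

section Commutators

variable {V : Type*} [NormedAddCommGroup V] [InnerProductSpace ℂ V]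

theorem norm_quarter_le {a b c d : V} {t : ℝ} {w : V} (ha : ‖a‖ ≤ t) (hb : ‖b‖ ≤ t)
    (hc : ‖c‖ ≤ t) (hd : ‖d‖ ≤ t) (h : (4 : ℂ) • w = a + b + c + d) : ‖w‖ ≤ t := by
  have h₁ : ‖(4 : ℂ) • w‖ ≤ t + t + t + t := by
    rw [h]
    exact (norm_add₄_le).trans (by linarith)
  rw [norm_smul] at h₁
  simp only [Complex.norm_ofNat] at h₁
  linarith

/-- By bilinearity, four times each of these commutators is a signed sum of the four commutators of
`Z ± X` with `Z' ± X'`. -/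
theorem norm_comm_of_sum_diff {Z X Z' X' : Module.End ℂ V} {ψ : V} {t : ℝ}
    (h : ∀ e e' : ℂ, e = 1 ∨ e = -1 → e' = 1 ∨ e' = -1 →
      ‖((Z + e • X) * (Z' + e' • X') - (Z' + e' • X') * (Z + e • X)) ψ‖ ≤ t) :
    ‖(Z * Z' - Z' * Z) ψ‖ ≤ t ∧ ‖(Z * X' - X' * Z) ψ‖ ≤ t ∧
      ‖(X * Z' - Z' * X) ψ‖ ≤ t ∧ ‖(X * X' - X' * X) ψ‖ ≤ t := by
  have h₁ := h 1 1 (.inl rfl) (.inl rfl)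
  have h₂ := h 1 (-1) (.inl rfl) (.inr rfl)
  have h₃ := h (-1) 1 (.inr rfl) (.inl rfl)
  have h₄ := h (-1) (-1) (.inr rfl) (.inr rfl)
  have h₂' := h₂; have h₃' := h₃; have h₄' := h₄
  rw [← norm_neg] at h₂' h₃' h₄'
  refine ⟨norm_quarter_le h₁ h₂ h₃ h₄ ?_, norm_quarter_le h₁ h₂' h₃ h₄' ?_,
    norm_quarter_le h₁ h₂ h₃' h₄' ?_, norm_quarter_le h₁ h₂' h₃' h₄ ?_⟩
  all_goals
    simp only [LinearMap.sub_apply, Module.End.mul_apply, LinearMap.add_apply,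
      LinearMap.smul_apply, map_add, map_smul]
    module

theorem norm_add_smul_reflection_le {Z X : Module.End ℂ V} (hZ : IsReflection Z)
    (hX : IsReflection X) {e : ℂ} (he : ‖e‖ = 1) (v : V) : ‖(Z + e • X) v‖ ≤ 2 * ‖v‖ := by
  rw [LinearMap.add_apply, LinearMap.smul_apply]
  refine (norm_add_le _ _).trans ?_
  rw [norm_smul, he, hZ.norm_apply, hX.norm_apply]
  linarith

/-- Rotating the approximate identities of CHSH rigidity. -/
theorem norm_sqrt_two_smul_sub {z x b₀ b₁ : V} {η : ℝ}
    (hz : ‖((√2 : ℝ) : ℂ) • z - (b₀ + b₁)‖ ≤ η) (hx : ‖((√2 : ℝ) : ℂ) • x - (b₀ - b₁)‖ ≤ η) :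
    ‖((√2 : ℝ) : ℂ) • (z + x) - (2 : ℂ) • b₀‖ ≤ 2 * η ∧
      ‖((√2 : ℝ) : ℂ) • (z - x) - (2 : ℂ) • b₁‖ ≤ 2 * η := by
  constructor
  · rw [show ((√2 : ℝ) : ℂ) • (z + x) - (2 : ℂ) • b₀ = (((√2 : ℝ) : ℂ) • z - (b₀ + b₁)) +
      (((√2 : ℝ) : ℂ) • x - (b₀ - b₁)) by module]
    exact (norm_add_le _ _).trans (by linarith)
  · rw [show ((√2 : ℝ) : ℂ) • (z - x) - (2 : ℂ) • b₁ = (((√2 : ℝ) : ℂ) • z - (b₀ + b₁)) -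
      (((√2 : ℝ) : ℂ) • x - (b₀ - b₁)) by module]
    exact (norm_sub_le _ _).trans (by linarith)

/-- CHSH rigidity for two indices: if the reflections `Z, X` and `Z', X'` are near-optimal for CHSH
with observables `B b c`, `C c b` such that `B b c` and `C c b` commute, then they nearly
commute. -/
theorem norm_comm_of_chsh {Z X Z' X' : Module.End ℂ V} {B C : Fin 2 → Fin 2 → Module.End ℂ V}
    (hZ : IsReflection Z) (hX : IsReflection X) (hZ' : IsReflection Z') (hX' : IsReflection X')
    (hB : ∀ b c, IsReflection (B b c)) (hC : ∀ c b, IsReflection (C c b))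
    (hBC : ∀ b c, Commute (B b c) (C c b)) (hZC : ∀ c b, Commute Z (C c b))
    (hXC : ∀ c b, Commute X (C c b)) (hZB : ∀ b c, Commute Z' (B b c))
    (hXB : ∀ b c, Commute X' (B b c)) {ψ : V} {η : ℝ}
    (h₁ : ∀ c, ‖((√2 : ℝ) : ℂ) • Z ψ - (B 0 c ψ + B 1 c ψ)‖ ≤ η)
    (h₂ : ∀ c, ‖((√2 : ℝ) : ℂ) • X ψ - (B 0 c ψ - B 1 c ψ)‖ ≤ η)
    (h₃ : ∀ b, ‖((√2 : ℝ) : ℂ) • Z' ψ - (C 0 b ψ + C 1 b ψ)‖ ≤ η)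
    (h₄ : ∀ b, ‖((√2 : ℝ) : ℂ) • X' ψ - (C 0 b ψ - C 1 b ψ)‖ ≤ η) :
    ‖(Z * Z' - Z' * Z) ψ‖ ≤ 10 * η ∧ ‖(Z * X' - X' * Z) ψ‖ ≤ 10 * η ∧
      ‖(X * Z' - Z' * X) ψ‖ ≤ 10 * η ∧ ‖(X * X' - X' * X) ψ‖ ≤ 10 * η := by
  have key : ∀ e : ℂ, e = 1 ∨ e = -1 → ∃ b : Fin 2, ‖e‖ = 1 ∧
      (∀ c, ‖((√2 : ℝ) : ℂ) • (Z + e • X) ψ - (2 : ℂ) • B b c ψ‖ ≤ 2 * η) ∧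
      (∀ c, ‖((√2 : ℝ) : ℂ) • (Z' + e • X') ψ - (2 : ℂ) • C b c ψ‖ ≤ 2 * η) := by
    rintro e (rfl | rfl)
    · refine ⟨0, by simp, fun c => ?_, fun c => ?_⟩
      · simpa using (norm_sqrt_two_smul_sub (h₁ c) (h₂ c)).1
      · simpa using (norm_sqrt_two_smul_sub (h₃ c) (h₄ c)).1
    · refine ⟨1, by simp, fun c => ?_, fun c => ?_⟩
      · simpa [sub_eq_add_neg] using (norm_sqrt_two_smul_sub (h₁ c) (h₂ c)).2
      · simpa [sub_eq_add_neg] using (norm_sqrt_two_smul_sub (h₃ c) (h₄ c)).2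
  refine norm_comm_of_sum_diff fun e e' he he' => ?_
  -- The sign `e` selects the bit `b` and `e'` the bit `c`. Since the simulation holds for every
  -- spectator bit, it may be taken with `B b c` and `C c b`, the commuting pair.
  obtain ⟨b, hb, hb₁, -⟩ := key e he
  obtain ⟨c, hc, -, hc₁⟩ := key e' he'
  exact norm_comm_of_simulated (norm_add_smul_reflection_le hZ hX hb)
    (norm_add_smul_reflection_le hZ' hX' hc) (hB b c) (hC c b) (hBC b c)
    ((hZC c b).add_left ((hXC c b).smul_left e)) ((hZB b c).add_left ((hXB b c).smul_left e'))
    (hb₁ c) (hc₁ b)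

end Commutators

/-- Bob's two answers to the pair `(i, b)`, `(j, c)` serve as commuting simulators of Alice's `Z ±
X`. -/
theorem Strategy.norm_left_comm_le {n : ℕ} {HA HB : Type*} [NormedAddCommGroup HA]
    [InnerProductSpace ℂ HA] [NormedAddCommGroup HB] [InnerProductSpace ℂ HB]
    {S : Strategy n HA HB} {δ : ℝ} (hn : 2 ≤ n) (hδ : 0 < δ)
    (hS : omegaOpt - δ ≤ S.acceptProb) {i j : Fin n} (hij : i ≠ j) (P Q : Fin 2) :
    ‖left HB (S.alice.obs (i, P) * S.alice.obs (j, Q) - S.alice.obs (j, Q) * S.alice.obs (i, P))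
      S.ψ‖ ≤ 10 * (12 * (n * √δ)) := by
  have hij₁ : ∀ b c : Fin 2, ((i, b) : Question n).1 ≠ ((j, c) : Question n).1 := fun _ _ => hij
  have hij₂ : ∀ b c : Fin 2, ((j, b) : Question n).1 ≠ ((i, c) : Question n).1 :=
    fun _ _ => hij.symm
  have key := norm_comm_of_chsh (ψ := S.ψ) (η := 12 * (n * √δ))
    (B := fun b c => right HA (S.bob.answer (i, b) (j, c)))
    (C := fun c b => right HA (S.bob.answer (j, c) (i, b)))
    (S.alice.obs_refl (i, 0)).left (S.alice.obs_refl (i, 1)).left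
    (S.alice.obs_refl (j, 0)).left (S.alice.obs_refl (j, 1)).left
    (fun b c => (S.bob.answer_refl (hij₁ b c)).right)
    (fun c b => (S.bob.answer_refl (hij₂ c b)).right)
    (fun b c => commute_right (S.bob.answer_commute (hij₁ b c)))
    (fun _ _ => commute_left_right _ _) (fun _ _ => commute_left_right _ _)
    (fun _ _ => commute_left_right _ _) (fun _ _ => commute_left_right _ _)
    (fun c => (norm_chsh_le hn hδ hS (hij₁ 0 c)).1) (fun c => (norm_chsh_le hn hδ hS (hij₁ 0 c)).2)
    (fun b => (norm_chsh_le hn hδ hS (hij₂ 0 b)).1) (fun b => (norm_chsh_le hn hδ hS (hij₂ 0 b)).2)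
  rw [left_sub, left_mul, left_mul]
  revert P Q
  exact fin_two_cases (fin_two_cases key.1 key.2.1) (fin_two_cases key.2.2.1 key.2.2.2)

/-! ### Exactly anticommuting reflections on an extended space -/

section Anticommute

variable {R : Type*} [Ring R]

/-- A dilated operator `w + v q`, where `q` commutes with everything, is an involution. -/
theorem dilation_mul_self {w v q : R} (h : w * w + v * v = 1) (h' : w * v + v * w = 0)
    (hq : q * q = 1) (hwq : Commute w q) (hvq : Commute v q) : (w + v * q) * (w + v * q) = 1 := by
  have e₁ : (w + v * q) * (w + v * q) = w * w + w * v * q + v * (q * w) + v * (q * v) * q := by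
    noncomm_ring
  rw [e₁, ← hwq.eq, ← hvq.eq, mul_assoc v, mul_assoc v q q, hq, mul_one, ← mul_assoc v w q,
    add_assoc (w * w), ← add_mul, h', zero_mul, add_zero, h]

/-- The term with `w` changes sign because of `z`, the term with `v q` because of `p`; each picks up
exactly one sign. -/
theorem dilation_anticomm {z w v p q : R} (hzw : z * w = -(w * z)) (hzv : Commute z v)
    (hpq : p * q = -(q * p)) (hwp : Commute w p) (hvp : Commute v p)
    (hzq : Commute z q) :
    z * p * (w + v * q) + (w + v * q) * (z * p) = 0 := by
  have e₁ : z * p * w = -(w * (z * p)) := by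
    rw [mul_assoc, ← hwp.eq, ← mul_assoc, hzw, neg_mul, mul_assoc]
  have e₂ : z * p * (v * q) = -(v * q * (z * p)) := by
    calc z * p * (v * q) = z * (p * v) * q := by noncomm_ring
      _ = z * v * (p * q) := by rw [← hvp.eq]; noncomm_ring
      _ = -(v * (z * q) * p) := by rw [hpq, hzv.eq]; noncomm_ring
      _ = -(v * q * (z * p)) := by rw [hzq.eq]; noncomm_ring
  rw [mul_add, add_mul, e₁, e₂]
  abel

variable [Algebra ℂ R]

/-- The part of `x` anticommuting with the involution `z`. -/
def antiPart (z x : R) : R := (1 / 2 : ℂ) • (x - z * x * z)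

/-- The part of `x` commuting with the involution `z`. -/
def commPart (z x : R) : R := (1 / 2 : ℂ) • (x + z * x * z)

variable {z x : R}

theorem antiPart_add_commPart : antiPart z x + commPart z x = x := by
  unfold antiPart commPart
  module

/-- Makes the commuting part small wherever `z` and `x` nearly anticommute. -/
theorem commPart_add_self (hz : z * z = 1) :
    commPart z x + commPart z x = z * (z * x + x * z) := by
  rw [mul_add, ← mul_assoc, hz, one_mul, ← mul_assoc]
  unfold commPart
  module

theorem antiPart_anticomm (hz : z * z = 1) : z * antiPart z x = -(antiPart z x * z) := by
  unfold antiPart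
  rw [mul_smul_comm, smul_mul_assoc, mul_sub, sub_mul, mul_assoc (z * x), hz, mul_assoc z x z,
    ← mul_assoc z z, hz, one_mul, mul_one, ← smul_neg, neg_sub]

theorem commPart_comm (hz : z * z = 1) : Commute z (commPart z x) := by
  unfold commPart
  rw [commute_iff_eq, mul_smul_comm, smul_mul_assoc, mul_add, add_mul, mul_assoc (z * x), hz,
    mul_assoc z x z, ← mul_assoc z z, hz, one_mul, mul_one, add_comm]

/-- With the involution `y = z x z`, the products `(x - y)(x + y)` and `(x + y)(x - y)` add up to
`2(x² - y²) = 0`. -/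
theorem antiPart_mul_commPart (hz : z * z = 1) (hx : x * x = 1) :
    antiPart z x * commPart z x + commPart z x * antiPart z x = 0 := by
  have h : (x - z * x * z) * (x + z * x * z) + (x + z * x * z) * (x - z * x * z) = 0 := by
    have e : (z * x * z) * (z * x * z) = 1 := by
      rw [mul_assoc, ← mul_assoc z (z * x), ← mul_assoc z z, hz, one_mul, mul_assoc,
        ← mul_assoc x x, hx, one_mul, hz]
    have : (x - z * x * z) * (x + z * x * z) + (x + z * x * z) * (x - z * x * z) =
      2 • (x * x) - 2 • ((z * x * z) * (z * x * z)) := by noncomm_ring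
    rw [this, e, hx, sub_self]
  unfold antiPart commPart
  simp only [smul_mul_assoc, mul_smul_comm, ← smul_add, h, smul_zero]

theorem antiPart_sq_add_commPart_sq (hz : z * z = 1) (hx : x * x = 1) :
    antiPart z x * antiPart z x + commPart z x * commPart z x = 1 := by
  have h : (x - z * x * z) * (x - z * x * z) + (x + z * x * z) * (x + z * x * z) = (4 : ℂ) • 1 := by
    have e : (z * x * z) * (z * x * z) = 1 := by
      rw [mul_assoc, ← mul_assoc z (z * x), ← mul_assoc z z, hz, one_mul, mul_assoc,
        ← mul_assoc x x, hx, one_mul, hz]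
    have : (x - z * x * z) * (x - z * x * z) + (x + z * x * z) * (x + z * x * z) =
      2 • (x * x) + 2 • ((z * x * z) * (z * x * z)) := by noncomm_ring
    rw [this, e, hx]
    module
  unfold antiPart commPart
  simp only [smul_mul_assoc, mul_smul_comm, ← smul_add, h, smul_smul]
  norm_num

end Anticommute

namespace PlayerStrategy

variable {n : ℕ} {H : Type*} [NormedAddCommGroup H] [InnerProductSpace ℂ H]
  (s : PlayerStrategy n H)

/-- The part of `X i` anticommuting with `Z i`. -/
def anti (i : Fin n) : Module.End ℂ H := antiPart (s.Z i) (s.X i)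

/-- The part of `X i` commuting with `Z i`. -/
def comm (i : Fin n) : Module.End ℂ H := commPart (s.Z i) (s.X i)

theorem conj_isSymmetric (i : Fin n) : LinearMap.IsSymmetric (s.Z i * s.X i * s.Z i) := by
  intro v w
  simp only [Module.End.mul_apply]
  rw [(s.Z_refl i).isSymmetric, (s.X_refl i).isSymmetric, (s.Z_refl i).isSymmetric]

theorem isSymmetric_half {T : Module.End ℂ H} (hT : LinearMap.IsSymmetric T) :
    LinearMap.IsSymmetric ((1 / 2 : ℂ) • T) :=
  hT.smul (by rw [map_div₀, map_one, Complex.conj_ofNat])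

theorem anti_isSymmetric (i : Fin n) : LinearMap.IsSymmetric (s.anti i) :=
  isSymmetric_half ((s.X_refl i).isSymmetric.sub (s.conj_isSymmetric i))

theorem comm_isSymmetric (i : Fin n) : LinearMap.IsSymmetric (s.comm i) :=
  isSymmetric_half ((s.X_refl i).isSymmetric.add (s.conj_isSymmetric i))

/-- The embedding `v ↦ v ⊗ |a⟩`. -/
def embed (H : Type*) [NormedAddCommGroup H] [InnerProductSpace ℂ H] (x : Fin 1 → Fin 2) :
    H →ₗᵢ[ℂ] H ⊗[ℂ] Qubits 1 where
  toLinearMap := (TensorProduct.mk ℂ H (Qubits 1)).flip (ket x)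
  norm_map' v := by simp [ket]

theorem embed_apply (x : Fin 1 → Fin 2) (v : H) : embed H x v = v ⊗ₜ ket x := rfl

/-- One extra qubit suffices to dilate the reflections `X i` to reflections anticommuting with
`Z i`. -/
def extension : Extension s (H ⊗[ℂ] Qubits 1) where
  ι := embed H 0
  -- On `|0⟩` the factor `σ^z` is trivial, so this restricts to `s.Z i`; on `|1⟩` it is `-s.Z i`.
  -- The sign makes the commuting part of `X`, paired with `σ^x`, anticommute as well.
  Z i := left (Qubits 1) (s.Z i) * right H (onQubit (pauli 0) 0)
  X i := left (Qubits 1) (s.anti i) + left (Qubits 1) (s.comm i) * right H (onQubit (pauli 1) 0)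
  Z_refl i := (s.Z_refl i).left.mul (onQubit_pauli_refl 0 0).right (commute_left_right _ _)
  X_refl i := by
    refine ⟨LinearMap.IsSymmetric.add
      (isSymmetric_map (s.anti_isSymmetric i) IsReflection.one.isSymmetric) ?_, ?_⟩
    · rw [left_mul_right]
      exact isSymmetric_map (s.comm_isSymmetric i) (onQubit_pauli_refl 1 0).isSymmetric
    · refine dilation_mul_self ?_ ?_ (onQubit_pauli_refl 1 0).right.mul_self
        (commute_left_right _ _) (commute_left_right _ _)
      · rw [← left_mul, ← left_mul, ← left_add]
        rw [anti, comm, antiPart_sq_add_commPart_sq (s.Z_refl i).mul_self (s.X_refl i).mul_self,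
          left_one]
      · rw [← left_mul, ← left_mul, ← left_add]
        rw [anti, comm, antiPart_mul_commPart (s.Z_refl i).mul_self (s.X_refl i).mul_self]
        exact TensorProduct.map_zero_left _
  Z_extends i v := by
    simp [embed_apply, onQubit_pauli_zero_ket, bitSign]
  anticomm i := by
    refine dilation_anticomm ?_ (commute_left ?_) ?_ (commute_left_right _ _)
      (commute_left_right _ _) (commute_left_right _ _)
    · rw [← left_mul, ← left_mul, ← left_neg, anti, antiPart_anticomm (s.Z_refl i).mul_self]
    · exact commPart_comm (s.Z_refl i).mul_self
    · rw [← right_mul, onQubit_pauli_anticomm, right_neg, right_mul]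

/-- The dilation moves `X i` by `σ^x - 1` on the commuting part only, which is the part that is
small on the state. -/
theorem extension_X_embed (i : Fin n) (v : H) : s.extension.X i (embed H 0 v) =
    embed H 0 (s.X i v) + (embed H (flipBit 0 0) (s.comm i v) - embed H 0 (s.comm i v)) := by
  have e : s.X i v = s.anti i v + s.comm i v := by
    rw [← LinearMap.add_apply, anti, comm, antiPart_add_commPart]
  rw [e, map_add]
  simp [extension, embed_apply, onQubit_pauli_one_ket]

theorem extension_obs_refl (P : Fin 2) (i : Fin n) : IsReflection (s.extension.obs P i) := by
  unfold Extension.obs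
  split_ifs
  exacts [s.extension.Z_refl i, s.extension.X_refl i]

end PlayerStrategy

/-! ### The extended strategies on the state -/

section Generic

variable {V W : Type*} [NormedAddCommGroup V] [NormedAddCommGroup W]

theorem norm_sub_le_of_eq_add_sub {a b c d : V} {t : ℝ} (h : b = a + (c - d)) (hc : ‖c‖ ≤ t)
    (hd : ‖d‖ ≤ t) : ‖a - b‖ ≤ 2 * t := by
  rw [h, show a - (a + (c - d)) = d - c by abel]
  exact (norm_sub_le _ _).trans (by linarith)

theorem norm_sub_le_of_eq {a b : V} {t : ℝ} (h : a = b) (ht : 0 ≤ t) : ‖a - b‖ ≤ t := by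
  rwa [h, sub_self, norm_zero]

theorem norm_sub_le_of_approx {a b c d : V} {r s t : ℝ} (h₁ : ‖a - b‖ ≤ r) (h₂ : ‖b - c‖ ≤ s)
    (h₃ : ‖c - d‖ ≤ t) : ‖a - d‖ ≤ r + s + t := by
  rw [show a - d = (a - b) + (b - c) + (c - d) by abel]
  exact norm_add₃_le.trans (by linarith)

theorem norm_sub_le_of_approx' {a b c d : V} {r s t : ℝ} (h₁ : ‖b - a‖ ≤ r) (h₂ : ‖b - c‖ ≤ s)
    (h₃ : ‖c - d‖ ≤ t) : ‖a - d‖ ≤ r + s + t :=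
  norm_sub_le_of_approx (by rwa [norm_sub_rev]) h₂ h₃

variable [InnerProductSpace ℂ V] [InnerProductSpace ℂ W]

theorem two_mul_norm_eq {v w : V} (h : v + v = w) : 2 * ‖v‖ = ‖w‖ := by
  rw [← h, ← two_smul ℂ v, norm_smul]; simp

/-- Products of dilated operators on the embedded state are close to the embedded products. -/
theorem norm_dilated_mul_sub_le (J : V →ₗ[ℂ] W) (hJ₀ : ∀ v, ‖J v‖ = ‖v‖) {P Q Q' : Module.End ℂ V}
    {P' T T' : Module.End ℂ W} {ψ : V} {η : ℝ} (hP : IsReflection P) (hP' : IsReflection P')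
    (hT' : IsReflection T') (hPQ : Commute P Q') (hPT : Commute P' T')
    (hJ : ∀ v, T' (J v) = J (Q' v)) (h₁ : ‖Q ψ - Q' ψ‖ ≤ η)
    (h₂ : ‖J (P ψ) - P' (J ψ)‖ ≤ 4 * η) (h₃ : ‖J (Q ψ) - T (J ψ)‖ ≤ 4 * η) :
    ‖P' (T (J ψ)) - J (P (Q ψ))‖ ≤ 10 * η := by
  have e₁ : P (Q' ψ) = Q' (P ψ) := LinearMap.congr_fun hPQ.eq ψ
  have e₂ : P' (T' (J ψ)) = T' (P' (J ψ)) := LinearMap.congr_fun hPT.eq (J ψ)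
  -- `P'` is known only on `Jψ`, so `Q` is first traded for `Q'`, which moves past it: `P'TJψ ≈
  -- P'JQψ ≈ P'JQ'ψ = T'P'Jψ ≈ T'JPψ = JPQ'ψ ≈ JPQψ`. The errors are `4 + 1 + 4 + 1` times `η`.
  have a₁ : ‖P' (T (J ψ)) - P' (J (Q ψ))‖ ≤ 4 * η := by
    rw [← map_sub, hP'.norm_apply, norm_sub_rev]; exact h₃
  have a₂ : ‖P' (J (Q ψ)) - P' (J (Q' ψ))‖ ≤ η := by
    rw [← map_sub, ← map_sub, hP'.norm_apply, hJ₀]; exact h₁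
  have a₃ : ‖P' (J (Q' ψ)) - J (P (Q' ψ))‖ ≤ 4 * η := by
    rw [← hJ, e₂, e₁, ← hJ, ← map_sub, hT'.norm_apply, norm_sub_rev]; exact h₂
  have a₄ : ‖J (P (Q' ψ)) - J (P (Q ψ))‖ ≤ η := by
    rw [← map_sub, ← map_sub, hJ₀, hP.norm_apply, norm_sub_rev]; exact h₁
  have := (norm_sub_le_norm_sub_add_norm_sub _ _ _).trans
    (add_le_add (norm_sub_le_of_approx a₁ a₂ a₃) a₄)
  linarith

theorem norm_local_dilated_mul_sub_le {H K H' K' : Type*} [NormedAddCommGroup H]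
    [InnerProductSpace ℂ H] [NormedAddCommGroup K] [InnerProductSpace ℂ K] [NormedAddCommGroup H']
    [InnerProductSpace ℂ H'] [NormedAddCommGroup K'] [InnerProductSpace ℂ K'] {ι : H →ₗᵢ[ℂ] H'}
    {κ : K →ₗᵢ[ℂ] K'} {P Q : Module.End ℂ H} {P' Q' : Module.End ℂ H'} {R : Module.End ℂ K}
    {R' : Module.End ℂ K'} {ψ : H ⊗[ℂ] K} {η : ℝ} (hP : IsReflection P) (hP' : IsReflection P')
    (hR' : IsReflection R') (hκ : ∀ v, R' (κ v) = κ (R v))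
    (h₁ : ‖left K Q ψ - right H R ψ‖ ≤ η)
    (h₂ : ‖TensorProduct.map ι.toLinearMap κ.toLinearMap (left K P ψ) -
      left K' P' (TensorProduct.map ι.toLinearMap κ.toLinearMap ψ)‖ ≤ 4 * η)
    (h₃ : ‖TensorProduct.map ι.toLinearMap κ.toLinearMap (left K Q ψ) -
      left K' Q' (TensorProduct.map ι.toLinearMap κ.toLinearMap ψ)‖ ≤ 4 * η) :
    ‖left K' P' (left K' Q' (TensorProduct.map ι.toLinearMap κ.toLinearMap ψ)) -
      TensorProduct.map ι.toLinearMap κ.toLinearMap (left K P (left K Q ψ))‖ ≤ 10 * η := by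
  refine norm_dilated_mul_sub_le (TensorProduct.map ι.toLinearMap κ.toLinearMap)
    (TensorProduct.norm_map ι κ) (T' := right H' R') hP.left hP'.left hR'.right
    (commute_left_right P R) (commute_left_right P' R') (fun v => ?_) h₁ h₂ h₃
  induction v using TensorProduct.induction_on with
  | zero => simp
  | add x y hx hy => simp only [map_add, hx, hy]
  | tmul a b => exact congrArg (ι a ⊗ₜ[ℂ] ·) (hκ b)

theorem norm_comm_dilated_le (J : V →ₗ[ℂ] W) (hJ₀ : ∀ v, ‖J v‖ = ‖v‖)
    {P Q : Module.End ℂ V} {P' Q' : Module.End ℂ W}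
    {ψ : V} {η : ℝ} (h : ‖(P * Q - Q * P) ψ‖ ≤ 10 * η)
    (h₁ : ‖P' (Q' (J ψ)) - J (P (Q ψ))‖ ≤ 10 * η)
    (h₂ : ‖Q' (P' (J ψ)) - J (Q (P ψ))‖ ≤ 10 * η) :
    ‖(P' * Q' - Q' * P') (J ψ)‖ ≤ 30 * η := by
  have e : ‖J (P (Q ψ)) - J (Q (P ψ))‖ ≤ 10 * η := by
    rw [← map_sub, hJ₀]; exact h
  rw [norm_sub_rev] at h₂
  have := norm_sub_le_of_approx h₁ e h₂
  rw [LinearMap.sub_apply, Module.End.mul_apply, Module.End.mul_apply]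
  linarith

theorem norm_local_comm_dilated_le {H K H' K' : Type*} [NormedAddCommGroup H]
    [InnerProductSpace ℂ H] [NormedAddCommGroup K] [InnerProductSpace ℂ K] [NormedAddCommGroup H']
    [InnerProductSpace ℂ H'] [NormedAddCommGroup K'] [InnerProductSpace ℂ K'] {ι : H →ₗᵢ[ℂ] H'}
    {κ : K →ₗᵢ[ℂ] K'} {P Q : Module.End ℂ H} {P' Q' : Module.End ℂ H'} {R S : Module.End ℂ K}
    {R' S' : Module.End ℂ K'} {ψ : H ⊗[ℂ] K} {η : ℝ} (hP : IsReflection P)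
    (hQ : IsReflection Q) (hP' : IsReflection P') (hQ' : IsReflection Q')
    (hR' : IsReflection R') (hS' : IsReflection S') (hRκ : ∀ v, R' (κ v) = κ (R v))
    (hSκ : ∀ v, S' (κ v) = κ (S v))
    (h₁ : ‖left K P ψ - right H R ψ‖ ≤ η) (h₂ : ‖left K Q ψ - right H S ψ‖ ≤ η)
    (h₃ : ‖TensorProduct.map ι.toLinearMap κ.toLinearMap (left K P ψ) -
      left K' P' (TensorProduct.map ι.toLinearMap κ.toLinearMap ψ)‖ ≤ 4 * η)
    (h₄ : ‖TensorProduct.map ι.toLinearMap κ.toLinearMap (left K Q ψ) -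
      left K' Q' (TensorProduct.map ι.toLinearMap κ.toLinearMap ψ)‖ ≤ 4 * η)
    (h₅ : ‖left K (P * Q - Q * P) ψ‖ ≤ 10 * η) :
    ‖left K' (P' * Q' - Q' * P') (TensorProduct.map ι.toLinearMap κ.toLinearMap ψ)‖
      ≤ 30 * η := by
  rw [left_sub, left_mul, left_mul] at h₅ ⊢
  exact norm_comm_dilated_le (TensorProduct.map ι.toLinearMap κ.toLinearMap)
    (TensorProduct.norm_map ι κ) h₅
    (norm_local_dilated_mul_sub_le hP hP' hS' hSκ h₂ h₃ h₄)
    (norm_local_dilated_mul_sub_le hQ hQ' hR' hRκ h₁ h₄ h₃)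

end Generic

namespace Strategy

variable {n : ℕ} {HA HB : Type*} [NormedAddCommGroup HA] [InnerProductSpace ℂ HA]
  [NormedAddCommGroup HB] [InnerProductSpace ℂ HB] (S : Strategy n HA HB)

/-- The embedding of the players' space into the extended space. -/
def embedding : HA ⊗[ℂ] HB →ₗ[ℂ] (HA ⊗[ℂ] Qubits 1) ⊗[ℂ] (HB ⊗[ℂ] Qubits 1) :=
  TensorProduct.map S.alice.extension.ι.toLinearMap S.bob.extension.ι.toLinearMap

theorem norm_embedding (v : HA ⊗[ℂ] HB) : ‖S.embedding v‖ = ‖v‖ :=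
  TensorProduct.norm_map S.alice.extension.ι S.bob.extension.ι v

/-- The state in the extended space. -/
def extState : (HA ⊗[ℂ] Qubits 1) ⊗[ℂ] (HB ⊗[ℂ] Qubits 1) := S.embedding S.ψ

theorem norm_extState : ‖S.extState‖ = 1 := by
  rw [extState, norm_embedding, S.norm_ψ]

theorem comm_embedding (v : HA ⊗[ℂ] HB) :
    TensorProduct.comm ℂ _ _ (S.embedding v) = S.swap.embedding (TensorProduct.comm ℂ _ _ v) := by
  induction v using TensorProduct.induction_on with
  | zero => simp
  | add x y hx hy => simp only [map_add, hx, hy]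
  | tmul a b => rfl

theorem comm_extState : TensorProduct.comm ℂ _ _ S.extState = S.swap.extState :=
  S.comm_embedding S.ψ

theorem left_Z_embedding (i : Fin n) (v : HA ⊗[ℂ] HB) :
    left (HB ⊗[ℂ] Qubits 1) (S.alice.extension.Z i) (S.embedding v) =
      S.embedding (left HB (S.alice.Z i) v) := by
  induction v using TensorProduct.induction_on with
  | zero => simp
  | add x y hx hy => simp only [map_add, hx, hy]
  | tmul a b =>
    simp [embedding, S.alice.extension.Z_extends]

theorem left_X_embedding (i : Fin n) (v : HA ⊗[ℂ] HB) :
    left (HB ⊗[ℂ] Qubits 1) (S.alice.extension.X i) (S.embedding v) =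
      S.embedding (left HB (S.alice.X i) v) +
        (TensorProduct.map (PlayerStrategy.embed HA (flipBit 0 0)).toLinearMap
          S.bob.extension.ι.toLinearMap
          (left HB (S.alice.comm i) v) - S.embedding (left HB (S.alice.comm i) v)) := by
  induction v using TensorProduct.induction_on with
  | zero => simp
  | add x y hx hy => simp only [map_add, hx, hy]; abel
  | tmul a b =>
    have h : S.alice.extension.X i (S.alice.extension.ι a) = _ := S.alice.extension_X_embed i a
    refine (congrArg (· ⊗ₜ[ℂ] S.bob.extension.ι b) h).trans ?_
    rw [TensorProduct.add_tmul, TensorProduct.sub_tmul]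
    rfl

variable {S} {δ : ℝ}

theorem norm_embedding_X_sub_le (hn : 2 ≤ n) (hδ : 0 < δ) (hS : omegaOpt - δ ≤ S.acceptProb)
    (i : Fin n) :
    ‖S.embedding (left HB (S.alice.X i) S.ψ) -
      left (HB ⊗[ℂ] Qubits 1) (S.alice.extension.X i) S.extState‖ ≤ 4 * (12 * (n * √δ)) := by
  -- Half of the anticommutator bound. The dilation error is a difference of two vectors of this
  -- norm.
  have h : ‖left HB (S.alice.comm i) S.ψ‖ ≤ 2 * (12 * (n * √δ)) := by
    have e : left HB (S.alice.comm i) S.ψ + left HB (S.alice.comm i) S.ψ =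
        left HB (S.alice.Z i) (left HB (S.alice.Z i * S.alice.X i + S.alice.X i * S.alice.Z i)
          S.ψ) := by
      rw [← Module.End.mul_apply, ← left_mul, ← LinearMap.add_apply, ← left_add,
        PlayerStrategy.comm, commPart_add_self (S.alice.Z_refl i).mul_self]
    have h₁ := two_mul_norm_eq e
    have h₂ := norm_left_anticomm_le hn hδ hS i
    rw [(S.alice.Z_refl i).left.norm_apply] at h₁
    linarith
  refine (norm_sub_le_of_eq_add_sub (S.left_X_embedding i S.ψ)
    (t := 2 * (12 * (n * √δ))) ?_ ?_).trans (by linarith)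
  · rwa [TensorProduct.norm_map]
  · rwa [norm_embedding]

theorem norm_embedding_obs_sub_le (hn : 2 ≤ n) (hδ : 0 < δ)
    (hS : omegaOpt - δ ≤ S.acceptProb) (P : Fin 2) (i : Fin n) :
    ‖S.embedding (left HB (S.alice.obs (i, P)) S.ψ) -
      left (HB ⊗[ℂ] Qubits 1) (S.alice.extension.obs P i) S.extState‖ ≤ 4 * (12 * (n * √δ)) := by
  revert P
  refine fin_two_cases ?_ (norm_embedding_X_sub_le hn hδ hS i)
  have : left (HB ⊗[ℂ] Qubits 1) (S.alice.extension.obs 0 i) S.extState =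
    S.embedding (left HB (S.alice.obs (i, 0)) S.ψ) := S.left_Z_embedding i S.ψ
  exact norm_sub_le_of_eq this.symm (by positivity)

theorem norm_left_extension_comm_le (hn : 2 ≤ n) (hδ : 0 < δ)
    (hS : omegaOpt - δ ≤ S.acceptProb) {i j : Fin n} (hij : i ≠ j) (P Q : Fin 2) :
    ‖left (HB ⊗[ℂ] Qubits 1) (S.alice.extension.obs P i * S.alice.extension.obs Q j -
      S.alice.extension.obs Q j * S.alice.extension.obs P i) S.extState‖
      ≤ 30 * (12 * (n * √δ)) := by
  -- The stand-ins are Bob's original observables tensored with the identity, not his extended ones: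
  -- these commute with the embedding exactly.
  exact norm_local_comm_dilated_le (S.alice.obs_refl (i, P)) (S.alice.obs_refl (j, Q))
    (S.alice.extension_obs_refl P i) (S.alice.extension_obs_refl Q j)
    (S.bob.obs_refl (i, P)).left (S.bob.obs_refl (j, Q)).left (fun _ => rfl) (fun _ => rfl)
    (norm_left_obs_sub_right_obs_le hn hδ hS (i, P))
    (norm_left_obs_sub_right_obs_le hn hδ hS (j, Q))
    (norm_embedding_obs_sub_le hn hδ hS P i) (norm_embedding_obs_sub_le hn hδ hS Q j)
    (norm_left_comm_le hn hδ hS hij P Q)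

/-- Transfer of a bound for Alice's operators to Bob. -/
theorem norm_right_eq {K L : Type*} [NormedAddCommGroup K] [InnerProductSpace ℂ K]
    [NormedAddCommGroup L] [InnerProductSpace ℂ L] (T : Module.End ℂ L) (v : K ⊗[ℂ] L) :
    ‖right K T v‖ = ‖left K T (TensorProduct.comm ℂ K L v)‖ := by
  rw [← comm_right, TensorProduct.norm_comm]

theorem norm_right_extension_comm_le (hn : 2 ≤ n) (hδ : 0 < δ)
    (hS : omegaOpt - δ ≤ S.acceptProb) {i j : Fin n} (hij : i ≠ j) (P Q : Fin 2) :
    ‖right (HA ⊗[ℂ] Qubits 1) (S.bob.extension.obs P i * S.bob.extension.obs Q j -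
      S.bob.extension.obs Q j * S.bob.extension.obs P i) S.extState‖
      ≤ 30 * (12 * (n * √δ)) := by
  rw [norm_right_eq, comm_extState]
  exact norm_left_extension_comm_le (S := S.swap) hn hδ (by rwa [acceptProb_swap]) hij P Q

theorem norm_embedding_right_obs_sub_le (hn : 2 ≤ n) (hδ : 0 < δ)
    (hS : omegaOpt - δ ≤ S.acceptProb) (P : Fin 2) (i : Fin n) :
    ‖S.embedding (right HA (S.bob.obs (i, P)) S.ψ) -
      right (HA ⊗[ℂ] Qubits 1) (S.bob.extension.obs P i) S.extState‖
      ≤ 4 * (12 * (n * √δ)) := by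
  have h := norm_embedding_obs_sub_le (S := S.swap) hn hδ (by rwa [acceptProb_swap]) P i
  rw [← TensorProduct.norm_comm, map_sub, comm_embedding, comm_right, comm_right, comm_extState]
  exact h

/-- Passes through the original observables: `4 + 1 + 4` units. -/
theorem norm_left_sub_right_extension_le (hn : 2 ≤ n) (hδ : 0 < δ)
    (hS : omegaOpt - δ ≤ S.acceptProb) (P : Fin 2) (i : Fin n) :
    ‖left (HB ⊗[ℂ] Qubits 1) (S.alice.extension.obs P i) S.extState -
      right (HA ⊗[ℂ] Qubits 1) (S.bob.extension.obs P i) S.extState‖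
      ≤ 9 * (12 * (n * √δ)) := by
  have h₁ := norm_embedding_obs_sub_le hn hδ hS P i
  have h₃ := norm_embedding_right_obs_sub_le hn hδ hS P i
  have h₂ := norm_left_obs_sub_right_obs_le hn hδ hS (i, P)
  rw [← S.norm_embedding, map_sub] at h₂
  refine (norm_sub_le_of_approx' h₁ h₂ h₃).trans (by linarith)

end Strategy

/-! ### Swap gates -/

section SwapGate

variable {V : Type*} [NormedAddCommGroup V] [InnerProductSpace ℂ V]

/-- For `A = X ⊗ σˣ` and `B = Z ⊗ σᶻ`, where `Z` and `X` are anticommuting reflections, this gate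
swaps the qubit defined by `Z` and `X` with another qubit. -/
def swapGate (A B : Module.End ℂ V) : Module.End ℂ V := (1 / 2 : ℂ) • (1 + A + B - A * B)

theorem swapGate_symm {A B : Module.End ℂ V} (h : Commute A B) : swapGate A B = swapGate B A := by
  rw [swapGate, swapGate, h.eq, add_right_comm]

/-- On a joint eigenvector with signs `a`, `b` the gate acts as `(1 + a + b - ab)/2`, which is `-1`
if `a = b = -1` (the singlet) and `1` otherwise. -/
theorem swapGate_refl {A B : Module.End ℂ V} (hA : IsReflection A) (hB : IsReflection B)
    (h : Commute A B) : IsReflection (swapGate A B) := by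
  refine ⟨PlayerStrategy.isSymmetric_half (((IsReflection.one.isSymmetric.add
    hA.isSymmetric).add hB.isSymmetric).sub (hA.mul hB h).isSymmetric), ?_⟩
  have e₁ : A * (A * B) = B := by rw [← mul_assoc, hA.mul_self, one_mul]
  have e₂ : B * (A * B) = A := by rw [h.eq, ← mul_assoc, hB.mul_self, one_mul]
  have e₃ : A * B * A = B := by rw [h.eq, mul_assoc, hA.mul_self, mul_one]
  have e₄ : A * B * B = A := by rw [mul_assoc, hB.mul_self, mul_one]
  have e₅ : A * B * (A * B) = 1 := by rw [mul_assoc, e₂, hA.mul_self]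
  simp only [swapGate, smul_mul_assoc, mul_smul_comm, add_mul, mul_add, sub_mul, mul_sub, one_mul,
    mul_one, hA.mul_self, hB.mul_self, e₁, e₂, e₃, e₄, e₅, ← h.eq]
  module

/-- The gate is the usual `(1 + XX + YY + ZZ)/2` with `YY = -(XX)(ZZ)`. Multiplying by `x` on the
right or by `p` on the left gives the same four terms, exchanged in pairs. -/
theorem swapGate_mul {x z p q : Module.End ℂ V} (hx : x * x = 1) (hp : p * p = 1)
    (hxz : z * x = -(x * z)) (hxp : Commute x p) (hxq : Commute x q) :
    swapGate (x * p) (z * q) * x = p * swapGate (x * p) (z * q) := by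
  have e₁ : x * p * x = p := by rw [mul_assoc, ← hxp.eq, ← mul_assoc, hx, one_mul]
  have e₂ : p * (x * p) = x := by rw [← mul_assoc, ← hxp.eq, mul_assoc, hp, mul_one]
  have e₃ : z * q * x = -(x * (z * q)) := by
    rw [mul_assoc, ← hxq.eq, ← mul_assoc, hxz, neg_mul, mul_assoc]
  have e₄ : x * p * (z * q) * x = -(p * (z * q)) := by
    rw [mul_assoc, e₃, mul_neg, ← mul_assoc, e₁]
  have e₅ : p * (x * p * (z * q)) = x * (z * q) := by rw [← mul_assoc, e₂]
  simp only [swapGate, smul_mul_assoc, mul_smul_comm, add_mul, mul_add, sub_mul, mul_sub, one_mul,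
    mul_one, e₁, e₂, e₃, e₄, e₅]
  module

/-- The two anticommutation signs cancel. -/
theorem commute_of_anticomm {x z p q : Module.End ℂ V} (hxz : z * x = -(x * z))
    (hpq : q * p = -(p * q)) (hxq : Commute x q) (hzp : Commute z p) :
    Commute (x * p) (z * q) := by
  have e : z * q * (x * p) = x * p * (z * q) := by
    calc z * q * (x * p) = z * (q * x) * p := by noncomm_ring
      _ = z * x * (q * p) := by rw [← hxq.eq]; noncomm_ring
      _ = x * (z * p) * q := by rw [hxz, hpq]; noncomm_ring
      _ = x * p * (z * q) := by rw [hzp.eq]; noncomm_ring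
  exact e.symm

theorem norm_half_smul_le {v : V} {t : ℝ} (h : ‖v‖ ≤ 2 * t) : ‖(1 / 2 : ℂ) • v‖ ≤ t := by
  rw [norm_smul]
  simp only [one_div, norm_inv, Complex.norm_ofNat]
  linarith

/-- Gates built from operators close on the state are close on the state. -/
theorem norm_swapGate_sub_le {A B A' B' : Module.End ℂ V} {ψ : V} {ε : ℝ} (hA : IsReflection A)
    (hB' : IsReflection B') (hAB' : Commute A B') (hAB : Commute A' B')
    (h₁ : ‖A ψ - A' ψ‖ ≤ ε) (h₂ : ‖B ψ - B' ψ‖ ≤ ε) :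
    ‖swapGate A B ψ - swapGate A' B' ψ‖ ≤ 2 * ε := by
  have e₁ : A (B' ψ) = B' (A ψ) := LinearMap.congr_fun hAB'.eq ψ
  have e₂ : A' (B' ψ) = B' (A' ψ) := LinearMap.congr_fun hAB.eq ψ
  have a₁ : ‖A (B' ψ - B ψ)‖ ≤ ε := by rw [hA.norm_apply, norm_sub_rev]; exact h₂
  have a₂ : ‖B' (A' ψ - A ψ)‖ ≤ ε := by rw [hB'.norm_apply, norm_sub_rev]; exact h₁
  -- For the product term, `ABψ ≈ AB'ψ = B'Aψ ≈ B'A'ψ = A'B'ψ`. Four errors `ε` in all are halved.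
  have e : swapGate A B ψ - swapGate A' B' ψ = (1 / 2 : ℂ) •
      ((A ψ - A' ψ) + (B ψ - B' ψ) + A (B' ψ - B ψ) + B' (A' ψ - A ψ)) := by
    simp only [swapGate, LinearMap.smul_apply, LinearMap.add_apply, LinearMap.sub_apply,
      Module.End.mul_apply, map_sub, e₁, e₂]
    module
  rw [e]
  exact norm_half_smul_le (norm_add₄_le.trans (by linarith))

/-- An operator nearly commuting with `A` and `B` on the state nearly commutes with the gate. -/
theorem norm_swapGate_comm_le {A B B' T : Module.End ℂ V} {ψ : V} {ε : ℝ} (hA : IsReflection A)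
    (hT : IsReflection T) (hB' : IsReflection B') (hAB' : Commute A B') (hTB' : Commute T B')
    (h₁ : ‖T (A ψ) - A (T ψ)‖ ≤ ε) (h₂ : ‖T (B ψ) - B (T ψ)‖ ≤ ε) (h₃ : ‖B ψ - B' ψ‖ ≤ ε) :
    ‖T (swapGate A B ψ) - swapGate A B (T ψ)‖ ≤ 3 * ε := by
  have e₁ : ∀ v, A (B' v) = B' (A v) := LinearMap.congr_fun hAB'.eq
  have e₂ : ∀ v, T (B' v) = B' (T v) := LinearMap.congr_fun hTB'.eq
  have a₁ : ‖T (A (B ψ - B' ψ))‖ ≤ ε := by rwa [hT.norm_apply, hA.norm_apply]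
  have a₂ : ‖B' (T (A ψ) - A (T ψ))‖ ≤ ε := by rwa [hB'.norm_apply]
  have a₃ : ‖A (T (B ψ - B' ψ))‖ ≤ ε := by rwa [hA.norm_apply, hT.norm_apply]
  have a₄ : ‖A (T (B ψ) - B (T ψ))‖ ≤ ε := by rwa [hA.norm_apply]
  -- To move `T` past `A` in `TABψ`, `B` is replaced by `B'`, pulled to the left and restored
  -- afterwards. Six errors `ε` are halved.
  have e : T (swapGate A B ψ) - swapGate A B (T ψ) = (1 / 2 : ℂ) •
      (((T (A ψ) - A (T ψ)) + (T (B ψ) - B (T ψ)) - T (A (B ψ - B' ψ)) - B' (T (A ψ) - A (T ψ)))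
        + (A (T (B ψ - B' ψ)) - A (T (B ψ) - B (T ψ)))) := by
    simp only [swapGate, LinearMap.smul_apply, LinearMap.add_apply, LinearMap.sub_apply,
      Module.End.mul_apply, Module.End.one_apply, map_sub, map_add, map_smul, e₁, e₂]
    module
  rw [e]
  refine norm_half_smul_le ((norm_add_le _ _).trans ?_)
  have b₁ := norm_sub_le ((T (A ψ) - A (T ψ)) + (T (B ψ) - B (T ψ)) - T (A (B ψ - B' ψ)))
    (B' (T (A ψ) - A (T ψ)))
  have b₂ := norm_sub_le ((T (A ψ) - A (T ψ)) + (T (B ψ) - B (T ψ))) (T (A (B ψ - B' ψ)))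
  have b₃ := norm_add_le (T (A ψ) - A (T ψ)) (T (B ψ) - B (T ψ))
  have b₄ := norm_sub_le (A (T (B ψ - B' ψ))) (A (T (B ψ) - B (T ψ)))
  linarith

end SwapGate

/-! ### Circuits of swap gates -/

section Circuit

variable {V : Type*} [NormedAddCommGroup V] [InnerProductSpace ℂ V] {ι : Type*}

/-- The product of the operators `S i` for `i` in the list. -/
def circuit (S : ι → Module.End ℂ V) (l : List ι) : Module.End ℂ V := (l.map S).prod

theorem circuit_append (S : ι → Module.End ℂ V) (l l' : List ι) :
    circuit S (l ++ l') = circuit S l * circuit S l' := by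
  simp [circuit]

theorem circuit_cons (S : ι → Module.End ℂ V) (i : ι) (l : List ι) :
    circuit S (i :: l) = S i * circuit S l := by
  simp [circuit]

theorem circuit_nil (S : ι → Module.End ℂ V) : circuit S [] = 1 := rfl

theorem norm_circuit_apply {S : ι → Module.End ℂ V} (hS : ∀ i, IsReflection (S i)) (l : List ι)
    (v : V) : ‖circuit S l v‖ = ‖v‖ := by
  induction l with
  | nil => rfl
  | cons i l ih => rw [circuit_cons, Module.End.mul_apply, (hS i).norm_apply, ih]

theorem commute_circuit {S : ι → Module.End ℂ V} {T : Module.End ℂ V} {l : List ι}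
    (h : ∀ i ∈ l, Commute T (S i)) : Commute T (circuit S l) := by
  induction l with
  | nil => exact Commute.one_right T
  | cons i l ih =>
    rw [circuit_cons]
    exact (h i (by simp)).mul_right (ih fun k hk => h k (by simp [hk]))

/-- If every gate is simulated on the state by an operator commuting with everything, then an
operator nearly commuting with every gate on the state nearly commutes with the circuit. -/
theorem norm_circuit_comm_le {S S' : ι → Module.End ℂ V} {T : Module.End ℂ V} {ψ : V}
    {ε₁ ε₂ : ℝ} (hS : ∀ i, IsReflection (S i)) (hS' : ∀ i, IsReflection (S' i))
    (hT : IsReflection T) (hTS' : ∀ i, Commute T (S' i)) (hSS' : ∀ i k, Commute (S' i) (S k))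
    (h₁ : ∀ i, ‖S i ψ - S' i ψ‖ ≤ ε₁) (l : List ι)
    (h₂ : ∀ i ∈ l, ‖T (S i ψ) - S i (T ψ)‖ ≤ ε₂) :
    ‖T (circuit S l ψ) - circuit S l (T ψ)‖ ≤ l.length * (2 * ε₁ + ε₂) := by
  -- The gate split off is the last in the list, which acts first, because it alone meets `ψ`
  -- itself. Replacing it by its mirror and back costs `2ε₁`, exchanging it with `T` costs `ε₂`.
  induction l using List.reverseRecOn with
  | nil => simp [circuit]
  | append_singleton l i ih =>
    have ih' := ih fun k hk => h₂ k (by simp [hk])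
    have hi := h₂ i (by simp)
    set P := circuit S l with hP
    have e : circuit S (l ++ [i]) = P * S i := by
      rw [circuit_append, circuit_cons, circuit_nil, mul_one]
    have eT : ∀ v, T (S' i v) = S' i (T v) := LinearMap.congr_fun (hTS' i).eq
    have eP : ∀ v, S' i (P v) = P (S' i v) :=
      LinearMap.congr_fun (commute_circuit fun k _ => hSS' i k).eq
    have a₁ : ‖T (P (S i ψ - S' i ψ))‖ ≤ ε₁ := by
      rw [hT.norm_apply, hP, norm_circuit_apply hS]; exact h₁ i
    have a₂ : ‖S' i (T (P ψ) - P (T ψ))‖ ≤ l.length * (2 * ε₁ + ε₂) := by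
      rwa [(hS' i).norm_apply]
    have a₃ : ‖P (T (S' i ψ - S i ψ))‖ ≤ ε₁ := by
      rw [hP, norm_circuit_apply hS, hT.norm_apply, norm_sub_rev]; exact h₁ i
    have a₄ : ‖P (T (S i ψ) - S i (T ψ))‖ ≤ ε₂ := by
      rw [hP, norm_circuit_apply hS]; exact hi
    have e' : T (circuit S (l ++ [i]) ψ) - circuit S (l ++ [i]) (T ψ) =
        T (P (S i ψ - S' i ψ)) + S' i (T (P ψ) - P (T ψ)) + P (T (S' i ψ - S i ψ)) +
          P (T (S i ψ) - S i (T ψ)) := by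
      simp only [e, Module.End.mul_apply, map_sub, eT, eP, ← eT (P ψ)]
      abel
    rw [e']
    refine norm_add₄_le.trans ?_
    rw [List.length_append, List.length_singleton]
    push_cast
    linarith

/-- The circuit nearly intertwines `T` and `p` if one of its gates does so exactly. -/
theorem norm_circuit_intertwine_le {S S' : ι → Module.End ℂ V} {T p : Module.End ℂ V} {ψ : V}
    {ε₁ ε₂ : ℝ} {j : ι} (hε : 0 ≤ 2 * ε₁ + ε₂) (hS : ∀ i, IsReflection (S i))
    (hS' : ∀ i, IsReflection (S' i)) (hT : IsReflection T) (hTS' : ∀ i, Commute T (S' i))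
    (hSS' : ∀ i k, Commute (S' i) (S k)) (hp : ∀ i, i ≠ j → Commute p (S i))
    (hj : S j * T = p * S j) (h₁ : ∀ i, ‖S i ψ - S' i ψ‖ ≤ ε₁)
    (h₂ : ∀ i, i ≠ j → ‖T (S i ψ) - S i (T ψ)‖ ≤ ε₂) {l : List ι} (hl : l.Nodup) (hjl : j ∈ l) :
    ‖circuit S l (T ψ) - p (circuit S l ψ)‖ ≤ l.length * (2 * ε₁ + ε₂) := by
  obtain ⟨l₁, l₂, rfl⟩ := List.append_of_mem hjl
  have hj₁ : ∀ i ∈ l₁, i ≠ j := by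
    rintro i hi rfl
    exact (List.nodup_append.1 hl).2.2 i hi i (by simp) rfl
  have hj₂ : ∀ i ∈ l₂, i ≠ j := by
    rintro i hi rfl
    exact (List.nodup_cons.1 (List.nodup_append.1 hl).2.1).1 hi
  have e₁ : ∀ v, p (circuit S l₁ v) = circuit S l₁ (p v) :=
    LinearMap.congr_fun (commute_circuit fun i hi => hp i (hj₁ i hi)).eq
  have e₂ : ∀ v, S j (T v) = p (S j v) := LinearMap.congr_fun hj
  -- Gate `j` turns `T` into `p` exactly and the gates of `l₁` commute with `p` exactly, so only the
  -- gates of `l₂`, acting before gate `j`, cause an error.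
  have e : circuit S (l₁ ++ j :: l₂) (T ψ) - p (circuit S (l₁ ++ j :: l₂) ψ) =
      circuit S l₁ (S j (circuit S l₂ (T ψ) - T (circuit S l₂ ψ))) := by
    simp only [circuit_append, circuit_cons, Module.End.mul_apply, map_sub, e₁, e₂]
  rw [e, norm_circuit_apply hS, (hS j).norm_apply, norm_sub_rev]
  refine (norm_circuit_comm_le hS hS' hT hTS' hSS' h₁ l₂ fun i hi => h₂ i (hj₂ i hi)).trans ?_
  refine mul_le_mul_of_nonneg_right ?_ hε
  simp
  have := Nat.cast_nonneg (α := ℝ) l₁.length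
  linarith

end Circuit

/-! ### The swap circuit of one player -/

/-- The operators relevant for the swap circuit of one player: the player's reflections `M` and
ancilla operators `p`, and the operators `M'` of the other player and `p'` on the partner ancilla
that simulate them on the state `ψ`. -/
structure SwapData (n : ℕ) (V : Type*) [NormedAddCommGroup V] [InnerProductSpace ℂ V]
    (ψ : V) (ε : ℝ) where
  M : Fin 2 → Fin n → Module.End ℂ V
  p : Fin 2 → Fin n → Module.End ℂ V
  M' : Fin 2 → Fin n → Module.End ℂ V
  p' : Fin 2 → Fin n → Module.End ℂ V
  M_refl : ∀ P i, IsReflection (M P i)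
  p_refl : ∀ P i, IsReflection (p P i)
  M'_refl : ∀ P i, IsReflection (M' P i)
  p'_refl : ∀ P i, IsReflection (p' P i)
  M_anti : ∀ i, M 0 i * M 1 i = -(M 1 i * M 0 i)
  p_anti : ∀ i, p 0 i * p 1 i = -(p 1 i * p 0 i)
  M'_anti : ∀ i, M' 0 i * M' 1 i = -(M' 1 i * M' 0 i)
  p'_anti : ∀ i, p' 0 i * p' 1 i = -(p' 1 i * p' 0 i)
  p_comm : ∀ P Q i j, i ≠ j → Commute (p P i) (p Q j)
  M_comm_p : ∀ P Q i j, Commute (M P i) (p Q j)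
  M_comm_M' : ∀ P Q i j, Commute (M P i) (M' Q j)
  M_comm_p' : ∀ P Q i j, Commute (M P i) (p' Q j)
  p_comm_M' : ∀ P Q i j, Commute (p P i) (M' Q j)
  p_comm_p' : ∀ P Q i j, Commute (p P i) (p' Q j)
  M'_comm_p' : ∀ P Q i j, Commute (M' P i) (p' Q j)
  norm_M_sub_M' : ∀ P i, ‖M P i ψ - M' P i ψ‖ ≤ ε
  norm_M_comm : ∀ P Q i j, i ≠ j → ‖(M P i * M Q j - M Q j * M P i) ψ‖ ≤ ε
  p_apply : ∀ P i, p P i ψ = p' P i ψ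

namespace SwapData

variable {n : ℕ} {V : Type*} [NormedAddCommGroup V] [InnerProductSpace ℂ V] {ψ : V} {ε : ℝ}
  (D : SwapData n V ψ ε)

/-- The gate swapping the `i`-th qubit of the player with the `i`-th ancilla. -/
def gate (i : Fin n) : Module.End ℂ V := swapGate (D.M 1 i * D.p 1 i) (D.M 0 i * D.p 0 i)

/-- The operator simulating the gate on the state. -/
def mirror (i : Fin n) : Module.End ℂ V := swapGate (D.M' 1 i * D.p' 1 i) (D.M' 0 i * D.p' 0 i)

theorem M_mul_p_refl (P : Fin 2) (i : Fin n) : IsReflection (D.M P i * D.p P i) :=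
  (D.M_refl P i).mul (D.p_refl P i) (D.M_comm_p _ _ _ _)

theorem M'_mul_p'_refl (P : Fin 2) (i : Fin n) : IsReflection (D.M' P i * D.p' P i) :=
  (D.M'_refl P i).mul (D.p'_refl P i) (D.M'_comm_p' _ _ _ _)

theorem gate_commute (i : Fin n) : Commute (D.M 1 i * D.p 1 i) (D.M 0 i * D.p 0 i) :=
  commute_of_anticomm (D.M_anti i) (D.p_anti i) (D.M_comm_p _ _ _ _) (D.M_comm_p _ _ _ _)

theorem mirror_commute (i : Fin n) : Commute (D.M' 1 i * D.p' 1 i) (D.M' 0 i * D.p' 0 i) :=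
  commute_of_anticomm (D.M'_anti i) (D.p'_anti i) (D.M'_comm_p' _ _ _ _) (D.M'_comm_p' _ _ _ _)

theorem gate_refl (i : Fin n) : IsReflection (D.gate i) :=
  swapGate_refl (D.M_mul_p_refl 1 i) (D.M_mul_p_refl 0 i) (D.gate_commute i)

theorem mirror_refl (i : Fin n) : IsReflection (D.mirror i) :=
  swapGate_refl (D.M'_mul_p'_refl 1 i) (D.M'_mul_p'_refl 0 i) (D.mirror_commute i)

theorem commute_swapGate {T A B : Module.End ℂ V} (hA : Commute T A) (hB : Commute T B) :
    Commute T (swapGate A B) :=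
  ((((Commute.one_right T).add_right hA).add_right hB).sub_right (hA.mul_right hB)).smul_right _

theorem M_comm_mirror (P : Fin 2) (i j : Fin n) : Commute (D.M P i) (D.mirror j) :=
  commute_swapGate ((D.M_comm_M' _ _ _ _).mul_right (D.M_comm_p' _ _ _ _))
    ((D.M_comm_M' _ _ _ _).mul_right (D.M_comm_p' _ _ _ _))

theorem p_comm_mirror (P : Fin 2) (i j : Fin n) : Commute (D.p P i) (D.mirror j) :=
  commute_swapGate ((D.p_comm_M' _ _ _ _).mul_right (D.p_comm_p' _ _ _ _))
    ((D.p_comm_M' _ _ _ _).mul_right (D.p_comm_p' _ _ _ _))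

theorem mirror_comm_gate (i j : Fin n) : Commute (D.mirror i) (D.gate j) :=
  commute_swapGate ((D.M_comm_mirror _ _ _).symm.mul_right (D.p_comm_mirror _ _ _).symm)
    ((D.M_comm_mirror _ _ _).symm.mul_right (D.p_comm_mirror _ _ _).symm)

theorem p_comm_gate (P : Fin 2) {i j : Fin n} (h : i ≠ j) : Commute (D.p P i) (D.gate j) :=
  commute_swapGate ((D.M_comm_p _ _ _ _).symm.mul_right (D.p_comm _ _ _ _ h))
    ((D.M_comm_p _ _ _ _).symm.mul_right (D.p_comm _ _ _ _ h))

theorem gate_mul_M (P : Fin 2) (j : Fin n) : D.gate j * D.M P j = D.p P j * D.gate j := by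
  revert P
  refine fin_two_cases ?_ ?_
  · rw [gate, swapGate_symm (D.gate_commute j)]
    exact swapGate_mul (D.M_refl 0 j).mul_self (D.p_refl 0 j).mul_self
      (by rw [D.M_anti, neg_neg]) (D.M_comm_p _ _ _ _) (D.M_comm_p _ _ _ _)
  · exact swapGate_mul (D.M_refl 1 j).mul_self (D.p_refl 1 j).mul_self
      (D.M_anti j) (D.M_comm_p _ _ _ _) (D.M_comm_p _ _ _ _)

/-- On `ψ` the ancilla operator equals its partner exactly, so only the error between `M` and `M'`
remains. -/
theorem norm_M_mul_p_sub_le (P : Fin 2) (i : Fin n) :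
    ‖(D.M P i * D.p P i) ψ - (D.M' P i * D.p' P i) ψ‖ ≤ ε := by
  rw [(D.M'_comm_p' _ _ _ _).eq, Module.End.mul_apply, D.p_apply, ← Module.End.mul_apply,
    (D.M_comm_p' _ _ _ _).eq, Module.End.mul_apply, Module.End.mul_apply, ← map_sub,
    (D.p'_refl P i).norm_apply]
  exact D.norm_M_sub_M' P i

theorem norm_gate_sub_mirror_le (i : Fin n) : ‖D.gate i ψ - D.mirror i ψ‖ ≤ 2 * ε :=
  norm_swapGate_sub_le (D.M_mul_p_refl 1 i) (D.M'_mul_p'_refl 0 i)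
    (((D.M_comm_M' _ _ _ _).mul_right (D.M_comm_p' _ _ _ _)).mul_left
      ((D.p_comm_M' _ _ _ _).mul_right (D.p_comm_p' _ _ _ _)))
    (D.mirror_commute i) (D.norm_M_mul_p_sub_le 1 i) (D.norm_M_mul_p_sub_le 0 i)

theorem norm_M_gate_comm_le (P : Fin 2) {i j : Fin n} (h : i ≠ j) :
    ‖D.M P j (D.gate i ψ) - D.gate i (D.M P j ψ)‖ ≤ 3 * ε := by
  have key : ∀ Q, ‖D.M P j ((D.M Q i * D.p Q i) ψ) - (D.M Q i * D.p Q i) (D.M P j ψ)‖ ≤ ε := by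
    intro Q
    rw [← Module.End.mul_apply, ← Module.End.mul_apply, mul_assoc, ← (D.M_comm_p P Q j i).eq,
      ← mul_assoc, ← mul_assoc, (((D.M_comm_p P Q j i).mul_left (D.M_comm_p Q Q i i))).eq,
      (((D.M_comm_p Q Q i i).mul_left (D.M_comm_p P Q j i))).eq,
      Module.End.mul_apply (D.p Q i), Module.End.mul_apply (D.p Q i), ← map_sub,
      (D.p_refl Q i).norm_apply]
    exact D.norm_M_comm P Q j i h.symm
  exact norm_swapGate_comm_le (D.M_mul_p_refl 1 i) (D.M_refl P j) (D.M'_mul_p'_refl 0 i)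
    (((D.M_comm_M' _ _ _ _).mul_right (D.M_comm_p' _ _ _ _)).mul_left
      ((D.p_comm_M' _ _ _ _).mul_right (D.p_comm_p' _ _ _ _)))
    ((D.M_comm_M' _ _ _ _).mul_right (D.M_comm_p' _ _ _ _)) (key 1) (key 0)
    (D.norm_M_mul_p_sub_le 0 i)

/-- The swap circuit nearly maps the player's reflections to the Pauli operators on the
ancillas. -/
theorem norm_circuit_le (P : Fin 2) (j : Fin n) :
    ‖circuit D.gate (List.finRange n) (D.M P j ψ) -
      D.p P j (circuit D.gate (List.finRange n) ψ)‖ ≤ n * (7 * ε) := by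
  have hε : 0 ≤ ε := (norm_nonneg _).trans (D.norm_M_sub_M' P j)
  -- The cost per gate is `2 · 2ε + 3ε = 7ε`.
  have h := norm_circuit_intertwine_le (j := j) (p := D.p P j) (by positivity) D.gate_refl
    D.mirror_refl
    (D.M_refl P j) (D.M_comm_mirror P j) D.mirror_comm_gate
    (fun i hi => D.p_comm_gate P hi.symm) (D.gate_mul_M P j) D.norm_gate_sub_mirror_le
    (fun i hi => D.norm_M_gate_comm_le P hi) (List.nodup_finRange n) (List.mem_finRange j)
  rw [List.length_finRange] at h
  refine h.trans (le_of_eq (by ring))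

end SwapData

/-! ### Projecting onto the stabilized subspace -/

section Stabilized

variable {V : Type*} [NormedAddCommGroup V] [InnerProductSpace ℂ V]

/-- Pythagoras: the error splits into a `-1` eigenvector of `g`, coming from `v`, and the projection
of `v - u` onto the `+1` eigenspace. -/
theorem norm_sq_sub_half_le {g : Module.End ℂ V} (hg : IsReflection g) (v u : V) :
    ‖v - (1 / 2 : ℂ) • (u + g u)‖ ^ 2 ≤ ‖(1 / 2 : ℂ) • (v - g v)‖ ^ 2 + ‖v - u‖ ^ 2 := by
  have e : v - (1 / 2 : ℂ) • (u + g u) =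
      (1 / 2 : ℂ) • (v - g v) + (1 / 2 : ℂ) • ((v - u) + g (v - u)) := by
    rw [map_sub]; module
  have h₀ : inner ℂ (v - g v) ((v - u) + g (v - u)) = 0 := by
    have h₁ : inner ℂ (g v) (v - u) = inner ℂ v (g (v - u)) := hg.isSymmetric _ _
    rw [inner_sub_left, inner_add_right, inner_add_right, hg.inner_apply_apply, h₁]
    ring
  have h₁ : ‖(1 / 2 : ℂ) • ((v - u) + g (v - u))‖ ≤ ‖v - u‖ := by
    refine norm_half_smul_le ((norm_add_le _ _).trans ?_)
    rw [hg.norm_apply]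
    linarith
  rw [e, @norm_add_sq ℂ, inner_smul_left, inner_smul_right, h₀]
  have h₂ := pow_le_pow_left₀ (norm_nonneg _) h₁ 2
  simp only [mul_zero, map_zero]
  linarith

/-- A vector nearly fixed by commuting reflections is close to a vector fixed by them. -/
theorem exists_fixed_near {v : V} {t : ℝ} (l : List (Module.End ℂ V))
    (hl : ∀ g ∈ l, IsReflection g) (hc : ∀ g ∈ l, ∀ g' ∈ l, Commute g g')
    (h : ∀ g ∈ l, ‖v - g v‖ ≤ 2 * t) :
    ∃ u, (∀ g ∈ l, g u = u) ∧ ‖v - u‖ ^ 2 ≤ l.length * t ^ 2 := by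
  induction l with
  | nil => exact ⟨v, by simp, by simp⟩
  | cons g l ih =>
    obtain ⟨u, hu, hvu⟩ := ih (fun k hk => hl k (by simp [hk]))
      (fun k hk k' hk' => hc k (by simp [hk]) k' (by simp [hk'])) fun k hk => h k (by simp [hk])
    -- The projection of `u` onto the fixed space of `g`; commutation keeps it fixed by the earlier
    -- reflections. Squared errors add, so the distance grows like the square root of the number of
    -- reflections.
    refine ⟨(1 / 2 : ℂ) • (u + g u), fun k hk => ?_, ?_⟩
    · rcases List.mem_cons.1 hk with rfl | hk'
      · rw [map_smul, map_add, (hl _ (by simp)).apply_apply, add_comm]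
      · have e : k (g u) = g (k u) := LinearMap.congr_fun (hc k hk g (by simp)).eq u
        rw [map_smul, map_add, e, hu k hk']
    · have h₁ := norm_sq_sub_half_le (hl g (by simp)) v u
      have h₂ : ‖(1 / 2 : ℂ) • (v - g v)‖ ≤ t := norm_half_smul_le (h g (by simp))
      have h₃ := pow_le_pow_left₀ (norm_nonneg _) h₂ 2
      rw [List.length_cons]
      push_cast
      linarith

/-- A unit vector near the range of an isometry is near the image of a unit vector. -/
theorem exists_unit_near {W : Type*} [NormedAddCommGroup W] [InnerProductSpace ℂ W]
    (J : W →ₗ[ℂ] V) (hJ : ∀ w, ‖J w‖ = ‖w‖) {u₀ : W} (hu₀ : ‖u₀‖ = 1) {v : V} (hv : ‖v‖ = 1)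
    {w : W} {s : ℝ} (h : ‖v - J w‖ ≤ s) : ∃ e : W, ‖e‖ = 1 ∧ ‖v - J e‖ ≤ 2 * s := by
  by_cases hw : w = 0
  -- Here `s ≥ 1`, so any unit vector is near enough.
  · refine ⟨u₀, hu₀, (norm_sub_le _ _).trans ?_⟩
    rw [hw, map_zero, sub_zero, hv] at h
    rw [hJ, hu₀, hv]
    linarith
  · have hw' : ‖w‖ ≠ 0 := norm_ne_zero_iff.2 hw
    refine ⟨((‖w‖⁻¹ : ℝ) : ℂ) • w, ?_, ?_⟩
    · rw [norm_smul, Complex.norm_real, norm_inv, norm_norm, inv_mul_cancel₀ hw']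
    · have h₁ : ‖J w - J (((‖w‖⁻¹ : ℝ) : ℂ) • w)‖ = |‖w‖ - 1| := by
        have : w - ((‖w‖⁻¹ : ℝ) : ℂ) • w = ((1 - ‖w‖⁻¹ : ℝ) : ℂ) • w := by
          push_cast; module
        rw [← map_sub, hJ, this, norm_smul, Complex.norm_real, Real.norm_eq_abs,
          ← abs_norm w, ← abs_mul, abs_norm, sub_mul, inv_mul_cancel₀ hw', one_mul]
      have h₂ : |‖w‖ - 1| ≤ s := by
        rw [← hJ w, ← hv, abs_sub_comm]
        exact (abs_norm_sub_norm_le _ _).trans h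
      have := norm_sub_le_norm_sub_add_norm_sub v (J w) (J (((‖w‖⁻¹ : ℝ) : ℂ) • w))
      linarith

end Stabilized

/-! ### The EPR state -/

section EPR

variable {n : ℕ}

theorem sum_flipBit {M : Type*} [AddCommMonoid M] (j : Fin n) (f : (Fin n → Fin 2) → M) :
    ∑ x, f (flipBit j x) = ∑ x, f x :=
  Equiv.sum_comp ⟨flipBit j, flipBit j, flipBit_flipBit j, flipBit_flipBit j⟩ f

/-- Paired bits carry equal signs under `σ^z`, and flipping the bit of one side amounts to flipping
that of the other after reindexing the sum. -/
theorem left_pauli_eprState (P : Fin 2) (j : Fin n) :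
    left (Qubits n) (onQubit (pauli P) j) (eprState n) =
      right (Qubits n) (onQubit (pauli P) j) (eprState n) := by
  unfold eprState
  rw [map_smul, map_smul, map_sum, map_sum]
  congr 1
  revert P
  refine fin_two_cases ?_ ?_
  · refine Finset.sum_congr rfl fun x _ => ?_
    rw [left_tmul, right_tmul, onQubit_pauli_zero_ket, TensorProduct.smul_tmul]
  · rw [← sum_flipBit j]
    refine Finset.sum_congr rfl fun x _ => ?_
    rw [left_tmul, right_tmul, onQubit_pauli_one_ket, onQubit_pauli_one_ket, flipBit_flipBit]

theorem norm_eprState : ‖eprState n‖ = 1 := by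
  have h : ‖∑ x : Fin n → Fin 2, (ket x ⊗ₜ[ℂ] ket x : Qubits n ⊗[ℂ] Qubits n)‖ ^ 2 = 2 ^ n := by
    have ho : Orthonormal ℂ fun x : Fin n → Fin 2 =>
        (ket x ⊗ₜ[ℂ] ket x : Qubits n ⊗[ℂ] Qubits n) := by
      rw [orthonormal_iff_ite]
      intro x y
      refine (TensorProduct.inner_tmul ..).trans ?_
      by_cases hxy : x = y
      · simp [hxy]
      · rw [EuclideanSpace.inner_single_left]
        simp [hxy]
    have h₁ := ho.inner_sum (fun _ => (1 : ℂ)) (fun _ => (1 : ℂ)) Finset.univ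
    simp only [one_smul] at h₁
    rw [inner_self_eq_norm_sq_to_K] at h₁
    have h₂ : ((‖∑ x : Fin n → Fin 2, (ket x ⊗ₜ[ℂ] ket x : Qubits n ⊗[ℂ] Qubits n)‖ ^ 2 : ℝ) : ℂ)
        = ((2 ^ n : ℝ) : ℂ) := by
      push_cast
      refine h₁.trans ?_
      simp
    exact_mod_cast h₂
  have h' : ‖∑ x : Fin n → Fin 2, (ket x ⊗ₜ[ℂ] ket x : Qubits n ⊗[ℂ] Qubits n)‖ =
      √(2 ^ n) := by
    rw [← h, Real.sqrt_sq (norm_nonneg _)]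
  unfold eprState
  refine (norm_smul _ _).trans ?_
  rw [h', Complex.norm_real, Real.norm_eq_abs, abs_of_nonneg (by positivity)]
  exact one_div_mul_cancel (by positivity)

/-- The coefficient of `|x⟩ ⊗ |y⟩`. -/
def coeff (x y : Fin n → Fin 2) (L : Type*) [AddCommGroup L] [Module ℂ L] :
    (Qubits n ⊗[ℂ] Qubits n) ⊗[ℂ] L →ₗ[ℂ] L :=
  (TensorProduct.lid ℂ L).toLinearMap ∘ₗ LinearMap.rTensor L (LinearMap.mul' ℂ ℂ ∘ₗ
    TensorProduct.map (EuclideanSpace.proj x : Qubits n →L[ℂ] ℂ).toLinearMap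
      (EuclideanSpace.proj y : Qubits n →L[ℂ] ℂ).toLinearMap)

theorem coeff_tmul (x y : Fin n → Fin 2) {L : Type*} [AddCommGroup L] [Module ℂ L]
    (s t : Qubits n) (l : L) : coeff x y L ((s ⊗ₜ t) ⊗ₜ l) = (s x * t y) • l := by
  simp [coeff]

theorem qubits_eq_sum (s : Qubits n) : s = ∑ x, s x • ket x := by
  have h := (EuclideanSpace.basisFun (Fin n → Fin 2) ℂ).sum_repr s
  simpa using h.symm

theorem eq_sum_coeff {L : Type*} [AddCommGroup L] [Module ℂ L]
    (y : (Qubits n ⊗[ℂ] Qubits n) ⊗[ℂ] L) :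
    y = ∑ a, ∑ b, (ket a ⊗ₜ[ℂ] ket b) ⊗ₜ[ℂ] coeff a b L y := by
  have h : (LinearMap.id : (Qubits n ⊗[ℂ] Qubits n) ⊗[ℂ] L →ₗ[ℂ] _) =
      ∑ a, ∑ b, TensorProduct.mk ℂ (Qubits n ⊗[ℂ] Qubits n) L (ket a ⊗ₜ[ℂ] ket b) ∘ₗ
        coeff a b L := by
    refine TensorProduct.ext_threefold fun s t l => ?_
    simp only [LinearMap.id_apply, LinearMap.sum_apply, LinearMap.comp_apply, coeff_tmul,
      TensorProduct.mk_apply]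
    conv_lhs => rw [qubits_eq_sum s, TensorProduct.sum_tmul, TensorProduct.sum_tmul]
    refine Finset.sum_congr rfl fun a _ => ?_
    conv_lhs => rw [qubits_eq_sum t, TensorProduct.tmul_sum, TensorProduct.sum_tmul]
    refine Finset.sum_congr rfl fun b _ => ?_
    rw [TensorProduct.smul_tmul_smul, TensorProduct.smul_tmul]
  simpa using LinearMap.congr_fun h y

theorem onQubit_pauli_zero_apply (j : Fin n) (s : Qubits n) (x : Fin n → Fin 2) :
    onQubit (pauli 0) j s x = bitSign (x j) * s x := by
  have h : (EuclideanSpace.proj x : Qubits n →L[ℂ] ℂ).toLinearMap ∘ₗ onQubit (pauli 0) j =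
      bitSign (x j) • (EuclideanSpace.proj x : Qubits n →L[ℂ] ℂ).toLinearMap := by
    refine qubits_ext fun y => ?_
    rw [LinearMap.comp_apply, onQubit_pauli_zero_ket]
    by_cases hxy : x = y
    · subst hxy; simp
    · simp [hxy]
  exact LinearMap.congr_fun h s

theorem onQubit_pauli_one_apply (j : Fin n) (s : Qubits n) (x : Fin n → Fin 2) :
    onQubit (pauli 1) j s x = s (flipBit j x) := by
  have h : (EuclideanSpace.proj x : Qubits n →L[ℂ] ℂ).toLinearMap ∘ₗ onQubit (pauli 1) j =
      (EuclideanSpace.proj (flipBit j x) : Qubits n →L[ℂ] ℂ).toLinearMap := by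
    refine qubits_ext fun y => ?_
    rw [LinearMap.comp_apply, onQubit_pauli_one_ket]
    have e : x = flipBit j y ↔ flipBit j x = y :=
      ⟨fun h => by rw [h, flipBit_flipBit], fun h => by rw [← h, flipBit_flipBit]⟩
    by_cases hxy : flipBit j x = y
    · simp [e.2 hxy, flipBit_flipBit]
    · simp [hxy, e]
  exact LinearMap.congr_fun h s

/-- A function on bit strings invariant under bit flips is constant. -/
theorem eq_of_flipBit_invariant {α : Type*} {f : (Fin n → Fin 2) → α}
    (h : ∀ j x, f (flipBit j x) = f x) (x : Fin n → Fin 2) : f x = f 0 := by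
  have key : ∀ (s : Finset (Fin n)) (x : Fin n → Fin 2), (∀ j, j ∉ s → x j = 0) → f x = f 0 := by
    intro s
    induction s using Finset.induction_on with
    | empty => intro x hx; rw [show x = 0 from funext fun j => hx j (by simp)]
    | insert j s hj ih =>
      intro x hx
      by_cases hxj : x j = 0
      · refine ih x fun k hk => ?_
        by_cases hkj : k = j
        · rw [hkj, hxj]
        · exact hx k (by simp [hkj, hk])
      · rw [← h j x]
        refine ih _ fun k hk => ?_
        by_cases hkj : k = j
        · rw [hkj, flipBit_same]
          generalize x j = a at *
          fin_cases a <;> simp at *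
        · rw [flipBit_of_ne hkj]
          exact hx k (by simp [hkj, hk])
  exact key Finset.univ x (by simp)

/-- A vector stabilized by all `σᴾ ⊗ σᴾ` is a multiple of the EPR state. -/
theorem eq_eprState_tmul_of_fixed {L : Type*} [NormedAddCommGroup L] [InnerProductSpace ℂ L]
    {y : (Qubits n ⊗[ℂ] Qubits n) ⊗[ℂ] L}
    (h : ∀ P j, left L (TensorProduct.map (onQubit (pauli P) j) (onQubit (pauli P) j)) y = y) :
    ∃ w : L, y = eprState n ⊗ₜ w := by
  -- The `σ^z` relations kill the coefficients with `a ≠ b`; the `σ^x` relations make the diagonal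
  -- invariant under bit flips, hence constant.
  have hz : ∀ j a b, coeff a b L y = (bitSign (a j) * bitSign (b j)) • coeff a b L y := by
    intro j a b
    have e : coeff a b L ∘ₗ
        left L (TensorProduct.map (onQubit (pauli 0) j) (onQubit (pauli 0) j)) =
        (bitSign (a j) * bitSign (b j)) • coeff a b L := by
      refine TensorProduct.ext_threefold fun s t l => ?_
      rw [LinearMap.comp_apply, left_tmul, TensorProduct.map_tmul, coeff_tmul,
        LinearMap.smul_apply, coeff_tmul, onQubit_pauli_zero_apply, onQubit_pauli_zero_apply,
        smul_smul]
      congr 1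
      ring
    have := LinearMap.congr_fun e y
    rwa [LinearMap.comp_apply, h 0 j, LinearMap.smul_apply] at this
  have hx : ∀ j a b, coeff (flipBit j a) (flipBit j b) L y = coeff a b L y := by
    intro j a b
    have e : coeff a b L ∘ₗ
        left L (TensorProduct.map (onQubit (pauli 1) j) (onQubit (pauli 1) j)) =
        coeff (flipBit j a) (flipBit j b) L := by
      refine TensorProduct.ext_threefold fun s t l => ?_
      rw [LinearMap.comp_apply, left_tmul, TensorProduct.map_tmul, coeff_tmul, coeff_tmul,
        onQubit_pauli_one_apply, onQubit_pauli_one_apply]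
    have := LinearMap.congr_fun e y
    rwa [LinearMap.comp_apply, h 1 j, eq_comm] at this
  have h₀ : ∀ a b, a ≠ b → coeff a b L y = 0 := by
    intro a b hab
    obtain ⟨j, hj⟩ := Function.ne_iff.1 hab
    have e := hz j a b
    have : bitSign (a j) * bitSign (b j) = -1 := by
      generalize a j = c at *
      generalize b j = d at *
      fin_cases c <;> fin_cases d <;> simp [bitSign] at *
    rw [this, neg_one_smul] at e
    have h₂ : (2 : ℂ) • coeff a b L y = 0 := by
      rw [two_smul]
      exact add_eq_zero_iff_eq_neg.2 e
    exact (smul_eq_zero.1 h₂).resolve_left two_ne_zero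
  have h₁ : ∀ a, coeff a a L y = coeff 0 0 L y :=
    eq_of_flipBit_invariant (f := fun a => coeff a a L y) fun j a => hx j a a
  refine ⟨((√(2 ^ n) : ℝ) : ℂ) • coeff 0 0 L y, ?_⟩
  have e₁ : y = ∑ a, (ket a ⊗ₜ[ℂ] ket a) ⊗ₜ[ℂ] coeff 0 0 L y := by
    conv_lhs => rw [eq_sum_coeff y]
    refine Finset.sum_congr rfl fun a _ => ?_
    rw [Finset.sum_eq_single a, h₁]
    · intro b _ hb
      rw [h₀ a b hb.symm, TensorProduct.tmul_zero]
    · simp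
  conv_lhs => rw [e₁]
  rw [eprState, TensorProduct.smul_tmul, smul_smul, ← Complex.ofReal_mul,
    one_div_mul_cancel (by positivity), Complex.ofReal_one, one_smul, TensorProduct.sum_tmul]

theorem pauli_pair_commute (P Q : Fin 2) (j k : Fin n) :
    Commute (TensorProduct.map (onQubit (pauli P) j) (onQubit (pauli P) j))
      (TensorProduct.map (onQubit (pauli Q) k) (onQubit (pauli Q) k)) := by
  by_cases hjk : j = k
  · subst hjk
    have h : Commute (TensorProduct.map (onQubit (pauli 1) j) (onQubit (pauli 1) j))
        (TensorProduct.map (onQubit (pauli 0) j) (onQubit (pauli 0) j)) := by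
      rw [← left_mul_right, ← left_mul_right]
      refine commute_of_anticomm ?_ ?_ (commute_left_right _ _) (commute_left_right _ _)
      · rw [← left_mul, onQubit_pauli_anticomm, left_neg, left_mul]
      · rw [← right_mul, onQubit_pauli_anticomm, right_neg, right_mul]
    revert P Q
    exact fin_two_cases (fin_two_cases (Commute.refl _) h.symm)
      (fin_two_cases h (Commute.refl _))
  · rw [commute_iff_eq, ← TensorProduct.map_mul, ← TensorProduct.map_mul,
      (onQubit_pauli_commute P Q hjk).eq]

theorem norm_sub_mul_apply {V : Type*} [NormedAddCommGroup V] [InnerProductSpace ℂ V]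
    {g h : Module.End ℂ V} (hg : IsReflection g) (v : V) : ‖v - (g * h) v‖ = ‖g v - h v‖ := by
  rw [← hg.norm_apply, map_sub, Module.End.mul_apply, hg.apply_apply]

/-- A vector on which the Pauli operators of both sides nearly agree is close to the EPR state
tensored with another vector. -/
theorem exists_eprState_tmul_near {L : Type*} [NormedAddCommGroup L] [InnerProductSpace ℂ L]
    {y : (Qubits n ⊗[ℂ] Qubits n) ⊗[ℂ] L} {t : ℝ}
    (h : ∀ P j, ‖left L (left (Qubits n) (onQubit (pauli P) j)) y -
      left L (right (Qubits n) (onQubit (pauli P) j)) y‖ ≤ 2 * t) :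
    ∃ w : L, ‖y - eprState n ⊗ₜ w‖ ^ 2 ≤ 2 * n * t ^ 2 := by
  -- There are `2n` of these stabilizers, which is the factor in the bound.
  set g : Fin 2 × Fin n → Module.End ℂ ((Qubits n ⊗[ℂ] Qubits n) ⊗[ℂ] L) := fun q =>
    left L (TensorProduct.map (onQubit (pauli q.1) q.2) (onQubit (pauli q.1) q.2)) with hg
  obtain ⟨u, hu, hyu⟩ := exists_fixed_near (v := y) (t := t) (Finset.univ.toList.map g)
    (by
      intro k hk
      obtain ⟨q, -, rfl⟩ := List.mem_map.1 hk
      exact ((onQubit_pauli_refl _ _).map (onQubit_pauli_refl _ _)).left)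
    (by
      intro k hk k' hk'
      obtain ⟨q, -, rfl⟩ := List.mem_map.1 hk
      obtain ⟨r, -, rfl⟩ := List.mem_map.1 hk'
      exact commute_left (pauli_pair_commute _ _ _ _))
    (by
      intro k hk
      obtain ⟨q, -, rfl⟩ := List.mem_map.1 hk
      simp only [hg]
      rw [← left_mul_right, left_mul, norm_sub_mul_apply (onQubit_pauli_refl _ _).left.left]
      exact h q.1 q.2)
  obtain ⟨w, rfl⟩ := eq_eprState_tmul_of_fixed (y := u) fun P j =>
    hu (g (P, j)) (List.mem_map.2 ⟨(P, j), by simp, rfl⟩)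
  refine ⟨w, hyu.trans (le_of_eq ?_)⟩
  simp

end EPR

/-! ### Juxtaposition -/

section Juxt

variable {A B A' B' : Type*} [NormedAddCommGroup A] [InnerProductSpace ℂ A]
  [NormedAddCommGroup B] [InnerProductSpace ℂ B] [NormedAddCommGroup A']
  [InnerProductSpace ℂ A'] [NormedAddCommGroup B'] [InnerProductSpace ℂ B']

/-- The isometric reordering `A ⊗ (B ⊗ C) ≃ B ⊗ (A ⊗ C)`. -/
def leftCommIsometry (A B C : Type*) [NormedAddCommGroup A] [InnerProductSpace ℂ A]
    [NormedAddCommGroup B] [InnerProductSpace ℂ B] [NormedAddCommGroup C]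
    [InnerProductSpace ℂ C] : A ⊗[ℂ] (B ⊗[ℂ] C) ≃ₗᵢ[ℂ] B ⊗[ℂ] (A ⊗[ℂ] C) :=
  (TensorProduct.assocIsometry ℂ A B C).symm.trans
    ((TensorProduct.congrIsometry (TensorProduct.commIsometry ℂ A B)
      (LinearIsometryEquiv.refl ℂ C)).trans (TensorProduct.assocIsometry ℂ B A C))

/-- The isometric reordering underlying `juxt`. -/
def juxtIsometry (A B A' B' : Type*) [NormedAddCommGroup A] [InnerProductSpace ℂ A]
    [NormedAddCommGroup B] [InnerProductSpace ℂ B] [NormedAddCommGroup A']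
    [InnerProductSpace ℂ A'] [NormedAddCommGroup B'] [InnerProductSpace ℂ B'] :
    (A ⊗[ℂ] B) ⊗[ℂ] (A' ⊗[ℂ] B') ≃ₗᵢ[ℂ] (A ⊗[ℂ] A') ⊗[ℂ] (B ⊗[ℂ] B') :=
  (TensorProduct.assocIsometry ℂ A B (A' ⊗[ℂ] B')).trans
    ((TensorProduct.congrIsometry (LinearIsometryEquiv.refl ℂ A)
      (leftCommIsometry B A' B')).trans (TensorProduct.assocIsometry ℂ A A' (B ⊗[ℂ] B')).symm)

/-- The reordering coincides on pure tensors with a composite of isometries. -/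
theorem norm_tensorTensorTensorComm (z : (A ⊗[ℂ] B) ⊗[ℂ] (A' ⊗[ℂ] B')) :
    ‖TensorProduct.tensorTensorTensorComm ℂ A B A' B' z‖ = ‖z‖ := by
  have h : (juxtIsometry A B A' B').toLinearEquiv.toLinearMap =
      (TensorProduct.tensorTensorTensorComm ℂ A B A' B').toLinearMap :=
    TensorProduct.ext_fourfold' fun _ _ _ _ => rfl
  exact (congrArg norm (LinearMap.congr_fun h z)).symm.trans ((juxtIsometry A B A' B').norm_map z)

theorem left_left_tensorTensorTensorComm (T : Module.End ℂ A)
    (v : (A ⊗[ℂ] B) ⊗[ℂ] (A' ⊗[ℂ] B')) :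
    left (B ⊗[ℂ] B') (left A' T) (TensorProduct.tensorTensorTensorComm ℂ A B A' B' v) =
      TensorProduct.tensorTensorTensorComm ℂ A B A' B' (left (A' ⊗[ℂ] B') (left B T) v) := by
  have h : left (B ⊗[ℂ] B') (left A' T) ∘ₗ
      (TensorProduct.tensorTensorTensorComm ℂ A B A' B').toLinearMap =
      (TensorProduct.tensorTensorTensorComm ℂ A B A' B').toLinearMap ∘ₗ
        left (A' ⊗[ℂ] B') (left B T) :=
    TensorProduct.ext_fourfold' fun _ _ _ _ => rfl
  exact LinearMap.congr_fun h v

theorem right_left_tensorTensorTensorComm (T : Module.End ℂ B)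
    (v : (A ⊗[ℂ] B) ⊗[ℂ] (A' ⊗[ℂ] B')) :
    right (A ⊗[ℂ] A') (left B' T) (TensorProduct.tensorTensorTensorComm ℂ A B A' B' v) =
      TensorProduct.tensorTensorTensorComm ℂ A B A' B' (left (A' ⊗[ℂ] B') (right A T) v) := by
  have h : right (A ⊗[ℂ] A') (left B' T) ∘ₗ
      (TensorProduct.tensorTensorTensorComm ℂ A B A' B').toLinearMap =
      (TensorProduct.tensorTensorTensorComm ℂ A B A' B').toLinearMap ∘ₗ
        left (A' ⊗[ℂ] B') (right A T) :=
    TensorProduct.ext_fourfold' fun _ _ _ _ => rfl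
  exact LinearMap.congr_fun h v

theorem left_right_juxt (T : Module.End ℂ A') (x : A ⊗[ℂ] B) (y : A' ⊗[ℂ] B') :
    left (B ⊗[ℂ] B') (right A T) (juxt x y) = juxt x (left B' T y) := by
  have h : left (B ⊗[ℂ] B') (right A T) ∘ₗ
      (TensorProduct.tensorTensorTensorComm ℂ A B A' B').toLinearMap =
      (TensorProduct.tensorTensorTensorComm ℂ A B A' B').toLinearMap ∘ₗ
        right (A ⊗[ℂ] B) (left B' T) :=
    TensorProduct.ext_fourfold' fun _ _ _ _ => rfl
  exact LinearMap.congr_fun h (x ⊗ₜ y)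

theorem right_right_juxt (T : Module.End ℂ B') (x : A ⊗[ℂ] B) (y : A' ⊗[ℂ] B') :
    right (A ⊗[ℂ] A') (right B T) (juxt x y) = juxt x (right A' T y) := by
  have h : right (A ⊗[ℂ] A') (right B T) ∘ₗ
      (TensorProduct.tensorTensorTensorComm ℂ A B A' B').toLinearMap =
      (TensorProduct.tensorTensorTensorComm ℂ A B A' B').toLinearMap ∘ₗ
        right (A ⊗[ℂ] B) (right A' T) :=
    TensorProduct.ext_fourfold' fun _ _ _ _ => rfl
  exact LinearMap.congr_fun h (x ⊗ₜ y)

theorem left_left_juxt (T : Module.End ℂ A) (x : A ⊗[ℂ] B) (y : A' ⊗[ℂ] B') :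
    left (B ⊗[ℂ] B') (left A' T) (juxt x y) = juxt (left B T x) y := by
  rw [juxt, left_left_tensorTensorTensorComm, left_tmul, juxt]

theorem right_left_juxt (T : Module.End ℂ B) (x : A ⊗[ℂ] B) (y : A' ⊗[ℂ] B') :
    right (A ⊗[ℂ] A') (left B' T) (juxt x y) = juxt (right A T x) y := by
  rw [juxt, right_left_tensorTensorTensorComm, left_tmul, juxt]

theorem norm_juxt (x : A ⊗[ℂ] B) (y : A' ⊗[ℂ] B') : ‖juxt x y‖ = ‖x‖ * ‖y‖ := by
  rw [juxt, norm_tensorTensorTensorComm, TensorProduct.norm_tmul]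

theorem juxt_sub_left (x x' : A ⊗[ℂ] B) (y : A' ⊗[ℂ] B') :
    juxt (x - x') y = juxt x y - juxt x' y := by
  rw [juxt, TensorProduct.sub_tmul, map_sub]
  rfl

end Juxt

/-! ### Unit vectors near the EPR state -/

theorem exists_ne_zero_right {M L : Type*} [AddCommGroup M] [Module ℂ M] [AddCommGroup L]
    [Module ℂ L] {y : M ⊗[ℂ] L} (hy : y ≠ 0) : ∃ u : L, u ≠ 0 := by
  by_contra! h
  refine hy ?_
  induction y using TensorProduct.induction_on with
  | zero => rfl
  | add a b ha hb =>
    by_cases h₀ : a = 0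
    · by_cases h₁ : b = 0
      · rw [h₀, h₁, add_zero]
      · exact absurd (hb h₁) h₁
    · exact absurd (ha h₀) h₀
  | tmul a b => rw [h b, TensorProduct.tmul_zero]

theorem norm_smul_inv_norm_eq {V : Type*} [NormedAddCommGroup V] [InnerProductSpace ℂ V] {u : V}
    (hu : u ≠ 0) : ‖((‖u‖⁻¹ : ℝ) : ℂ) • u‖ = 1 := by
  rw [norm_smul, Complex.norm_real, norm_inv, norm_norm, inv_mul_cancel₀ (norm_ne_zero_iff.2 hu)]

theorem ne_zero_of_norm_eq_one {V : Type*} [NormedAddCommGroup V] {u : V} (hu : ‖u‖ = 1) :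
    u ≠ 0 := by
  rintro rfl
  simp at hu

/-- `y ≠ 0` guarantees that `L` is nontrivial, so a unit vector is available even if `w = 0`. -/
theorem exists_unit_tmul_near {M L : Type*} [NormedAddCommGroup M] [InnerProductSpace ℂ M]
    [NormedAddCommGroup L] [InnerProductSpace ℂ L] {m : M} (hm : ‖m‖ = 1) {y : M ⊗[ℂ] L}
    (hy : ‖y‖ = 1) {w : L} {s : ℝ} (h : ‖y - m ⊗ₜ w‖ ≤ s) :
    ∃ e : L, ‖e‖ = 1 ∧ ‖y - m ⊗ₜ e‖ ≤ 2 * s := by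
  obtain ⟨u, hu⟩ := exists_ne_zero_right (ne_zero_of_norm_eq_one hy)
  exact exists_unit_near (TensorProduct.mk ℂ M L m)
    (fun w => (TensorProduct.norm_tmul _ _).trans (by rw [hm, one_mul]))
    (norm_smul_inv_norm_eq hu) hy h

theorem exists_unit_eprState_tmul_near {n : ℕ} {L : Type*} [NormedAddCommGroup L]
    [InnerProductSpace ℂ L] {y : (Qubits n ⊗[ℂ] Qubits n) ⊗[ℂ] L} (hy : ‖y‖ = 1) {t : ℝ}
    (ht : 0 ≤ t) (h : ∀ P j, ‖left L (left (Qubits n) (onQubit (pauli P) j)) y -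
      left L (right (Qubits n) (onQubit (pauli P) j)) y‖ ≤ 2 * t) :
    ∃ e : L, ‖e‖ = 1 ∧ ‖y - eprState n ⊗ₜ e‖ ≤ 2 * (√(2 * n) * t) := by
  obtain ⟨w, hw⟩ := exists_eprState_tmul_near h
  have hw' : ‖y - eprState n ⊗ₜ w‖ ≤ √(2 * n) * t := by
    refine le_of_sq_le_sq ?_ (by positivity)
    rw [mul_pow, Real.sq_sqrt (by positivity)]
    exact hw
  exact exists_unit_tmul_near norm_eprState hy hw'

/-- A bipartite vector on which the Pauli operators of the two sides nearly agree is close to a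
product of EPR pairs and another unit vector. -/
theorem exists_juxt_eprState_near {n : ℕ} {K L : Type*} [NormedAddCommGroup K]
    [InnerProductSpace ℂ K] [NormedAddCommGroup L] [InnerProductSpace ℂ L]
    {v : (Qubits n ⊗[ℂ] K) ⊗[ℂ] (Qubits n ⊗[ℂ] L)} (hv : ‖v‖ = 1) {t : ℝ} (ht : 0 ≤ t)
    (h : ∀ P j, ‖left (Qubits n ⊗[ℂ] L) (left K (onQubit (pauli P) j)) v -
      right (Qubits n ⊗[ℂ] K) (left L (onQubit (pauli P) j)) v‖ ≤ 2 * t) :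
    ∃ e : K ⊗[ℂ] L, ‖e‖ = 1 ∧ ‖v - juxt (eprState n) e‖ ≤ 2 * (√(2 * n) * t) := by
  obtain ⟨y, rfl⟩ :=
    (TensorProduct.tensorTensorTensorComm ℂ (Qubits n) (Qubits n) K L).surjective v
  rw [norm_tensorTensorTensorComm] at hv
  obtain ⟨e, he, hye⟩ := exists_unit_eprState_tmul_near hv ht fun P j => by
    have := h P j
    rwa [left_left_tensorTensorTensorComm, right_left_tensorTensorTensorComm, ← map_sub,
      norm_tensorTensorTensorComm] at this
  refine ⟨e, he, ?_⟩
  rwa [juxt, ← map_sub, norm_tensorTensorTensorComm]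

/-! ### Local isometries -/

section LocalIsometry

theorem IsReflection.conj {G G' : Type*} [NormedAddCommGroup G] [InnerProductSpace ℂ G]
    [NormedAddCommGroup G'] [InnerProductSpace ℂ G'] {R : Module.End ℂ G} (hR : IsReflection R)
    (U : G ≃ₗᵢ[ℂ] G') : IsReflection (U.toLinearEquiv.conj R) := by
  refine ⟨fun v w => ?_, ?_⟩
  · obtain ⟨v, rfl⟩ := U.surjective v
    obtain ⟨w, rfl⟩ := U.surjective w
    simp [LinearEquiv.conj_apply, hR.isSymmetric v w]
  · ext v
    obtain ⟨v, rfl⟩ := U.surjective v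
    simp [LinearEquiv.conj_apply, hR.apply_apply]

/-- Both reflections are isometric, so moving the estimate from the actual state `v` to the ideal
state `w` costs `t` for each. -/
theorem norm_sub_apply_le_of_near {V : Type*} [NormedAddCommGroup V] [InnerProductSpace ℂ V]
    {R S : Module.End ℂ V} (hR : IsReflection R) (hS : IsReflection S) {v w : V} {s t : ℝ}
    (h : ‖R v - S v‖ ≤ s) (h' : ‖v - w‖ ≤ t) : ‖(R - S) w‖ ≤ s + 2 * t := by
  have e : (R - S) w = (R v - S v) - R (v - w) + S (v - w) := by
    simp only [LinearMap.sub_apply, map_sub]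
    abel
  have h₁ := norm_add_le ((R v - S v) - R (v - w)) (S (v - w))
  have h₂ := norm_sub_le (R v - S v) (R (v - w))
  rw [hR.norm_apply] at h₂
  rw [hS.norm_apply] at h₁
  rw [e]
  linarith

variable {G G' F F' : Type*} [NormedAddCommGroup G] [InnerProductSpace ℂ G]
  [NormedAddCommGroup G'] [InnerProductSpace ℂ G'] [NormedAddCommGroup F] [InnerProductSpace ℂ F]
  [NormedAddCommGroup F'] [InnerProductSpace ℂ F']

theorem norm_map_equiv (U : G ≃ₗᵢ[ℂ] G') (W : F ≃ₗᵢ[ℂ] F') (ψ : G ⊗[ℂ] F) :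
    ‖TensorProduct.map U.toLinearEquiv.toLinearMap W.toLinearEquiv.toLinearMap ψ‖ = ‖ψ‖ :=
  TensorProduct.norm_map U.toLinearIsometry W.toLinearIsometry ψ

theorem left_conj_map (U : G ≃ₗᵢ[ℂ] G') (W : F ≃ₗᵢ[ℂ] F') (a : Module.End ℂ G)
    (ψ : G ⊗[ℂ] F) :
    left F' (U.toLinearEquiv.conj a)
      (TensorProduct.map U.toLinearEquiv.toLinearMap W.toLinearEquiv.toLinearMap ψ) =
      TensorProduct.map U.toLinearEquiv.toLinearMap W.toLinearEquiv.toLinearMap (left F a ψ) := by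
  induction ψ using TensorProduct.induction_on with
  | zero => simp
  | add x y hx hy => simp only [map_add, hx, hy]
  | tmul x y => simp [LinearEquiv.conj_apply]

theorem right_conj_map (U : G ≃ₗᵢ[ℂ] G') (W : F ≃ₗᵢ[ℂ] F') (b : Module.End ℂ F)
    (ψ : G ⊗[ℂ] F) :
    right G' (W.toLinearEquiv.conj b)
      (TensorProduct.map U.toLinearEquiv.toLinearMap W.toLinearEquiv.toLinearMap ψ) =
      TensorProduct.map U.toLinearEquiv.toLinearMap W.toLinearEquiv.toLinearMap
        (right G b ψ) := by
  induction ψ using TensorProduct.induction_on with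
  | zero => simp
  | add x y hx hy => simp only [map_add, hx, hy]
  | tmul x y => simp [LinearEquiv.conj_apply]

theorem norm_left_conj_sub_right_conj (U : G ≃ₗᵢ[ℂ] G') (W : F ≃ₗᵢ[ℂ] F') (a : Module.End ℂ G)
    (b : Module.End ℂ F) (ψ : G ⊗[ℂ] F) :
    ‖left F' (U.toLinearEquiv.conj a)
        (TensorProduct.map U.toLinearEquiv.toLinearMap W.toLinearEquiv.toLinearMap ψ) -
      right G' (W.toLinearEquiv.conj b)
        (TensorProduct.map U.toLinearEquiv.toLinearMap W.toLinearEquiv.toLinearMap ψ)‖ =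
      ‖left F a ψ - right G b ψ‖ := by
  rw [left_conj_map, right_conj_map, ← map_sub, norm_map_equiv]

/-- If `U` is a circuit `C` followed by a reordering `L`, then conjugation by `U` can be bounded
by intertwining with the circuit. -/
theorem norm_left_conj_sub_eq {U L : G ≃ₗᵢ[ℂ] G'} {C : Module.End ℂ G} (hU : ∀ x, U x = L (C x))
    (W : F ≃ₗᵢ[ℂ] F') {s : Module.End ℂ G} {s' : Module.End ℂ G'} (hs : ∀ x, s' (L x) = L (s x))
    (a : Module.End ℂ G) (ψ : G ⊗[ℂ] F) :
    ‖left F' (U.toLinearEquiv.conj a)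
        (TensorProduct.map U.toLinearEquiv.toLinearMap W.toLinearEquiv.toLinearMap ψ) -
      left F' s' (TensorProduct.map U.toLinearEquiv.toLinearMap W.toLinearEquiv.toLinearMap ψ)‖ =
      ‖left F C (left F a ψ) - left F s (left F C ψ)‖ := by
  have h₁ : ∀ x : G ⊗[ℂ] F,
      TensorProduct.map U.toLinearEquiv.toLinearMap W.toLinearEquiv.toLinearMap x =
      TensorProduct.map L.toLinearEquiv.toLinearMap W.toLinearEquiv.toLinearMap (left F C x) := by
    intro x
    induction x using TensorProduct.induction_on with
    | zero => simp
    | add x y hx hy => simp only [map_add, hx, hy]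
    | tmul x y => exact congrArg (· ⊗ₜ[ℂ] W y) (hU x)
  have h₂ : ∀ x : G ⊗[ℂ] F, left F' s'
      (TensorProduct.map L.toLinearEquiv.toLinearMap W.toLinearEquiv.toLinearMap x) =
      TensorProduct.map L.toLinearEquiv.toLinearMap W.toLinearEquiv.toLinearMap (left F s x) := by
    intro x
    induction x using TensorProduct.induction_on with
    | zero => simp
    | add x y hx hy => simp only [map_add, hx, hy]
    | tmul x y => exact congrArg (· ⊗ₜ[ℂ] W y) (hs x)
  rw [left_conj_map, h₁, h₁, h₂, ← map_sub, norm_map_equiv]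

theorem norm_right_conj_sub_eq (U : G ≃ₗᵢ[ℂ] G') {W L : F ≃ₗᵢ[ℂ] F'} {C : Module.End ℂ F}
    (hW : ∀ x, W x = L (C x)) {s : Module.End ℂ F} {s' : Module.End ℂ F'}
    (hs : ∀ x, s' (L x) = L (s x)) (b : Module.End ℂ F) (ψ : G ⊗[ℂ] F) :
    ‖right G' (W.toLinearEquiv.conj b)
        (TensorProduct.map U.toLinearEquiv.toLinearMap W.toLinearEquiv.toLinearMap ψ) -
      right G' s' (TensorProduct.map U.toLinearEquiv.toLinearMap W.toLinearEquiv.toLinearMap ψ)‖ =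
      ‖right G C (right G b ψ) - right G s (right G C ψ)‖ := by
  have h₁ : ∀ x : G ⊗[ℂ] F,
      TensorProduct.map U.toLinearEquiv.toLinearMap W.toLinearEquiv.toLinearMap x =
      TensorProduct.map U.toLinearEquiv.toLinearMap L.toLinearEquiv.toLinearMap
        (right G C x) := by
    intro x
    induction x using TensorProduct.induction_on with
    | zero => simp
    | add x y hx hy => simp only [map_add, hx, hy]
    | tmul x y => exact congrArg (U x ⊗ₜ[ℂ] ·) (hW y)
  have h₂ : ∀ x : G ⊗[ℂ] F, right G' s'
      (TensorProduct.map U.toLinearEquiv.toLinearMap L.toLinearEquiv.toLinearMap x) =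
      TensorProduct.map U.toLinearEquiv.toLinearMap L.toLinearEquiv.toLinearMap
        (right G s x) := by
    intro x
    induction x using TensorProduct.induction_on with
    | zero => simp
    | add x y hx hy => simp only [map_add, hx, hy]
    | tmul x y => exact congrArg (U x ⊗ₜ[ℂ] ·) (hs y)
  rw [right_conj_map, h₁, h₁, h₂, ← map_sub, norm_map_equiv]

theorem left_swapGate (A B : Module.End ℂ G) :
    left F (swapGate A B) = swapGate (left F A) (left F B) := by
  rw [swapGate, left_smul, left_sub, left_add, left_add, left_mul, left_one]
  rfl

theorem right_swapGate (A B : Module.End ℂ F) :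
    right G (swapGate A B) = swapGate (right G A) (right G B) := by
  rw [swapGate, right_smul, right_sub, right_add, right_add, right_mul, right_one]
  rfl

theorem left_circuit {ι : Type*} (S : ι → Module.End ℂ G) (l : List ι) :
    left F (circuit S l) = circuit (fun i => left F (S i)) l := by
  induction l with
  | nil => exact left_one
  | cons i l ih => rw [circuit_cons, circuit_cons, left_mul, ih]

theorem right_circuit {ι : Type*} (S : ι → Module.End ℂ F) (l : List ι) :
    right G (circuit S l) = circuit (fun i => right G (S i)) l := by
  induction l with
  | nil => exact right_one
  | cons i l ih => rw [circuit_cons, circuit_cons, right_mul, ih]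

end LocalIsometry

/-! ### The swap isometry -/

/-- A state of an ancilla carrying two families of Pauli operators that agree on the state. -/
structure AncillaPair {n : ℕ} {G : Type*} [NormedAddCommGroup G] [InnerProductSpace ℂ G]
    (p p' : Fin 2 → Fin n → Module.End ℂ G) (χ : G) : Prop where
  norm_eq : ‖χ‖ = 1
  refl : ∀ P i, IsReflection (p P i)
  refl' : ∀ P i, IsReflection (p' P i)
  anti : ∀ i, p 0 i * p 1 i = -(p 1 i * p 0 i)
  anti' : ∀ i, p' 0 i * p' 1 i = -(p' 1 i * p' 0 i)
  comm : ∀ P Q i j, i ≠ j → Commute (p P i) (p Q j)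
  comm' : ∀ P Q i j, Commute (p P i) (p' Q j)
  apply_eq : ∀ P i, p P i χ = p' P i χ

theorem ancillaPair_eprState (n : ℕ) :
    AncillaPair (fun P (i : Fin n) => left (Qubits n) (onQubit (pauli P) i))
      (fun P i => right (Qubits n) (onQubit (pauli P) i)) (eprState n) where
  norm_eq := norm_eprState
  refl P i := (onQubit_pauli_refl P i).left
  refl' P i := (onQubit_pauli_refl P i).right
  anti i := by rw [← left_mul, onQubit_pauli_anticomm, left_neg, left_mul]
  anti' i := by rw [← right_mul, onQubit_pauli_anticomm, right_neg, right_mul]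
  comm P Q i j h := commute_left (onQubit_pauli_commute P Q h)
  comm' _ _ _ _ := commute_left_right _ _
  apply_eq P i := left_pauli_eprState P i

section SwapIsometry

variable {n : ℕ} {H G : Type*} [NormedAddCommGroup H] [InnerProductSpace ℂ H]
  [NormedAddCommGroup G] [InnerProductSpace ℂ G]

/-- The gate swapping the qubit defined by `a 0 i` and `a 1 i` with the ancilla defined by `p 0 i`
and `p 1 i`. -/
def localGate (a : Fin 2 → Fin n → Module.End ℂ H) (p : Fin 2 → Fin n → Module.End ℂ G)
    (i : Fin n) : Module.End ℂ (H ⊗[ℂ] G) :=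
  swapGate (left G (a 1 i) * right H (p 1 i)) (left G (a 0 i) * right H (p 0 i))

theorem localGate_refl {a : Fin 2 → Fin n → Module.End ℂ H} (ha : ∀ P i, IsReflection (a P i))
    (ha' : ∀ i, a 0 i * a 1 i = -(a 1 i * a 0 i)) {p p' : Fin 2 → Fin n → Module.End ℂ G} {χ : G}
    (hp : AncillaPair p p' χ) (i : Fin n) : IsReflection (localGate a p i) := by
  have h : ∀ P, IsReflection (left G (a P i) * right H (p P i)) := fun P =>
    (ha P i).left.mul (hp.refl P i).right (commute_left_right _ _)
  refine swapGate_refl (h 1) (h 0) (commute_of_anticomm ?_ ?_ (commute_left_right _ _)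
    (commute_left_right _ _))
  · rw [← left_mul, ha', left_neg, left_mul]
  · rw [← right_mul, hp.anti, right_neg, right_mul]

/-- In finite dimension a norm-preserving endomorphism is onto, hence unitary. -/
theorem exists_reordered_isometry {A B C : Type*} [NormedAddCommGroup A] [InnerProductSpace ℂ A]
    [NormedAddCommGroup B] [InnerProductSpace ℂ B] [NormedAddCommGroup C] [InnerProductSpace ℂ C]
    [FiniteDimensional ℂ A] [FiniteDimensional ℂ B] [FiniteDimensional ℂ C]
    {T : Module.End ℂ (A ⊗[ℂ] (B ⊗[ℂ] C))} (hT : ∀ v, ‖T v‖ = ‖v‖) :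
    ∃ U : A ⊗[ℂ] (B ⊗[ℂ] C) ≃ₗᵢ[ℂ] B ⊗[ℂ] (A ⊗[ℂ] C), ∀ v, U v = leftCommIsometry A B C (T v) :=
  ⟨(LinearIsometry.toLinearIsometryEquiv (E₁ := A ⊗[ℂ] (B ⊗[ℂ] C)) (F := A ⊗[ℂ] (B ⊗[ℂ] C))
    ⟨T, hT⟩ rfl).trans (leftCommIsometry A B C), fun _ => rfl⟩

theorem left_leftCommIsometry {A B C : Type*} [NormedAddCommGroup A] [InnerProductSpace ℂ A]
    [NormedAddCommGroup B] [InnerProductSpace ℂ B] [NormedAddCommGroup C] [InnerProductSpace ℂ C]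
    (T : Module.End ℂ B) (x : A ⊗[ℂ] (B ⊗[ℂ] C)) :
    left (A ⊗[ℂ] C) T (leftCommIsometry A B C x) =
      leftCommIsometry A B C (right A (left C T) x) := by
  have h : left (A ⊗[ℂ] C) T ∘ₗ (leftCommIsometry A B C).toLinearEquiv.toLinearMap =
      (leftCommIsometry A B C).toLinearEquiv.toLinearMap ∘ₗ right A (left C T) :=
    TensorProduct.ext_threefold' fun _ _ _ => rfl
  exact LinearMap.congr_fun h x

/-- A local isometry extracting `n` qubits: a swap circuit followed by a reordering. -/
theorem exists_swapIsometry {H : Type u} [NormedAddCommGroup H] [InnerProductSpace ℂ H]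
    [FiniteDimensional ℂ H] {a : Fin 2 → Fin n → Module.End ℂ H}
    (ha : ∀ P i, IsReflection (a P i)) (ha' : ∀ i, a 0 i * a 1 i = -(a 1 i * a 0 i)) :
    ∃ (K : Type u) (_ : NormedAddCommGroup K) (_ : InnerProductSpace ℂ K)
      (_ : FiniteDimensional ℂ K) (U L : H ⊗[ℂ] Ancilla n ≃ₗᵢ[ℂ] Qubits n ⊗[ℂ] K),
      (∀ x, U x = L (circuit
        (localGate a fun P (i : Fin n) => left (Qubits n) (onQubit (pauli P) i))
        (List.finRange n) x)) ∧
      ∀ (T : Module.End ℂ (Qubits n)) x, left K T (L x) = L (right H (left (Qubits n) T) x) := by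
  obtain ⟨U, hU⟩ := exists_reordered_isometry
    (norm_circuit_apply (localGate_refl ha ha' (ancillaPair_eprState n)) (List.finRange n))
  -- The first halves of the local EPR pairs now hold the extracted qubits and move to the front;
  -- the player's space and the partner halves are left over.
  exact ⟨H ⊗[ℂ] Qubits n, inferInstance, inferInstance, inferInstance, U,
    leftCommIsometry H (Qubits n) (Qubits n), hU, left_leftCommIsometry⟩

end SwapIsometry

/-! ### Robustness -/

/-- Two families of reflections that nearly satisfy the Pauli relations on a shared state, and
that nearly agree on it. -/
structure NearPauli {n : ℕ} {H K : Type*} [NormedAddCommGroup H] [InnerProductSpace ℂ H]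
    [NormedAddCommGroup K] [InnerProductSpace ℂ K] (a : Fin 2 → Fin n → Module.End ℂ H)
    (b : Fin 2 → Fin n → Module.End ℂ K) (φ : H ⊗[ℂ] K) (ε : ℝ) : Prop where
  norm_eq : ‖φ‖ = 1
  left_refl : ∀ P i, IsReflection (a P i)
  right_refl : ∀ P i, IsReflection (b P i)
  left_anti : ∀ i, a 0 i * a 1 i = -(a 1 i * a 0 i)
  right_anti : ∀ i, b 0 i * b 1 i = -(b 1 i * b 0 i)
  norm_sub : ∀ P i, ‖left K (a P i) φ - right H (b P i) φ‖ ≤ ε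
  norm_left_comm : ∀ P Q i j, i ≠ j → ‖left K (a P i * a Q j - a Q j * a P i) φ‖ ≤ ε
  norm_right_comm : ∀ P Q i j, i ≠ j → ‖right H (b P i * b Q j - b Q j * b P i) φ‖ ≤ ε

namespace NearPauli

variable {n : ℕ} {H K G G' : Type*} [NormedAddCommGroup H] [InnerProductSpace ℂ H]
  [NormedAddCommGroup K] [InnerProductSpace ℂ K] [NormedAddCommGroup G] [InnerProductSpace ℂ G]
  [NormedAddCommGroup G'] [InnerProductSpace ℂ G'] {a : Fin 2 → Fin n → Module.End ℂ H}
  {b : Fin 2 → Fin n → Module.End ℂ K} {φ : H ⊗[ℂ] K} {ε : ℝ}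
  {p p' : Fin 2 → Fin n → Module.End ℂ G} {χ : G} {q q' : Fin 2 → Fin n → Module.End ℂ G'}
  {χ' : G'}

theorem norm_juxt_tmul (hχ : ‖χ‖ = 1) (hχ' : ‖χ'‖ = 1) (x : H ⊗[ℂ] K) :
    ‖juxt x (χ ⊗ₜ[ℂ] χ')‖ = ‖x‖ := by
  rw [norm_juxt, TensorProduct.norm_tmul, hχ, hχ', mul_one, mul_one]

theorem norm_left_sub_right (D : NearPauli a b φ ε) (hχ : ‖χ‖ = 1) (hχ' : ‖χ'‖ = 1) (P : Fin 2)
    (i : Fin n) :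
    ‖left (K ⊗[ℂ] G') (left G (a P i)) (juxt φ (χ ⊗ₜ[ℂ] χ')) -
      right (H ⊗[ℂ] G) (left G' (b P i)) (juxt φ (χ ⊗ₜ[ℂ] χ'))‖ ≤ ε := by
  rw [left_left_juxt, right_left_juxt, ← juxt_sub_left, norm_juxt_tmul hχ hχ']
  exact D.norm_sub P i

/-- The data of the first player's swap circuit. -/
def leftData (D : NearPauli a b φ ε) (hp : AncillaPair p p' χ) (hχ' : ‖χ'‖ = 1) :
    SwapData n ((H ⊗[ℂ] G) ⊗[ℂ] (K ⊗[ℂ] G')) (juxt φ (χ ⊗ₜ[ℂ] χ')) ε where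
  M P i := left (K ⊗[ℂ] G') (left G (a P i))
  p P i := left (K ⊗[ℂ] G') (right H (p P i))
  M' P i := right (H ⊗[ℂ] G) (left G' (b P i))
  p' P i := left (K ⊗[ℂ] G') (right H (p' P i))
  M_refl P i := (D.left_refl P i).left.left
  p_refl P i := (hp.refl P i).right.left
  M'_refl P i := (D.right_refl P i).left.right
  p'_refl P i := (hp.refl' P i).right.left
  M_anti i := by
    rw [← left_mul, ← left_mul, D.left_anti, left_neg, left_neg, left_mul, left_mul]
  p_anti i := by
    rw [← left_mul, ← right_mul, hp.anti, right_neg, left_neg, right_mul, left_mul]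
  M'_anti i := by
    rw [← right_mul, ← left_mul, D.right_anti, left_neg, right_neg, left_mul, right_mul]
  p'_anti i := by
    rw [← left_mul, ← right_mul, hp.anti', right_neg, left_neg, right_mul, left_mul]
  p_comm P Q i j h := commute_left (commute_right (hp.comm P Q i j h))
  M_comm_p _ _ _ _ := commute_left (commute_left_right _ _)
  M_comm_M' _ _ _ _ := commute_left_right _ _
  M_comm_p' _ _ _ _ := commute_left (commute_left_right _ _)
  p_comm_M' _ _ _ _ := commute_left_right _ _
  p_comm_p' P Q i j := commute_left (commute_right (hp.comm' P Q i j))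
  M'_comm_p' _ _ _ _ := (commute_left_right _ _).symm
  norm_M_sub_M' := D.norm_left_sub_right hp.norm_eq hχ'
  norm_M_comm P Q i j h := by
    rw [← left_mul, ← left_mul, ← left_mul, ← left_mul, ← left_sub, ← left_sub,
      left_left_juxt, norm_juxt_tmul hp.norm_eq hχ']
    exact D.norm_left_comm P Q i j h
  p_apply P i := by
    rw [left_right_juxt, left_right_juxt, left_tmul, left_tmul, hp.apply_eq]

/-- The data of the second player's swap circuit. -/
def rightData (D : NearPauli a b φ ε) (hχ : ‖χ‖ = 1) (hq : AncillaPair q q' χ') :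
    SwapData n ((H ⊗[ℂ] G) ⊗[ℂ] (K ⊗[ℂ] G')) (juxt φ (χ ⊗ₜ[ℂ] χ')) ε where
  M P i := right (H ⊗[ℂ] G) (left G' (b P i))
  p P i := right (H ⊗[ℂ] G) (right K (q P i))
  M' P i := left (K ⊗[ℂ] G') (left G (a P i))
  p' P i := right (H ⊗[ℂ] G) (right K (q' P i))
  M_refl P i := (D.right_refl P i).left.right
  p_refl P i := (hq.refl P i).right.right
  M'_refl P i := (D.left_refl P i).left.left
  p'_refl P i := (hq.refl' P i).right.right
  M_anti i := by
    rw [← right_mul, ← left_mul, D.right_anti, left_neg, right_neg, left_mul, right_mul]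
  p_anti i := by
    rw [← right_mul, ← right_mul, hq.anti, right_neg, right_neg, right_mul, right_mul]
  M'_anti i := by
    rw [← left_mul, ← left_mul, D.left_anti, left_neg, left_neg, left_mul, left_mul]
  p'_anti i := by
    rw [← right_mul, ← right_mul, hq.anti', right_neg, right_neg, right_mul, right_mul]
  p_comm P Q i j h := commute_right (commute_right (hq.comm P Q i j h))
  M_comm_p _ _ _ _ := commute_right (commute_left_right _ _)
  M_comm_M' _ _ _ _ := (commute_left_right _ _).symm
  M_comm_p' _ _ _ _ := commute_right (commute_left_right _ _)
  p_comm_M' _ _ _ _ := (commute_left_right _ _).symm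
  p_comm_p' P Q i j := commute_right (commute_right (hq.comm' P Q i j))
  M'_comm_p' _ _ _ _ := commute_left_right _ _
  norm_M_sub_M' P i := (norm_sub_rev _ _).trans_le (D.norm_left_sub_right hχ hq.norm_eq P i)
  norm_M_comm P Q i j h := by
    rw [← right_mul, ← left_mul, ← right_mul, ← left_mul, ← right_sub, ← left_sub,
      right_left_juxt, norm_juxt_tmul hχ hq.norm_eq]
    exact D.norm_right_comm P Q i j h
  p_apply P i := by
    rw [right_right_juxt, right_right_juxt, right_tmul, right_tmul, hq.apply_eq]

theorem norm_left_circuit_le (D : NearPauli a b φ ε) (hp : AncillaPair p p' χ) (hχ' : ‖χ'‖ = 1)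
    (P : Fin 2) (j : Fin n) :
    ‖left (K ⊗[ℂ] G') (circuit (localGate a p) (List.finRange n))
        (left (K ⊗[ℂ] G') (left G (a P j)) (juxt φ (χ ⊗ₜ[ℂ] χ'))) -
      left (K ⊗[ℂ] G') (right H (p P j)) (left (K ⊗[ℂ] G')
        (circuit (localGate a p) (List.finRange n)) (juxt φ (χ ⊗ₜ[ℂ] χ')))‖ ≤ n * (7 * ε) := by
  have h : (D.leftData hp hχ').gate = fun i => left (K ⊗[ℂ] G') (localGate a p i) := by
    funext i
    rw [localGate, left_swapGate, left_mul, left_mul]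
    rfl
  have h' := (D.leftData hp hχ').norm_circuit_le P j
  rw [h] at h'
  rw [left_circuit]
  exact h'

theorem norm_right_circuit_le (D : NearPauli a b φ ε) (hχ : ‖χ‖ = 1) (hq : AncillaPair q q' χ')
    (P : Fin 2) (j : Fin n) :
    ‖right (H ⊗[ℂ] G) (circuit (localGate b q) (List.finRange n))
        (right (H ⊗[ℂ] G) (left G' (b P j)) (juxt φ (χ ⊗ₜ[ℂ] χ'))) -
      right (H ⊗[ℂ] G) (right K (q P j)) (right (H ⊗[ℂ] G)
        (circuit (localGate b q) (List.finRange n)) (juxt φ (χ ⊗ₜ[ℂ] χ')))‖ ≤ n * (7 * ε) := by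
  have h : (D.rightData hχ hq).gate = fun i => right (H ⊗[ℂ] G) (localGate b q i) := by
    funext i
    rw [localGate, right_swapGate, right_mul, right_mul]
    rfl
  have h' := (D.rightData hχ hq).norm_circuit_le P j
  rw [h] at h'
  rw [right_circuit]
  exact h'

/-- The robustness of the extracted EPR pairs. -/
theorem exists_extra {K₁ K₂ : Type*} [NormedAddCommGroup K₁] [InnerProductSpace ℂ K₁]
    [NormedAddCommGroup K₂] [InnerProductSpace ℂ K₂] (D : NearPauli a b φ ε)
    (hp : AncillaPair p p' χ) (hq : AncillaPair q q' χ') (hn : 1 ≤ n)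
    {U L : H ⊗[ℂ] G ≃ₗᵢ[ℂ] Qubits n ⊗[ℂ] K₁} {W M : K ⊗[ℂ] G' ≃ₗᵢ[ℂ] Qubits n ⊗[ℂ] K₂}
    (hU : ∀ x, U x = L (circuit (localGate a p) (List.finRange n) x))
    (hL : ∀ P i x, left K₁ (onQubit (pauli P) i) (L x) = L (right H (p P i) x))
    (hW : ∀ x, W x = M (circuit (localGate b q) (List.finRange n) x))
    (hM : ∀ P i x, left K₂ (onQubit (pauli P) i) (M x) = M (right K (q P i) x)) :
    ∃ extra : K₁ ⊗[ℂ] K₂, ‖extra‖ = 1 ∧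
      ‖TensorProduct.map U.toLinearEquiv.toLinearMap W.toLinearEquiv.toLinearMap
          (juxt φ (χ ⊗ₜ[ℂ] χ')) - juxt (eprState n) extra‖ ≤ 55 * (√n * (n * ε)) ∧
      ∀ j P,
        ‖left (Qubits n ⊗[ℂ] K₂) (U.toLinearEquiv.conj (left G (a P j)) -
          left K₁ (onQubit (pauli P) j)) (juxt (eprState n) extra)‖ ≤ 55 * (√n * (n * ε)) ∧
        ‖right (Qubits n ⊗[ℂ] K₁) (W.toLinearEquiv.conj (left G' (b P j)) -
          left K₂ (onQubit (pauli P) j)) (juxt (eprState n) extra)‖ ≤ 55 * (√n * (n * ε)) := by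
  have hε : 0 ≤ ε := (norm_nonneg _).trans (D.norm_sub 0 ⟨0, hn⟩)
  set ψ := juxt φ (χ ⊗ₜ[ℂ] χ') with hψ
  set v := TensorProduct.map U.toLinearEquiv.toLinearMap W.toLinearEquiv.toLinearMap ψ with hv
  have h₁ : ∀ P j, ‖left (Qubits n ⊗[ℂ] K₂) (U.toLinearEquiv.conj (left G (a P j))) v -
      left (Qubits n ⊗[ℂ] K₂) (left K₁ (onQubit (pauli P) j)) v‖ ≤ n * (7 * ε) := fun P j =>
    (norm_left_conj_sub_eq hU W (hL P j) _ ψ).trans_le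
      (D.norm_left_circuit_le hp hq.norm_eq P j)
  have h₂ : ∀ P j, ‖right (Qubits n ⊗[ℂ] K₁) (W.toLinearEquiv.conj (left G' (b P j))) v -
      right (Qubits n ⊗[ℂ] K₁) (left K₂ (onQubit (pauli P) j)) v‖ ≤ n * (7 * ε) := fun P j =>
    (norm_right_conj_sub_eq U hW (hM P j) _ ψ).trans_le
      (D.norm_right_circuit_le hp.norm_eq hq P j)
  have h₃ : ∀ P j, ‖left (Qubits n ⊗[ℂ] K₂) (U.toLinearEquiv.conj (left G (a P j))) v -
      right (Qubits n ⊗[ℂ] K₁) (W.toLinearEquiv.conj (left G' (b P j))) v‖ ≤ ε := fun P j =>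
    (norm_left_conj_sub_right_conj U W _ _ ψ).trans_le
      (D.norm_left_sub_right hp.norm_eq hq.norm_eq P j)
  have hn' : (1 : ℝ) ≤ n := by exact_mod_cast hn
  have hnε : ε ≤ n * ε := le_mul_of_one_le_left hε hn'
  have hnε' : 0 ≤ n * ε := by positivity
  have hs : 1 ≤ √(n : ℝ) := Real.one_le_sqrt.2 hn'
  have hsε : n * ε ≤ √n * (n * ε) := le_mul_of_one_le_left hnε' hs
  have hv₁ : ‖v‖ = 1 := by
    rw [hv, norm_map_equiv, hψ, norm_juxt_tmul hp.norm_eq hq.norm_eq, D.norm_eq]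
  -- The Pauli operators of the two sides differ by `7nε + ε + 7nε ≤ 15nε = 2t`.
  obtain ⟨extra, he, hve⟩ := exists_juxt_eprState_near hv₁ (t := 15 / 2 * (n * ε))
    (by positivity) fun P j =>
      (norm_sub_le_of_approx' (h₁ P j) (h₃ P j) (h₂ P j)).trans (by linarith)
  -- `2 · √2 · 15/2 ≤ 22.5`. The operator bounds below then need `7 + 2 · 23 = 53`.
  have hve' : ‖v - juxt (eprState n) extra‖ ≤ 23 * (√n * (n * ε)) := by
    refine hve.trans ?_
    rw [Real.sqrt_mul (by norm_num)]
    have : √2 * (√n * (n * ε)) ≤ 3 / 2 * (√n * (n * ε)) :=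
      mul_le_mul_of_nonneg_right sqrt_two_lt.le (by positivity)
    linarith
  refine ⟨extra, he, hve'.trans (by linarith), fun j P => ⟨?_, ?_⟩⟩
  · rw [left_sub]
    exact (norm_sub_apply_le_of_near ((D.left_refl P j).left.conj U).left
      (onQubit_pauli_refl P j).left.left (h₁ P j) hve').trans (by linarith)
  · rw [right_sub]
    exact (norm_sub_apply_le_of_near ((D.right_refl P j).left.conj W).right
      (onQubit_pauli_refl P j).left.right (h₂ P j) hve').trans (by linarith)

end NearPauli

/-- Local isometries extracting `n` EPR pairs from a state with nearly Pauli observables. -/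
theorem NearPauli.exists_isometries {n : ℕ} {H : Type u} {K : Type v} [NormedAddCommGroup H]
    [InnerProductSpace ℂ H] [FiniteDimensional ℂ H] [NormedAddCommGroup K]
    [InnerProductSpace ℂ K] [FiniteDimensional ℂ K] {a : Fin 2 → Fin n → Module.End ℂ H}
    {b : Fin 2 → Fin n → Module.End ℂ K} {φ : H ⊗[ℂ] K} {ε : ℝ} (D : NearPauli a b φ ε)
    (hn : 1 ≤ n) :
    ∃ (KA : Type u) (_ : NormedAddCommGroup KA) (_ : InnerProductSpace ℂ KA)
      (_ : FiniteDimensional ℂ KA)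
      (KB : Type v) (_ : NormedAddCommGroup KB) (_ : InnerProductSpace ℂ KB)
      (_ : FiniteDimensional ℂ KB)
      (UA : H ⊗[ℂ] Ancilla n ≃ₗᵢ[ℂ] Qubits n ⊗[ℂ] KA)
      (UB : K ⊗[ℂ] Ancilla n ≃ₗᵢ[ℂ] Qubits n ⊗[ℂ] KB)
      (extra : KA ⊗[ℂ] KB), ‖extra‖ = 1 ∧
      ‖TensorProduct.map UA.toLinearEquiv.toLinearMap UB.toLinearEquiv.toLinearMap
          (withAncillas n φ) - juxt (eprState n) extra‖ ≤ 55 * (√n * (n * ε)) ∧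
      ∀ j P,
        ‖left (Qubits n ⊗[ℂ] KB) (UA.toLinearEquiv.conj (left (Ancilla n) (a P j)) -
          left KA (onQubit (pauli P) j)) (juxt (eprState n) extra)‖ ≤ 55 * (√n * (n * ε)) ∧
        ‖right (Qubits n ⊗[ℂ] KA) (UB.toLinearEquiv.conj (left (Ancilla n) (b P j)) -
          left KB (onQubit (pauli P) j)) (juxt (eprState n) extra)‖ ≤ 55 * (√n * (n * ε)) := by
  obtain ⟨KA, iA, jA, fA, U, L, hU, hL⟩ := exists_swapIsometry D.left_refl D.left_anti
  obtain ⟨KB, iB, jB, fB, W, M, hW, hM⟩ := exists_swapIsometry D.right_refl D.right_anti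
  obtain ⟨extra, h₁, h₂, h₃⟩ := D.exists_extra (ancillaPair_eprState n) (ancillaPair_eprState n)
    hn hU (fun P i => hL (onQubit (pauli P) i)) hW (fun P i => hM (onQubit (pauli P) i))
  exact ⟨KA, iA, jA, fA, KB, iB, jB, fB, U, W, extra, h₁, h₂, h₃⟩

/-! ### Near-Pauli relations of the extended strategy -/

theorem norm_map_sub_self {H K : Type*} [NormedAddCommGroup H] [InnerProductSpace ℂ H]
    [NormedAddCommGroup K] [InnerProductSpace ℂ K] {A : Module.End ℂ H} {B : Module.End ℂ K}
    (hA : IsReflection A) (φ : H ⊗[ℂ] K) :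
    ‖TensorProduct.map A B φ - φ‖ = ‖left K A φ - right H B φ‖ := by
  rw [norm_sub_rev, ← left_mul_right, norm_sub_mul_apply hA.left]

theorem Extension.obs_anticomm {n : ℕ} {H H' : Type*} [NormedAddCommGroup H]
    [InnerProductSpace ℂ H] [NormedAddCommGroup H'] [InnerProductSpace ℂ H']
    {s : PlayerStrategy n H} (e : Extension s H') (i : Fin n) :
    e.obs 0 i * e.obs 1 i = -(e.obs 1 i * e.obs 0 i) :=
  eq_neg_of_add_eq_zero_left (e.anticomm i)

/-- The powers of `n` come from the stabilizer projections (`√n`), the number of gates (`n`) and the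
error of a single relation (`n√δ`). -/
theorem sqrt_mul_mul_eq_rpow {n : ℕ} (hn : 0 < n) (δ : ℝ) :
    √n * (n * (n * √δ)) = (n : ℝ) ^ (5 / 2 : ℝ) * √δ := by
  have hn' : (0 : ℝ) < n := by exact_mod_cast hn
  rw [show (5 / 2 : ℝ) = 1 / 2 + (1 + 1) by norm_num, Real.rpow_add hn', Real.rpow_add hn',
    Real.rpow_one, ← Real.sqrt_eq_rpow]
  ring

section

variable {n : ℕ} {HA : Type u} {HB : Type v} [NormedAddCommGroup HA] [InnerProductSpace ℂ HA]
  [NormedAddCommGroup HB] [InnerProductSpace ℂ HB] {S : Strategy n HA HB} {δ : ℝ}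

/-- The constant `360 = 30 · 12` is set by the commutators, the worst of the relations. -/
theorem Strategy.nearPauli (hn : 2 ≤ n) (hδ : 0 < δ) (hS : omegaOpt - δ ≤ S.acceptProb) :
    NearPauli S.alice.extension.obs S.bob.extension.obs S.extState (360 * (n * √δ)) where
  norm_eq := S.norm_extState
  left_refl := S.alice.extension_obs_refl
  right_refl := S.bob.extension_obs_refl
  left_anti := S.alice.extension.obs_anticomm
  right_anti := S.bob.extension.obs_anticomm
  norm_sub P i := (norm_left_sub_right_extension_le hn hδ hS P i).trans (by
    have : 0 ≤ n * √δ := by positivity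
    linarith)
  norm_left_comm P Q i j hij :=
    (norm_left_extension_comm_le hn hδ hS hij P Q).trans (le_of_eq (by ring))
  norm_right_comm P Q i j hij :=
    (norm_right_extension_comm_le hn hδ hS hij P Q).trans (le_of_eq (by ring))

end

end

end EPRTest

open EPRTest in
theorem theorem3 :
    ∃ C : ℝ, 0 < C ∧
    ∀ (n : ℕ), 2 ≤ n →
    ∀ (HA : Type u) [NormedAddCommGroup HA] [InnerProductSpace ℂ HA] [FiniteDimensional ℂ HA]
      (HB : Type v) [NormedAddCommGroup HB] [InnerProductSpace ℂ HB] [FiniteDimensional ℂ HB]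
      (S : Strategy n HA HB) (δ : ℝ), 0 < δ → omegaOpt - δ ≤ S.acceptProb →
    ∃ (HA' : Type u) (_ : NormedAddCommGroup HA') (_ : InnerProductSpace ℂ HA')
      (_ : FiniteDimensional ℂ HA')
      (HB' : Type v) (_ : NormedAddCommGroup HB') (_ : InnerProductSpace ℂ HB')
      (_ : FiniteDimensional ℂ HB')
      (eA : Extension S.alice HA') (eB : Extension S.bob HB') (φ : HA' ⊗[ℂ] HB'),
      -- `φ` is the state `ψ` in the extended space
      φ = TensorProduct.map eA.ι.toLinearMap eB.ι.toLinearMap S.ψ ∧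
      -- the new reflections are close to the original ones on the state
      (∀ i, ‖TensorProduct.map eA.ι.toLinearMap eB.ι.toLinearMap (left HB (S.alice.X i) S.ψ)
          - left HB' (eA.X i) φ‖ ≤ C * (n * √δ)) ∧
      (∀ i, ‖TensorProduct.map eA.ι.toLinearMap eB.ι.toLinearMap (right HA (S.bob.X i) S.ψ)
          - right HA' (eB.X i) φ‖ ≤ C * (n * √δ)) ∧
      -- operators with distinct indices nearly commute on the state
      (∀ i j, i ≠ j → ∀ P Q : Fin 2,
        ‖left HB' (eA.obs P i * eA.obs Q j - eA.obs Q j * eA.obs P i) φ‖ ≤ C * (n * √δ) ∧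
        ‖right HA' (eB.obs P i * eB.obs Q j - eB.obs Q j * eB.obs P i) φ‖ ≤ C * (n * √δ)) ∧
      -- the state is nearly stabilized
      (∀ i, ∀ P : Fin 2,
        ‖TensorProduct.map (eA.obs P i) (eB.obs P i) φ - φ‖ ≤ C * (n * √δ)) ∧
      -- the state is close to `n` EPR pairs, up to local ancillas and local unitaries
      ∃ (KA : Type u) (_ : NormedAddCommGroup KA) (_ : InnerProductSpace ℂ KA)
        (_ : FiniteDimensional ℂ KA)
        (KB : Type v) (_ : NormedAddCommGroup KB) (_ : InnerProductSpace ℂ KB)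
        (_ : FiniteDimensional ℂ KB)
        (UA : HA' ⊗[ℂ] Ancilla n ≃ₗᵢ[ℂ] Qubits n ⊗[ℂ] KA)
        (UB : HB' ⊗[ℂ] Ancilla n ≃ₗᵢ[ℂ] Qubits n ⊗[ℂ] KB)
        (extra : KA ⊗[ℂ] KB), ‖extra‖ = 1 ∧
        ‖TensorProduct.map UA.toLinearEquiv.toLinearMap UB.toLinearEquiv.toLinearMap
            (withAncillas n φ) - juxt (eprState n) extra‖ ≤ C * ((n : ℝ) ^ (5 / 2 : ℝ) * √δ) ∧
        (∀ j, ∀ P : Fin 2,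
          ‖left (Qubits n ⊗[ℂ] KB)
              (UA.toLinearEquiv.conj (left (Ancilla n) (eA.obs P j))
                - left KA (onQubit (pauli P) j)) (juxt (eprState n) extra)‖
            ≤ C * ((n : ℝ) ^ (5 / 2 : ℝ) * √δ) ∧
          ‖right (Qubits n ⊗[ℂ] KA)
              (UB.toLinearEquiv.conj (left (Ancilla n) (eB.obs P j))
                - left KB (onQubit (pauli P) j)) (juxt (eprState n) extra)‖
            ≤ C * ((n : ℝ) ^ (5 / 2 : ℝ) * √δ)) := by
  -- Any constant from `55 · 360 = 19800` on works.
  refine ⟨20000, by norm_num, ?_⟩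
  intro n hn HA _ _ _ HB _ _ _ S δ hδ hS
  have hδ' : 0 ≤ n * √δ := by positivity
  have D := S.nearPauli hn hδ hS
  have hε : 55 * (√n * (n * (360 * (n * √δ)))) ≤ 20000 * ((n : ℝ) ^ (5 / 2 : ℝ) * √δ) := by
    rw [← sqrt_mul_mul_eq_rpow (by omega) δ]
    have : 0 ≤ √n * (n * (n * √δ)) := by positivity
    linarith
  obtain ⟨KA, iA, jA, fA, KB, iB, jB, fB, UA, UB, extra, h₁, h₂, h₃⟩ :=
    D.exists_isometries (by omega)
  refine ⟨HA ⊗[ℂ] Qubits 1, inferInstance, inferInstance, inferInstance, HB ⊗[ℂ] Qubits 1,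
    inferInstance, inferInstance, inferInstance, S.alice.extension, S.bob.extension,
    S.extState, rfl, fun i => ?_, fun i => ?_, fun i j hij P Q => ⟨?_, ?_⟩, fun i P => ?_,
    KA, iA, jA, fA, KB, iB, jB, fB, UA, UB, extra, h₁, h₂.trans hε,
    fun j P => ⟨(h₃ j P).1.trans hε, (h₃ j P).2.trans hε⟩⟩
  · exact (Strategy.norm_embedding_X_sub_le hn hδ hS i).trans (by linarith)
  · exact (Strategy.norm_embedding_right_obs_sub_le hn hδ hS 1 i).trans (by linarith)
  · exact (D.norm_left_comm P Q i j hij).trans (by linarith)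
  · exact (D.norm_right_comm P Q i j hij).trans (by linarith)
  · exact (norm_map_sub_self (D.left_refl P i) _).trans_le
      ((D.norm_sub P i).trans (by linarith))
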